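/- Let $G_{(1,2)}=\langle a,b \mid a^{a^b}=a^2\rangle$ be the Baumslag group, where $g^h=hgh^{-1}$, so that the defining relation reads $bab^{-1}\,a\,ba^{-1}b^{-1}=a^2$. The word problem of $G_{(1,2)}$ is decidable in time $\mathcal{O}(n^3)$ on a random-access machine. That is, there is a program of a random-access machine (unit-cost instructions for addition, subtraction, multiplication and integer division, indirect addressing and conditional jumps; machine words of $\mathcal{O}(\log n)$ bits, i.e. all numbers that occur are bounded by a fixed polynomial in $n$) which, given a word $w$ of length $n$ over the letters $a,a^{-1},b,b^{-1}$, decides after at most $\mathcal{O}(n^3)$ steps whether $w$ represents the identity of $G_{(1,2)}$. -/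

import Mathlib

open Filter Asymptotics

/-! ### Random-access machines -/

namespace RAM

/-- Instructions of a random-access machine. The machine has registers and a memory, both
indexed by `ℕ` and holding natural numbers; indirect addressing is done by `load` and `store`. -/
inductive Instr : Type
  /-- `r := c` -/
  | const (r c : ℕ)
  /-- `r := s` -/
  | move (r s : ℕ)
  /-- `r := s + t` -/
  | add (r s t : ℕ)
  /-- `r := max (s - t) 0` -/
  | sub (r s t : ℕ)
  /-- `r := s * t` -/
  | mul (r s t : ℕ)
  /-- `r := ⌊s / t⌋`, and `0` if `t = 0` -/
  | div (r s t : ℕ)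
  /-- `r := memory[s]` -/
  | load (r s : ℕ)
  /-- `memory[r] := s` -/
  | store (r s : ℕ)
  /-- continue at line `l` -/
  | jump (l : ℕ)
  /-- continue at line `l` if `r = 0`, and at the next line otherwise -/
  | jumpIfZero (r l : ℕ)
  /-- stop -/
  | halt

/-- A program is a finite list of instructions (with line numbers starting at `0`). -/
abbrev Program : Type := List Instr

/-- A configuration: program counter, contents of the registers, contents of the memory. -/
@[ext]
structure Config : Type where
  pc : ℕ
  reg : ℕ → ℕ
  mem : ℕ → ℕ

/-- Write `v` into register `r` and go to the next line. -/
def Config.setReg (c : Config) (r v : ℕ) : Config :=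
  ⟨c.pc + 1, Function.update c.reg r v, c.mem⟩

/-- Execution of one instruction, at unit cost. -/
def exec (c : Config) : Instr → Config
  | .const r k => c.setReg r k
  | .move r s => c.setReg r (c.reg s)
  | .add r s t => c.setReg r (c.reg s + c.reg t)
  | .sub r s t => c.setReg r (c.reg s - c.reg t)
  | .mul r s t => c.setReg r (c.reg s * c.reg t)
  | .div r s t => c.setReg r (c.reg s / c.reg t)
  | .load r s => c.setReg r (c.mem (c.reg s))
  | .store r s => ⟨c.pc + 1, c.reg, Function.update c.mem (c.reg r) (c.reg s)⟩
  | .jump l => ⟨l, c.reg, c.mem⟩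
  | .jumpIfZero r l => ⟨if c.reg r = 0 then l else c.pc + 1, c.reg, c.mem⟩
  | .halt => c

/-- The machine has halted if it is at a `halt` instruction or beyond the end of the program. -/
def Halted (P : Program) (c : Config) : Prop :=
  P[c.pc]? = none ∨ P[c.pc]? = some Instr.halt

/-- One step of the machine; a configuration that has halted does not change any more. -/
def step (P : Program) (c : Config) : Config :=
  match P[c.pc]? with
  | none => c
  | some i => exec c i

/-- The configuration after `t` steps. -/
def run (P : Program) (c : Config) (t : ℕ) : Config := (step P)^[t] c

/-- The initial configuration on a finite input sequence: the input `x₀, …, xₙ₋₁` stands in the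
memory cells `0, …, n - 1`, its length `n` in register `0`, and everything else is `0`. -/
def init (x : List ℕ) : Config where
  pc := 0
  reg := fun i => if i = 0 then x.length else 0
  mem := fun i => x.getD i 0

open Classical in
/-- The language `L` over the alphabet `α`, whose letters are coded by natural numbers, is
decidable in time `O(f)` on a random-access machine: there are a program `P` and a function
`T ∈ O(f)` such that on each input word `w` of length `n`, `P` halts within `T n` steps and then
register `0` holds `1` if `w ∈ L` and `0` if `w ∉ L`. Each step has unit cost; accordingly
machine words have `O(log n)` bits, that is, no number that occurs in a register or a memory cell
in the course of the computation exceeds a fixed polynomial in `n`. -/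
def DecidableInTime {α : Type*} (code : α → ℕ) (L : Language α) (f : ℕ → ℝ) : Prop :=
  ∃ (P : Program) (T : ℕ → ℕ) (B : Polynomial ℕ),
    (fun n => (T n : ℝ)) =O[atTop] f ∧
    ∀ w : List α,
      let c := init (w.map code)
      Halted P (run P c (T w.length)) ∧
      (run P c (T w.length)).reg 0 = (if w ∈ L then 1 else 0) ∧
      ∀ t i, (run P c t).reg i ≤ B.eval w.length ∧ (run P c t).mem i ≤ B.eval w.length

end RAM

/-! ### The word problem and the Baumslag group -/

/-- The word problem of the group `⟨ι | rels⟩`: the set of all words over the generators and their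
inverses (`(i, true)` is the `i`-th generator and `(i, false)` its inverse) that represent `1`. -/
def wordProblem {ι : Type*} (rels : Set (FreeGroup ι)) : Language (ι × Bool) :=
  {w : List (ι × Bool) | PresentedGroup.mk rels (FreeGroup.mk w) = 1}

/-- Numbering of the letters `a⁻¹, a, b⁻¹, b` by `0, 1, 2, 3`, where `a`, `b` are the generators
number `0` and `1`. -/
def letterCode (x : Fin 2 × Bool) : ℕ := 2 * (x.1 : ℕ) + (if x.2 then 1 else 0)

namespace Baumslag

/-- The generator `a` of the free group on `a`, `b`. -/
def a : FreeGroup (Fin 2) := FreeGroup.of 0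

/-- The generator `b` of the free group on `a`, `b`. -/
def b : FreeGroup (Fin 2) := FreeGroup.of 1

/-- Conjugation `g ^ h = h g h⁻¹`. -/
def conj (g h : FreeGroup (Fin 2)) : FreeGroup (Fin 2) := h * g * h⁻¹

/-- The defining relation `a ^ (a ^ b) = a²` of the Baumslag group `G₍₁,₂₎ = ⟨a, b | a^(a^b) = a²⟩`,
as a relator. -/
def rels : Set (FreeGroup (Fin 2)) := {conj a (conj a b) * (a ^ 2)⁻¹}

end Baumslag

/-!
Put `t = b a b⁻¹`, so that the defining relation reads `t a t⁻¹ = a²`. The subgroup generated by `a`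
and `t` is a quotient of `ℤ[1/2] ⋊ ℤ`, and the Baumslag group maps to the HNN extension of
`ℚ ⋊ ℤ` (`Dyad`) in which the stable letter conjugates `(k, 0)` into `(0, k)`. A prefix of the input
is kept as a reduced stack `g₁ b ^ u₁ ⋯ gₗ b ^ uₗ g` of elements `(r, m)` of `ℤ[1/2] ⋊ ℤ` and
powers `b ^ (±1)` (`IsStack`). A letter `a ^ (±1)` adds `± 2 ^ m` to the number `r` of the top
element; a letter `b ^ (±1)` is pushed, unless it makes a pinch `b (k, 0) b⁻¹ = (0, k)` or
`b⁻¹ (0, m) b = (m, 0)` with the top of the stack. By Britton's lemma the word represents `1`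
exactly if the stack is `(0, 0)` in the end (`IsStack.eq_one_iff`); it is irrelevant whether the
subgroup generated by `a` and `t` embeds.

The numbers `r`, `m` may be towers of exponentials, so they are stored as sums. Each letter
`a ^ (±1)` of the input stands for one term `± 2 ^ E`, whose exponent `E` is itself an integral
linear combination of the terms of other letters, with coefficients at most `n`: one row of a square
array. The two components of a stack element are the sums of the terms in two sets of letters.
A pinch `b (k, 0) b⁻¹` turns the first set into the scaling part of the element below, and a pinch
`b⁻¹ (0, m) b` turns the second set into its translation part, after multiplication by a power of
`2`: the row that represents the exponent of that power is added to the rows of all its letters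
(`shift`). The letters of an old scaling part that has become `0` are kept, as rows may refer to
them. Hence no new terms are ever needed.

All letters are held in one list, sorted by their exponents, along with the powers of `2` by which
neighbours differ, cut off at a bound `cap` of order `n²`. This makes it possible to evaluate a sum
of terms with small coefficients in time `O(n)`, in the sense that it is decided whether it is an
integer, and if so the integer is computed up to saturation (`evalSum_spec`). The terms with negative
exponents are summed from the smallest exponent on, where each step is an exact division (the sum is
not an integer if one of the divisions is impossible); the terms with positive exponents are summed
from the largest on, and once the partial sum is cut off, it exceeds all that may still be
subtracted (`Near`). Applied to the difference of two rows, this compares exponents in time `O(n)`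
(`compare_spec`), and applied to a set of letters, it detects pinches (`test_spec`). A shift changes
the exponents of one set of letters by the same amount, and so keeps the order within that set and
within its complement; therefore the list is sorted again by merging two lists, which takes `O(n)`
comparisons (`shift_resort`). So each letter of the input costs time `O(n²)`. The invariant of the
whole computation is `Inv`.

The program is written in a language of commands with loops of exactly `n + 16` iterations each and
with arithmetic that saturates at `cap`. Its translation to machine code (`decidableInTime_of_cmd`)
has a running time of degree equal to the nesting depth of the loops, here `3`, and all numbers that
occur are at most `cap²`, whatever the program.
-/

set_option linter.unusedSectionVars false

/-! ### The group `ℚ ⋊ ℤ` and the HNN extension -/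

/-- The group `ℚ ⋊ ℤ` in which `k : ℤ` acts on `ℚ` as multiplication by `2 ^ k`. It contains the
Baumslag–Solitar group `⟨a, t | t a t⁻¹ = a²⟩ = ℤ[1/2] ⋊ ℤ` with `a = (1, 0)` and `t = (0, 1)`. -/
@[ext]
structure Dyad where
  /-- the translation part -/
  r : ℚ
  /-- the exponent of the scaling part -/
  m : ℤ

namespace Dyad

instance : Mul Dyad := ⟨fun g h => ⟨g.r + 2 ^ g.m * h.r, g.m + h.m⟩⟩
instance : One Dyad := ⟨⟨0, 0⟩⟩
instance : Inv Dyad := ⟨fun g => ⟨-(2 ^ (-g.m) * g.r), -g.m⟩⟩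

theorem mul_def (g h : Dyad) : g * h = ⟨g.r + 2 ^ g.m * h.r, g.m + h.m⟩ := rfl
theorem one_def : (1 : Dyad) = ⟨0, 0⟩ := rfl
theorem inv_def (g : Dyad) : g⁻¹ = ⟨-(2 ^ (-g.m) * g.r), -g.m⟩ := rfl

instance : Group Dyad := Group.ofLeftAxioms
  (fun a b c => by
    simp only [mul_def, zpow_add₀ (two_ne_zero : (2 : ℚ) ≠ 0), Dyad.mk.injEq]
    constructor <;> ring)
  (fun a => by simp [mul_def, one_def])
  (fun a => by simp [mul_def, one_def, inv_def])

/-- `k ↦ (k, 0)` -/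
def ofInt : Multiplicative ℤ →* Dyad where
  toFun k := ⟨(Multiplicative.toAdd k : ℤ), 0⟩
  map_one' := by simp [one_def]
  map_mul' x y := by simp [mul_def]

/-- `k ↦ (0, k)` -/
def ofScale : Multiplicative ℤ →* Dyad where
  toFun k := ⟨0, Multiplicative.toAdd k⟩
  map_one' := by simp [one_def]
  map_mul' x y := by simp [mul_def]

theorem ofInt_injective : Function.Injective ofInt := fun x y h => by
  simpa [ofInt] using h

theorem ofScale_injective : Function.Injective ofScale := fun x y h => by
  simpa [ofScale] using h

theorem mem_range_ofInt {g : Dyad} : g ∈ ofInt.range ↔ g.m = 0 ∧ ∃ k : ℤ, g.r = k := by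
  constructor
  · rintro ⟨k, rfl⟩
    exact ⟨rfl, _, rfl⟩
  · rintro ⟨h, k, hk⟩
    exact ⟨Multiplicative.ofAdd k, by ext <;> simp [ofInt, h, hk]⟩

theorem mem_range_ofScale {g : Dyad} : g ∈ ofScale.range ↔ g.r = 0 := by
  constructor
  · rintro ⟨k, rfl⟩
    rfl
  · intro h
    exact ⟨Multiplicative.ofAdd g.m, by ext <;> simp [ofScale, h]⟩

/-- The isomorphism `(k, 0) ↦ (0, k)` of the two associated subgroups. -/
noncomputable def assoc : ofInt.range ≃* ofScale.range :=
  (MonoidHom.ofInjective ofInt_injective).symm.trans (MonoidHom.ofInjective ofScale_injective)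

theorem assoc_ofInt (k : Multiplicative ℤ) :
    (assoc ⟨ofInt k, k, rfl⟩ : Dyad) = ofScale k := by
  have : (MonoidHom.ofInjective ofInt_injective).symm ⟨ofInt k, k, rfl⟩ = k := by
    rw [MulEquiv.symm_apply_eq]; rfl
  simp only [assoc, MulEquiv.trans_apply, this]
  rfl

end Dyad

/-- The HNN extension of `ℚ ⋊ ℤ` with stable letter conjugating `(k, 0)` into `(0, k)`. The
Baumslag group maps to it. -/
abbrev DyadHNN : Type :=
  HNNExtension Dyad Dyad.ofInt.range Dyad.ofScale.range Dyad.assoc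

namespace Baumslag

/-- The Baumslag group `⟨a, b | a^(a^b) = a²⟩`. -/
abbrev Grp : Type := PresentedGroup rels

/-- The image of `a` in the Baumslag group. -/
def ga : Grp := PresentedGroup.of 0

/-- The image of `b` in the Baumslag group. -/
def gb : Grp := PresentedGroup.of 1

/-- The conjugate `b a b⁻¹`. -/
def gt : Grp := gb * ga * gb⁻¹

theorem gt_mul_ga : gt * ga * gt⁻¹ = ga ^ (2 : ℤ) := by
  have h : PresentedGroup.mk rels (conj a (conj a b) * (a ^ 2)⁻¹) = 1 :=
    PresentedGroup.one_of_mem (rels := rels) (x := conj a (conj a b) * (a ^ 2)⁻¹) rfl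
  rw [map_mul, map_inv, mul_inv_eq_one] at h
  exact h

theorem gt_pow_mul_ga (i : ℕ) : gt ^ i * ga * (gt ^ i)⁻¹ = ga ^ (2 ^ i : ℤ) := by
  induction i with
  | zero => simp
  | succ i ih =>
    calc gt ^ (i + 1) * ga * (gt ^ (i + 1))⁻¹
        = gt * (gt ^ i * ga * (gt ^ i)⁻¹) * gt⁻¹ := by rw [pow_succ']; group
      _ = (gt * ga * gt⁻¹) ^ (2 ^ i : ℤ) := by rw [ih, conj_zpow]
      _ = ga ^ (2 ^ (i + 1) : ℤ) := by rw [gt_mul_ga, ← zpow_mul, pow_succ']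

/-- `y` is the element of the Baumslag group that stands for `(r, 0)`: conjugating it by a
sufficiently high power of `b a b⁻¹` gives the integral power of `a` that it ought to give. -/
def IsShift (y : Grp) (r : ℚ) : Prop :=
  ∃ i₀ : ℤ, ∀ i ≥ i₀, ∃ j : ℤ, r * 2 ^ i = j ∧ gt ^ i * y * (gt ^ i)⁻¹ = ga ^ j

theorem isShift_zpow (k : ℤ) : IsShift (ga ^ k) k := by
  refine ⟨0, fun i hi => ?_⟩
  lift i to ℕ using hi
  refine ⟨k * 2 ^ i, by push_cast; simp, ?_⟩
  rw [zpow_natCast, ← conj_zpow, gt_pow_mul_ga, ← zpow_mul, mul_comm]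

theorem isShift_one : IsShift 1 0 := by simpa using isShift_zpow 0

theorem IsShift.mul {x y : Grp} {r s : ℚ} (hx : IsShift x r) (hy : IsShift y s) :
    IsShift (x * y) (r + s) := by
  obtain ⟨i₁, h₁⟩ := hx
  obtain ⟨i₂, h₂⟩ := hy
  refine ⟨max i₁ i₂, fun i hi => ?_⟩
  obtain ⟨j₁, e₁, f₁⟩ := h₁ i (le_trans (le_max_left _ _) hi)
  obtain ⟨j₂, e₂, f₂⟩ := h₂ i (le_trans (le_max_right _ _) hi)
  refine ⟨j₁ + j₂, by push_cast; rw [add_mul, e₁, e₂], ?_⟩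
  rw [zpow_add, ← f₁, ← f₂]; group

theorem IsShift.conj {y : Grp} {r : ℚ} (hy : IsShift y r) (m : ℤ) :
    IsShift (gt ^ m * y * (gt ^ m)⁻¹) (2 ^ m * r) := by
  obtain ⟨i₀, h⟩ := hy
  refine ⟨i₀ - m, fun i hi => ?_⟩
  obtain ⟨j, e, f⟩ := h (i + m) (by omega)
  refine ⟨j, ?_, ?_⟩
  · rw [← e, zpow_add₀ two_ne_zero]; ring
  · rw [← f, zpow_add]; group

/-- An element that stands for an integer is a power of `a`. No injectivity is needed: a conjugate of
it by some power of `t` agrees with the same conjugate of a power of `a`. -/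
theorem IsShift.eq_zpow {y : Grp} {r : ℚ} (hy : IsShift y r) {k : ℤ} (hk : r = k) :
    y = ga ^ k := by
  subst hk
  obtain ⟨i₁, h₁⟩ := hy
  obtain ⟨i₂, h₂⟩ := isShift_zpow k
  obtain ⟨j₁, e₁, f₁⟩ := h₁ (max i₁ i₂) (le_max_left _ _)
  obtain ⟨j₂, e₂, f₂⟩ := h₂ (max i₁ i₂) (le_max_right _ _)
  have : j₁ = j₂ := by exact_mod_cast e₁.symm.trans e₂
  subst this
  simpa using f₁.trans f₂.symm

/-- `x` is the element of the Baumslag group that stands for `g`; this is possible only if `g` lies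
in `ℤ[1/2] ⋊ ℤ`. -/
def Rep (x : Grp) (g : Dyad) : Prop := IsShift (x * (gt ^ g.m)⁻¹) g.r

theorem rep_one : Rep 1 1 := by simpa [Rep, Dyad.one_def] using isShift_one

theorem rep_zpow (k : ℤ) : Rep (ga ^ k) ⟨k, 0⟩ := by simpa [Rep] using isShift_zpow k

theorem rep_gt_zpow (k : ℤ) : Rep (gt ^ k) ⟨0, k⟩ := by simpa [Rep] using isShift_one

theorem Rep.mul {x y : Grp} {g h : Dyad} (hx : Rep x g) (hy : Rep y h) : Rep (x * y) (g * h) := by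
  have := IsShift.mul hx (hy.conj g.m)
  have e : x * y * (gt ^ (g * h).m)⁻¹
      = x * (gt ^ g.m)⁻¹ * (gt ^ g.m * (y * (gt ^ h.m)⁻¹) * (gt ^ g.m)⁻¹) := by
    simp only [Dyad.mul_def]
    group
  rw [Rep, e]
  exact this

theorem Rep.eq_zpow {x : Grp} {g : Dyad} (hx : Rep x g) (hm : g.m = 0) {k : ℤ} (hk : g.r = k) :
    x = ga ^ k := by
  simpa [hm] using IsShift.eq_zpow hx hk

theorem Rep.eq_gt_zpow {x : Grp} {g : Dyad} (hx : Rep x g) (hr : g.r = 0) : x = gt ^ g.m := by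
  have := IsShift.eq_zpow hx (k := 0) (by simpa using hr)
  simpa [mul_inv_eq_one] using this

theorem conj_of_int (k : ℤ) :
    (HNNExtension.t * HNNExtension.of (⟨k, 0⟩ : Dyad) * HNNExtension.t⁻¹ : DyadHNN)
      = HNNExtension.of ⟨0, k⟩ := by
  have := HNNExtension.equiv_eq_conj (φ := Dyad.assoc) ⟨Dyad.ofInt (Multiplicative.ofAdd k), _, rfl⟩
  rw [Dyad.assoc_ofInt] at this
  exact this.symm

/-- The homomorphism from the Baumslag group to the HNN extension of `ℚ ⋊ ℤ`. -/
noncomputable def toHNN : Grp →* DyadHNN :=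
  PresentedGroup.toGroup (f := ![HNNExtension.of ⟨1, 0⟩, HNNExtension.t]) (by
    have key := conj_of_int 1
    rintro r hr
    rw [Set.mem_singleton_iff.1 hr]
    simp only [conj, a, b, map_mul, map_inv, map_pow, FreeGroup.lift_apply_of, Matrix.cons_val_zero,
      Matrix.cons_val_one]
    push_cast at key
    rw [key, ← map_inv, ← map_mul, ← map_mul, ← map_pow, ← map_inv, ← map_mul]
    refine (congrArg HNNExtension.of ?_).trans (map_one HNNExtension.of)
    simp [Dyad.mul_def, Dyad.one_def, Dyad.inv_def, pow_two]
    norm_num)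

theorem toHNN_ga : toHNN ga = HNNExtension.of ⟨1, 0⟩ := by
  simp [toHNN, ga]

theorem toHNN_gb : toHNN gb = HNNExtension.t := by
  simp [toHNN, gb]

theorem toHNN_gt : toHNN gt = HNNExtension.of ⟨0, 1⟩ := by
  have := conj_of_int 1
  simpa [gt, toHNN_ga, toHNN_gb] using this

theorem mk_zero_one_zpow (k : ℤ) : (⟨0, 1⟩ : Dyad) ^ k = ⟨0, k⟩ := by
  have := map_zpow Dyad.ofScale (Multiplicative.ofAdd 1) k
  rw [← ofAdd_zsmul] at this
  simpa [Dyad.ofScale] using this.symm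

theorem mk_one_zero_zpow (k : ℤ) : (⟨1, 0⟩ : Dyad) ^ k = ⟨k, 0⟩ := by
  have := map_zpow Dyad.ofInt (Multiplicative.ofAdd 1) k
  rw [← ofAdd_zsmul] at this
  simpa [Dyad.ofInt] using this.symm

theorem IsShift.toHNN {y : Grp} {r : ℚ} (hy : IsShift y r) : toHNN y = HNNExtension.of ⟨r, 0⟩ := by
  obtain ⟨i, h⟩ := hy
  obtain ⟨j, e, f⟩ := h i le_rfl
  have hy : y = (gt ^ i)⁻¹ * ga ^ j * gt ^ i := by rw [← f]; group
  rw [hy]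
  simp only [map_mul, map_inv, map_zpow, toHNN_ga, toHNN_gt, ← map_zpow (HNNExtension.of),
    mk_one_zero_zpow, mk_zero_one_zpow]
  rw [← map_inv, ← map_mul, ← map_mul]
  congr 1
  simp only [Dyad.mul_def, Dyad.inv_def, ← e]
  ext <;> simp
  field_simp

theorem Rep.toHNN {x : Grp} {g : Dyad} (hx : Rep x g) :
    toHNN x = HNNExtension.of g := by
  have h := IsShift.toHNN hx
  simp only [map_mul, map_inv, map_zpow, toHNN_gt, ← map_zpow (HNNExtension.of),
    mk_zero_one_zpow, mul_inv_eq_iff_eq_mul] at h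
  rw [h, ← map_mul]
  simp [Dyad.mul_def]

/-! ### Britton stacks -/

/-- The condition that a letter `b ^ u` may follow the piece `g` on top of the stack `rest` without
making a pinch: `rest` is empty, or `b ^ u' g b ^ u` with `u'` the exponent on top of `rest` is
reduced. -/
def NoPinch (g : Dyad) (u : ℤˣ) (rest : List (Dyad × ℤˣ)) : Prop :=
  ∀ p ∈ rest.head?, g ∈ HNNExtension.toSubgroup Dyad.ofInt.range Dyad.ofScale.range p.2 → p.2 = u

/-- `IsStack x g [(gₗ, uₗ), …, (g₁, u₁)]` says that `x = g₁ b ^ u₁ ⋯ gₗ b ^ uₗ g`, where the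
`gᵢ` and `g` stand for elements of the Baumslag group, and that this product is reduced. -/
inductive IsStack : Grp → Dyad → List (Dyad × ℤˣ) → Prop
  | nil {x : Grp} {g : Dyad} (hx : Rep x g) : IsStack x g []
  | cons {x y : Grp} {g g' : Dyad} {rest : List (Dyad × ℤˣ)} {u : ℤˣ} (hy : IsStack y g' rest)
      (hx : Rep x g) (hu : NoPinch g' u rest) : IsStack (y * gb ^ (u : ℤ) * x) g ((g', u) :: rest)

theorem IsStack.mul {x y : Grp} {g h : Dyad} {rest : List (Dyad × ℤˣ)} (hx : IsStack x g rest)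
    (hy : Rep y h) : IsStack (x * y) (g * h) rest := by
  cases hx with
  | nil hx => exact .nil (hx.mul hy)
  | cons h₁ h₂ h₃ =>
    rw [mul_assoc]
    exact .cons h₁ (h₂.mul hy) h₃

theorem IsStack.push {x : Grp} {g : Dyad} {u : ℤˣ} {rest : List (Dyad × ℤˣ)}
    (hx : IsStack x g rest) (hu : NoPinch g u rest) :
    IsStack (x * gb ^ (u : ℤ)) 1 ((g, u) :: rest) := by
  simpa using IsStack.cons hx rep_one hu

/-- The pinch `b (k, 0) b⁻¹ = (0, k)`. -/
theorem IsStack.pop_one {x : Grp} {g g' : Dyad} {rest : List (Dyad × ℤˣ)}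
    (hx : IsStack x g ((g', 1) :: rest)) (hm : g.m = 0) {k : ℤ} (hk : g.r = k) :
    IsStack (x * gb⁻¹) (g' * ⟨0, k⟩) rest := by
  cases hx with
  | cons h₁ h₂ h₃ =>
    rw [h₂.eq_zpow hm hk]
    convert h₁.mul (rep_gt_zpow k) using 1
    rw [gt, conj_zpow]
    simp [mul_assoc]

/-- The pinch `b⁻¹ (0, m) b = (m, 0)`. -/
theorem IsStack.pop_neg_one {x : Grp} {g g' : Dyad} {rest : List (Dyad × ℤˣ)}
    (hx : IsStack x g ((g', -1) :: rest)) (hr : g.r = 0) :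
    IsStack (x * gb) (g' * ⟨g.m, 0⟩) rest := by
  cases hx with
  | cons h₁ h₂ h₃ =>
    rw [h₂.eq_gt_zpow hr]
    convert h₁.mul (rep_zpow g.m) using 1
    rw [gt, conj_zpow]
    simp [mul_assoc]

/-- The image of a stack in the HNN extension is the value of a reduced word, whose last piece is the
top piece of the stack. -/
theorem IsStack.exists_reduced {x : Grp} {g : Dyad} {rest : List (Dyad × ℤˣ)}
    (hx : IsStack x g rest) :
    ∃ (g₀ : Dyad) (l : List (ℤˣ × Dyad)),
      toHNN x = HNNExtension.of g₀ *
        (l.map fun p => HNNExtension.t ^ (p.1 : ℤ) * HNNExtension.of p.2).prod ∧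
      l.IsChain (fun p q => p.2 ∈ HNNExtension.toSubgroup Dyad.ofInt.range Dyad.ofScale.range p.1 →
        p.1 = q.1) ∧
      l.getLast? = rest.head?.map fun p => (p.2, g) := by
  induction hx with
  | nil hx => exact ⟨_, [], by simpa using hx.toHNN, by simp, by simp⟩
  | @cons x y g g' rest u hy hx hu ih =>
    obtain ⟨g₀, l, h₁, h₂, h₃⟩ := ih
    refine ⟨g₀, l ++ [(u, g)], ?_, ?_, by simp⟩
    · simp [h₁, toHNN_gb, hx.toHNN, mul_assoc]
    · rw [List.isChain_append]
      refine ⟨h₂, by simp, ?_⟩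
      intro p hp q hq
      simp only [List.head?_cons, Option.mem_def, Option.some.injEq] at hq
      rw [h₃] at hp
      simp only [Option.map_eq_some_iff, Option.mem_def] at hp
      obtain ⟨c, hc, rfl⟩ := hp
      subst hq
      exact hu c hc

/-- A nontrivial stack is not the identity, by Britton's lemma. -/
theorem IsStack.eq_one_iff {x : Grp} {g : Dyad} {rest : List (Dyad × ℤˣ)}
    (hx : IsStack x g rest) : x = 1 ↔ rest = [] ∧ g = 1 := by
  constructor
  · intro h1
    have hrest : rest = [] := by
      obtain ⟨g₀, l, h₁, h₂, h₃⟩ := hx.exists_reduced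
      let w : HNNExtension.NormalWord.ReducedWord Dyad Dyad.ofInt.range Dyad.ofScale.range :=
        ⟨g₀, l, h₂⟩
      have hw : w.toList = [] := by
        refine HNNExtension.ReducedWord.toList_eq_nil_of_mem_of_range Dyad.assoc w ⟨1, ?_⟩
        rw [map_one, ← map_one toHNN, ← h1, h₁]
        rfl
      have hl : l = [] := hw
      subst hl
      simpa using h₃.symm
    refine ⟨hrest, ?_⟩
    subst hrest
    cases hx with
    | nil hx =>
      have := hx.toHNN
      rw [h1, map_one, ← map_one (HNNExtension.of (φ := Dyad.assoc))] at this
      exact (HNNExtension.of_injective _ this).symm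
  · rintro ⟨rfl, rfl⟩
    cases hx with
    | nil hx => simpa using hx.eq_zpow (k := 0) rfl (by simp [Dyad.one_def])

end Baumslag

/-! ### A structured language with bounded loops -/

namespace RAM

/-- The number of iterations of each loop on the input `x`. -/
def size (x : List ℕ) : ℕ := x.length + 16

/-- The value at which additions and multiplications saturate on the input `x`. -/
def cap (x : List ℕ) : ℕ := 8 * size x ^ 2

/-- Expressions over variables `V` and arrays `A`. -/
inductive Ex (V A : Type) : Type
  /-- a small literal -/
  | lit (c : Fin 16)
  /-- a variable -/
  | var (v : V)
  /-- the number `size x` -/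
  | size
  /-- a letter of the input, and `0` beyond its end -/
  | inp (e : Ex V A)
  /-- an array element -/
  | get (a : A) (e : Ex V A)
  /-- sum, saturating at `cap x` -/
  | add (e f : Ex V A)
  /-- truncated difference -/
  | sub (e f : Ex V A)
  /-- product, saturating at `cap x` -/
  | mul (e f : Ex V A)
  /-- quotient, rounded down -/
  | div (e f : Ex V A)

/-- Commands. The only loops are those that run through all numbers below `size x`. -/
inductive Cmd (V A : Type) : Type
  /-- do nothing -/
  | skip
  /-- `v := e` -/
  | set (v : V) (e : Ex V A)
  /-- `a[e] := f` -/
  | put (a : A) (e f : Ex V A)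
  /-- first `c`, then `d` -/
  | seq (c d : Cmd V A)
  /-- `c` if `e ≠ 0`, and `d` otherwise -/
  | ite (e : Ex V A) (c d : Cmd V A)
  /-- `c` for `v = 0, …, size x - 1` -/
  | loop (v : V) (c : Cmd V A)

/-- Values of the variables and contents of the arrays. -/
structure Store (V A : Type) : Type where
  /-- values of the variables -/
  var : V → ℕ
  /-- contents of the arrays -/
  arr : A → ℕ → ℕ

/-- `iter f k s` applies `f 0`, `f 1`, …, `f (k - 1)` to `s`, in this order. -/
def iter {S : Type*} (f : ℕ → S → S) : ℕ → S → S
  | 0, s => s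
  | k + 1, s => f k (iter f k s)

/-- An invariant of the iterated maps. -/
theorem iter_induction {S : Type*} {f : ℕ → S → S} {s : S} {n : ℕ} (I : ℕ → S → Prop) (h0 : I 0 s)
    (hs : ∀ k < n, ∀ t, I k t → I (k + 1) (f k t)) : I n (iter f n s) := by
  have : ∀ k ≤ n, I k (iter f k s) := by
    intro k
    induction k with
    | zero => intro _; exact h0
    | succ k ih => intro hk; exact hs k (by omega) _ (ih (by omega))
  exact this n le_rfl

variable {V A : Type} [DecidableEq V] [DecidableEq A]

namespace Store

/-- Change the value of a variable. -/
def setVar (s : Store V A) (v : V) (n : ℕ) : Store V A := ⟨Function.update s.var v n, s.arr⟩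

/-- Change an array element. -/
def setArr (s : Store V A) (a : A) (i n : ℕ) : Store V A :=
  ⟨s.var, Function.update s.arr a (Function.update (s.arr a) i n)⟩

@[simp] theorem setVar_var (s : Store V A) (v : V) (n : ℕ) (w : V) :
    (s.setVar v n).var w = if w = v then n else s.var w := by
  simp [setVar, Function.update_apply]

@[simp] theorem setVar_arr (s : Store V A) (v : V) (n : ℕ) : (s.setVar v n).arr = s.arr := rfl

@[simp] theorem setArr_var (s : Store V A) (a : A) (i n : ℕ) : (s.setArr a i n).var = s.var := rfl

@[simp] theorem setArr_arr (s : Store V A) (a : A) (i n : ℕ) (a' : A) (j : ℕ) :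
    (s.setArr a i n).arr a' j = if a' = a ∧ j = i then n else s.arr a' j := by
  by_cases h : a' = a
  · subst h; simp [setArr, Function.update_apply]
  · simp [setArr, h]

/-- All values are at most `cap x`. -/
def Bdd (x : List ℕ) (s : Store V A) : Prop :=
  (∀ v, s.var v ≤ cap x) ∧ ∀ a i, s.arr a i ≤ cap x

theorem Bdd.setVar {x : List ℕ} {s : Store V A} (h : s.Bdd x) (v : V) {n : ℕ} (hn : n ≤ cap x) :
    (s.setVar v n).Bdd x := by
  refine ⟨fun w => ?_, h.2⟩
  rw [setVar_var]
  split_ifs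
  exacts [hn, h.1 w]

theorem Bdd.setArr {x : List ℕ} {s : Store V A} (h : s.Bdd x) (a : A) (i : ℕ) {n : ℕ}
    (hn : n ≤ cap x) : (s.setArr a i n).Bdd x := by
  refine ⟨h.1, fun b j => ?_⟩
  rw [setArr_arr]
  split_ifs
  exacts [hn, h.2 b j]

end Store

/-- The value of an expression. -/
def Ex.eval (x : List ℕ) (s : Store V A) : Ex V A → ℕ
  | .lit c => c
  | .var v => s.var v
  | .size => RAM.size x
  | .inp e => x.getD (e.eval x s) 0
  | .get a e => s.arr a (e.eval x s)
  | .add e f => min (e.eval x s + f.eval x s) (cap x)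
  | .sub e f => e.eval x s - f.eval x s
  | .mul e f => min (e.eval x s * f.eval x s) (cap x)
  | .div e f => e.eval x s / f.eval x s

/-- The effect of a command. -/
def Cmd.eval (x : List ℕ) : Cmd V A → Store V A → Store V A
  | .skip, s => s
  | .set v e, s => s.setVar v (e.eval x s)
  | .put a e f, s => s.setArr a (e.eval x s) (f.eval x s)
  | .seq c d, s => d.eval x (c.eval x s)
  | .ite e c d, s => if e.eval x s = 0 then d.eval x s else c.eval x s
  | .loop v c, s => iter (fun k t => c.eval x (t.setVar v k)) (RAM.size x) s

theorem size_le_cap (x : List ℕ) : size x ≤ cap x := by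
  unfold cap; nlinarith [Nat.zero_le (size x)]

theorem length_le_size (x : List ℕ) : x.length + 16 ≤ size x := le_rfl

theorem le_cap_of_le (x : List ℕ) {c : ℕ} (hc : c ≤ 2048) : c ≤ cap x := by
  have := length_le_size x
  unfold cap; nlinarith

theorem Ex.eval_le {x : List ℕ} (hx : ∀ i, x.getD i 0 ≤ cap x) {s : Store V A} (hs : s.Bdd x)
    (e : Ex V A) : e.eval x s ≤ cap x := by
  induction e with
  | lit c => exact le_cap_of_le x (by have := c.2; simp only [Ex.eval]; omega)
  | var v => exact hs.1 v
  | size => exact size_le_cap x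
  | inp e _ => exact hx _
  | get a e _ => exact hs.2 a _
  | add e f _ _ => exact min_le_right _ _
  | sub e f ihe _ => exact (Nat.sub_le _ _).trans ihe
  | mul e f _ _ => exact min_le_right _ _
  | div e f ihe _ => exact (Nat.div_le_self _ _).trans ihe

theorem Cmd.eval_bdd {x : List ℕ} (hx : ∀ i, x.getD i 0 ≤ cap x) (c : Cmd V A) :
    ∀ {s : Store V A}, s.Bdd x → (c.eval x s).Bdd x := by
  induction c with
  | skip => exact fun hs => hs
  | set v e => exact fun hs => hs.setVar v (e.eval_le hx hs)
  | put a e f => exact fun hs => hs.setArr a _ (f.eval_le hx hs)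
  | seq c d hc hd => exact fun hs => hd (hc hs)
  | ite e c d hc hd =>
    intro s hs
    simp only [Cmd.eval]
    split_ifs
    exacts [hd hs, hc hs]
  | loop v c hc =>
    intro s hs
    refine iter_induction (fun _ (t : Store V A) => t.Bdd x) hs fun k hk t ht => hc (ht.setVar v ?_)
    exact hk.le.trans (size_le_cap x)

/-! ### Running machine code -/

/-- All registers and memory cells hold at most `B`. -/
def Config.Bdd (B : ℕ) (c : Config) : Prop := ∀ i, c.reg i ≤ B ∧ c.mem i ≤ B

/-- `P` goes from `c` to `c'` in `t` steps, through configurations bounded by `B`. -/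
def Steps (P : Program) (B : ℕ) (c : Config) (t : ℕ) (c' : Config) : Prop :=
  run P c t = c' ∧ ∀ i ≤ t, (run P c i).Bdd B

theorem run_add (P : Program) (c : Config) (t u : ℕ) : run P c (t + u) = run P (run P c t) u := by
  simp only [run, Nat.add_comm t u, Function.iterate_add_apply]

theorem Steps.refl {P : Program} {B : ℕ} {c : Config} (h : c.Bdd B) : Steps P B c 0 c :=
  ⟨rfl, fun i hi => by rwa [Nat.le_zero.1 hi]⟩

theorem Steps.trans {P : Program} {B t u : ℕ} {c d e : Config} (h : Steps P B c t d)
    (h' : Steps P B d u e) : Steps P B c (t + u) e := by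
  refine ⟨by rw [run_add, h.1, h'.1], fun i hi => ?_⟩
  rcases le_total i t with hit | hit
  · exact h.2 i hit
  · obtain ⟨j, rfl⟩ := Nat.exists_eq_add_of_le hit
    rw [run_add, h.1]
    exact h'.2 j (by omega)

theorem Steps.bdd {P : Program} {B t : ℕ} {c d : Config} (h : Steps P B c t d) : d.Bdd B :=
  h.1 ▸ h.2 t le_rfl

theorem Steps.single {P : Program} {B : ℕ} {c : Config} {i : Instr} (hi : P[c.pc]? = some i)
    (h : c.Bdd B) (h' : (exec c i).Bdd B) : Steps P B c 1 (exec c i) := by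
  have e : run P c 1 = exec c i := by simp [run, step, hi]
  refine ⟨e, fun j hj => ?_⟩
  interval_cases j
  · exact h
  · rwa [e]

/-- The program `P` contains the instructions `l` from line `o` on. -/
def CodeAt (P : Program) (o : ℕ) (l : List Instr) : Prop := ∀ i < l.length, P[o + i]? = l[i]?

theorem CodeAt.left {P : Program} {o : ℕ} {l m : List Instr} (h : CodeAt P o (l ++ m)) :
    CodeAt P o l := fun i hi => by
  rw [h i (by simp; omega), List.getElem?_append_left hi]

theorem CodeAt.right {P : Program} {o : ℕ} {l m : List Instr} (h : CodeAt P o (l ++ m)) :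
    CodeAt P (o + l.length) m := fun i hi => by
  rw [Nat.add_assoc, h (l.length + i) (by simp; omega), List.getElem?_append_right (by omega)]
  simp

theorem CodeAt.head {P : Program} {o : ℕ} {i : Instr} {l : List Instr} (h : CodeAt P o (i :: l)) :
    P[o]? = some i := by simpa using h 0 (by simp)

theorem CodeAt.tail {P : Program} {o : ℕ} {i : Instr} {l : List Instr} (h : CodeAt P o (i :: l)) :
    CodeAt P (o + 1) l := CodeAt.right (l := [i]) h

/-- Execution of a list of instructions without jumps. -/
def execs (l : List Instr) (c : Config) : Config := l.foldl exec c

/-- The instructions `l`, executed one after the other from `c`, do not jump, and do not produce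
numbers greater than `B`. -/
def Straight (B : ℕ) : List Instr → Config → Prop
  | [], _ => True
  | i :: l, c => (exec c i).pc = c.pc + 1 ∧ (exec c i).Bdd B ∧ Straight B l (exec c i)

theorem Steps.straight {P : Program} {B : ℕ} {l : List Instr} :
    ∀ {c : Config}, CodeAt P c.pc l → c.Bdd B → Straight B l c →
      Steps P B c l.length (execs l c) ∧ (execs l c).pc = c.pc + l.length := by
  induction l with
  | nil => exact fun _ hb _ => ⟨.refl hb, rfl⟩
  | cons i l ih =>
    intro c hc hb hs
    obtain ⟨h1, h2⟩ := ih (c := exec c i) (hs.1 ▸ hc.tail) hs.2.1 hs.2.2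
    refine ⟨?_, ?_⟩
    · have := (Steps.single hc.head hb hs.2.1).trans h1
      rwa [Nat.add_comm] at this
    · rw [List.length_cons, execs, List.foldl_cons, ← execs, h2, hs.1]
      omega

theorem Config.Bdd.setReg {B : ℕ} {c : Config} (h : c.Bdd B) (r : ℕ) {v : ℕ} (hv : v ≤ B) :
    (c.setReg r v).Bdd B := by
  intro i
  refine ⟨?_, (h i).2⟩
  by_cases hi : i = r <;> simp [Config.setReg, hi, hv, (h i).1]

theorem Config.setReg_reg (c : Config) (r v i : ℕ) :
    (c.setReg r v).reg i = if i = r then v else c.reg i := by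
  simp [Config.setReg, Function.update_apply]

theorem Config.setReg_mem (c : Config) (r v : ℕ) : (c.setReg r v).mem = c.mem := rfl

theorem Config.setReg_pc (c : Config) (r v : ℕ) : (c.setReg r v).pc = c.pc + 1 := rfl

end RAM

/-! ### Compilation to machine code -/

namespace RAM

variable {V A : Type} [DecidableEq V] [DecidableEq A] (φ : V → ℕ) (ψ : A → ℕ)

/-- Instructions that replace the content of the register `r` by its minimum with register `4`. -/
def clamp (r : ℕ) : List Instr := [.sub 10 r 4, .sub r r 10]

/-- Machine code that computes an expression into the register `18 + 4 * d`. The variable `v` lives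
in the register `2 * φ v + 1`, the element `i` of the array `a` in the memory cell
`n + 16 * i + ψ a`, where `n` is the length of the input. The registers `0, 2, 4, 6, 8` hold the
constants `n`, `size x`, `cap x`, `1`, `16`. The registers `10, 12` are used as scratch, as are the
registers `18 + 4 * d'` with `d' ≥ d`, and the registers `16 + 4 * d` hold loop counters. -/
def Ex.comp : ℕ → Ex V A → List Instr
  | d, .lit c => [.const (18 + 4 * d) c]
  | d, .var v => [.move (18 + 4 * d) (2 * φ v + 1)]
  | d, .size => [.move (18 + 4 * d) 2]
  | d, .inp e => Ex.comp d e ++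
      -- the loaded value is multiplied by `min (n - i) 1`, to get `0` beyond the end of the input
      [.load 10 (18 + 4 * d), .sub 12 0 (18 + 4 * d), .sub (18 + 4 * d) 12 6,
        .sub 12 12 (18 + 4 * d), .mul (18 + 4 * d) 10 12]
  | d, .get a e => Ex.comp d e ++
      [.mul (18 + 4 * d) (18 + 4 * d) 8, .add (18 + 4 * d) (18 + 4 * d) 0, .const 10 (ψ a),
        .add (18 + 4 * d) (18 + 4 * d) 10, .load (18 + 4 * d) (18 + 4 * d)]
  | d, .add e f => Ex.comp d e ++ (Ex.comp (d + 1) f ++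
      (.add (18 + 4 * d) (18 + 4 * d) (18 + 4 * (d + 1)) :: clamp (18 + 4 * d)))
  | d, .sub e f => Ex.comp d e ++ (Ex.comp (d + 1) f ++
      [.sub (18 + 4 * d) (18 + 4 * d) (18 + 4 * (d + 1))])
  | d, .mul e f => Ex.comp d e ++ (Ex.comp (d + 1) f ++
      (.mul (18 + 4 * d) (18 + 4 * d) (18 + 4 * (d + 1)) :: clamp (18 + 4 * d)))
  | d, .div e f => Ex.comp d e ++ (Ex.comp (d + 1) f ++
      [.div (18 + 4 * d) (18 + 4 * d) (18 + 4 * (d + 1))])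

/-- Machine code for a command that is to stand at line `o`, inside `d` loops. -/
def Cmd.comp : ℕ → ℕ → Cmd V A → List Instr
  | _, _, .skip => []
  | _, _, .set v e => e.comp φ ψ 0 ++ [.move (2 * φ v + 1) 18]
  | _, _, .put a e f => e.comp φ ψ 0 ++ (f.comp φ ψ 1 ++
      [.mul 18 18 8, .add 18 18 0, .const 10 (ψ a), .add 18 18 10, .store 18 22])
  | d, o, .seq c c' => Cmd.comp d o c ++ Cmd.comp d (o + (Cmd.comp d o c).length) c'
  | d, o, .ite e c c' =>
      let le := (e.comp φ ψ 0).length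
      let l := Cmd.comp d (o + le + 1) c
      let l' := Cmd.comp d (o + le + 1 + l.length + 1) c'
      e.comp φ ψ 0 ++ (.jumpIfZero 18 (o + le + 1 + l.length + 1) ::
        (l ++ (.jump (o + le + 1 + l.length + 1 + l'.length) :: l')))
  | d, o, .loop v c =>
      let l := Cmd.comp (d + 1) (o + 4) c
      .const (16 + 4 * d) 0 :: .sub 10 2 (16 + 4 * d) :: .jumpIfZero 10 (o + 4 + l.length + 2) ::
        .move (2 * φ v + 1) (16 + 4 * d) ::
        (l ++ [.add (16 + 4 * d) (16 + 4 * d) 6, .jump (o + 1)])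

/-- An upper bound for the number of steps of the code for a command, if each loop makes `N`
iterations. -/
def Cmd.cost (N : ℕ) : Cmd V A → ℕ
  | .skip => 0
  | .set _ e => (e.comp φ ψ 0).length + 1
  | .put _ e f => (e.comp φ ψ 0).length + (f.comp φ ψ 1).length + 5
  | .seq c c' => c.cost N + c'.cost N
  | .ite e c c' => (e.comp φ ψ 0).length + (c.cost N + c'.cost N) + 2
  | .loop _ c => N * (c.cost N + 5) + 3

/-- The bound for all numbers that occur on the input `x`. -/
def wordBound (x : List ℕ) : ℕ := cap x ^ 2

/-- The configuration `c` represents the store `s`. -/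
structure Rel (x : List ℕ) (s : Store V A) (c : Config) : Prop where
  var : ∀ v, c.reg (2 * φ v + 1) = s.var v
  arr : ∀ a i, c.mem (x.length + 16 * i + ψ a) = s.arr a i
  inp : ∀ i < x.length, c.mem i = x.getD i 0
  reg0 : c.reg 0 = x.length
  reg2 : c.reg 2 = size x
  reg4 : c.reg 4 = cap x
  reg6 : c.reg 6 = 1
  reg8 : c.reg 8 = 16
  bdd : c.Bdd (wordBound x)

/-- A register whose content is not changed by the code of an expression at depth `d`. -/
def Kept (d r : ℕ) : Prop := r ≠ 10 ∧ r ≠ 12 ∧ (r % 4 = 2 → r < 18 + 4 * d)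

variable {φ ψ}

theorem Rel.congr {x : List ℕ} {s : Store V A} {c c' : Config} (h : Rel φ ψ x s c)
    (hm : c'.mem = c.mem) (hr : ∀ r, Kept 0 r → c'.reg r = c.reg r)
    (hb : c'.Bdd (wordBound x)) : Rel φ ψ x s c' where
  var v := by rw [hr _ ⟨by omega, by omega, by omega⟩, h.var]
  arr a i := by rw [hm, h.arr]
  inp i hi := by rw [hm, h.inp i hi]
  reg0 := by rw [hr _ ⟨by omega, by omega, by omega⟩, h.reg0]
  reg2 := by rw [hr _ ⟨by omega, by omega, by omega⟩, h.reg2]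
  reg4 := by rw [hr _ ⟨by omega, by omega, by omega⟩, h.reg4]
  reg6 := by rw [hr _ ⟨by omega, by omega, by omega⟩, h.reg6]
  reg8 := by rw [hr _ ⟨by omega, by omega, by omega⟩, h.reg8]
  bdd := hb

theorem Kept.mono {d d' r : ℕ} (h : Kept d r) (hd : d ≤ d') : Kept d' r :=
  ⟨h.1, h.2.1, fun hr => (h.2.2 hr).trans_le (by omega)⟩

theorem cap_le_wordBound (x : List ℕ) : cap x ≤ wordBound x :=
  Nat.le_self_pow two_ne_zero _

theorem address_le_wordBound (x : List ℕ) {i a : ℕ} (hi : i ≤ cap x) (ha : a < 16) :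
    x.length + 16 * i + a ≤ wordBound x := by
  have h1 := length_le_size x
  have h2 := size_le_cap x
  have h3 := le_cap_of_le x le_rfl
  unfold wordBound
  nlinarith

theorem mul_le_wordBound (x : List ℕ) {i j : ℕ} (hi : i ≤ cap x) (hj : j ≤ cap x) :
    i * j ≤ wordBound x := by
  unfold wordBound
  nlinarith

/-- Started in `c`, the code `l` computes the value `v` into the register `18 + 4 * d`. -/
def Computes (x : List ℕ) (d : ℕ) (l : List Instr) (v : ℕ) (c : Config) : Prop :=
  ∀ ⦃P : Program⦄, CodeAt P c.pc l → ∃ c' : Config, Steps P (wordBound x) c l.length c' ∧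
    c'.pc = c.pc + l.length ∧ c'.mem = c.mem ∧ c'.reg (18 + 4 * d) = v ∧
    ∀ r, Kept d r → c'.reg r = c.reg r

theorem Computes.of_straight {x : List ℕ} {d : ℕ} {l : List Instr} {v : ℕ} {c : Config}
    (hb : c.Bdd (wordBound x)) (h : Straight (wordBound x) l c) (hm : (execs l c).mem = c.mem)
    (hv : (execs l c).reg (18 + 4 * d) = v) (hk : ∀ r, Kept d r → (execs l c).reg r = c.reg r) :
    Computes x d l v c := fun _ hP =>
  ⟨_, (Steps.straight hP hb h).1, (Steps.straight hP hb h).2, hm, hv, hk⟩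

/-- Code that uses the value of a subexpression: the second part may assume that the first part has
changed nothing but scratch registers. -/
theorem Computes.append {x : List ℕ} {d e : ℕ} {l m : List Instr} {v w : ℕ} {c : Config}
    (h : Computes x e l v c) (hde : d ≤ e)
    (h' : ∀ c' : Config, c'.Bdd (wordBound x) → c'.mem = c.mem → c'.reg (18 + 4 * e) = v →
      (∀ r, Kept e r → c'.reg r = c.reg r) → Computes x d m w c') :
    Computes x d (l ++ m) w c := by
  intro P hP
  obtain ⟨c₁, s₁, p₁, m₁, v₁, k₁⟩ := h hP.left
  obtain ⟨c₂, s₂, p₂, m₂, v₂, k₂⟩ := h' c₁ s₁.bdd m₁ v₁ k₁ (p₁ ▸ hP.right)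
  refine ⟨c₂, by simpa using s₁.trans s₂, by rw [p₂, p₁]; simp; omega, m₂.trans m₁, v₂,
    fun r hr => (k₂ r hr).trans (k₁ r (hr.mono hde))⟩

theorem Kept.ne {d r : ℕ} (h : Kept d r) : r ≠ 18 + 4 * d := by
  rintro rfl
  have := h.2.2 (by omega)
  omega

theorem tmp_ne (d : ℕ) : 18 + 4 * d ≠ 10 ∧ 10 ≠ 18 + 4 * d ∧ 18 + 4 * d ≠ 12 ∧ 12 ≠ 18 + 4 * d ∧
    4 ≠ 18 + 4 * d ∧ 0 ≠ 18 + 4 * d := by omega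

theorem Config.Bdd.sub {B : ℕ} {c : Config} (h : c.Bdd B) (r s t : ℕ) :
    (exec c (.sub r s t)).Bdd B := h.setReg _ ((Nat.sub_le _ _).trans (h _).1)

/-- Code for a binary operation: the value of the first argument survives the computation of the
second, which uses registers of greater depth. -/
theorem Computes.binary {x : List ℕ} {s : Store V A} {c : Config} (hc : Rel φ ψ x s c)
    {d v w u : ℕ} {e f : Ex V A} {l : List Instr}
    (he : ∀ c : Config, Rel φ ψ x s c → Computes x d (e.comp φ ψ d) v c)
    (hf : ∀ c : Config, Rel φ ψ x s c → Computes x (d + 1) (f.comp φ ψ (d + 1)) w c)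
    (hl : ∀ c' : Config, Rel φ ψ x s c' → c'.reg (18 + 4 * d) = v →
      c'.reg (18 + 4 * (d + 1)) = w → Computes x d l u c') :
    Computes x d (e.comp φ ψ d ++ (f.comp φ ψ (d + 1) ++ l)) u c := by
  refine (he c hc).append le_rfl fun c₁ b₁ m₁ v₁ k₁ => ?_
  have r₁ : Rel φ ψ x s c₁ := hc.congr m₁ (fun r hr => k₁ r (hr.mono (Nat.zero_le d))) b₁
  refine (hf c₁ r₁).append (Nat.le_succ d) fun c₂ b₂ m₂ v₂ k₂ => ?_
  refine hl c₂ (r₁.congr m₂ (fun r hr => k₂ r (hr.mono (Nat.zero_le _))) b₂) ?_ v₂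
  rw [k₂ _ ⟨by omega, by omega, by omega⟩, v₁]

/-- The code `i :: clamp r`, where `i` writes the number `u` into the register `r`. -/
theorem Computes.clamp {x : List ℕ} {s : Store V A} {c : Config} (hc : Rel φ ψ x s c) {d u : ℕ}
    {i : Instr} (hi : exec c i = c.setReg (18 + 4 * d) u) (hu : u ≤ wordBound x) :
    Computes x d (i :: RAM.clamp (18 + 4 * d)) (min u (cap x)) c := by
  have b₁ : (exec c i).Bdd (wordBound x) := hi ▸ hc.bdd.setReg _ hu
  refine .of_straight hc.bdd ⟨by rw [hi]; rfl, b₁, rfl, b₁.sub _ _ _, rfl,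
    (b₁.sub _ _ _).sub _ _ _, trivial⟩ ?_ ?_ fun r hr => ?_ <;>
  rw [show execs (i :: RAM.clamp (18 + 4 * d)) c =
    execs (RAM.clamp (18 + 4 * d)) (c.setReg (18 + 4 * d) u) by simp [execs, hi]]
  · simp [execs, RAM.clamp, exec, Config.setReg_mem]
  · simp [execs, RAM.clamp, exec, Config.setReg_reg, hc.reg4, tmp_ne d]
    omega
  · simp [execs, RAM.clamp, exec, Config.setReg_reg, hr.1, hr.ne]

/-- The compiled code of an expression computes its value. -/
theorem Ex.comp_correct {x : List ℕ} (hx : ∀ i, x.getD i 0 ≤ cap x) (hψ : ∀ a, ψ a < 16)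
    {s : Store V A} (hs : s.Bdd x) (e : Ex V A) :
    ∀ (d : ℕ) (c : Config), Rel φ ψ x s c → Computes x d (e.comp φ ψ d) (e.eval x s) c := by
  have hB := cap_le_wordBound x
  induction e with
  | lit l =>
    intro d c hc
    have := le_cap_of_le x (c := l) (by have := l.2; omega)
    refine .of_straight hc.bdd ⟨rfl, hc.bdd.setReg _ (by omega), trivial⟩ rfl ?_ fun r hr => ?_
    · simp [execs, Ex.comp, exec, Config.setReg_reg, Ex.eval]
    · simp [execs, Ex.comp, exec, Config.setReg_reg, hr.ne]
  | var v =>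
    intro d c hc
    refine .of_straight hc.bdd ⟨rfl, hc.bdd.setReg _ (hc.bdd _).1, trivial⟩ rfl ?_ fun r hr => ?_
    · simp [execs, Ex.comp, exec, Config.setReg_reg, Ex.eval, hc.var]
    · simp [execs, Ex.comp, exec, Config.setReg_reg, hr.ne]
  | size =>
    intro d c hc
    refine .of_straight hc.bdd ⟨rfl, hc.bdd.setReg _ (hc.bdd _).1, trivial⟩ rfl ?_ fun r hr => ?_
    · simp [execs, Ex.comp, exec, Config.setReg_reg, Ex.eval, hc.reg2]
    · simp [execs, Ex.comp, exec, Config.setReg_reg, hr.ne]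
  | inp e ih =>
    intro d c hc
    refine (ih d c hc).append le_rfl fun c' b m v k => ?_
    have hc' := hc.congr m (fun r hr => k r (hr.mono (Nat.zero_le d))) b
    have b₁ : (exec c' (.load 10 (18 + 4 * d))).Bdd (wordBound x) := b.setReg _ (b _).2
    have b₂ := b₁.sub 12 0 (18 + 4 * d)
    have b₃ := b₂.sub (18 + 4 * d) 12 6
    have b₄ := b₃.sub 12 12 (18 + 4 * d)
    refine .of_straight b ⟨rfl, b₁, rfl, b₂, rfl, b₃, rfl, b₄, rfl, b₄.setReg _ ?_, trivial⟩
      rfl ?_ fun r hr => ?_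
    · refine le_trans ?_ (b (c'.reg (18 + 4 * d))).2
      simp [exec, Config.setReg_reg, hc'.reg6, tmp_ne d]
      refine (Nat.mul_le_mul_left _ (?_ : _ ≤ 1)).trans_eq (mul_one _)
      omega
    · simp [execs, exec, Config.setReg_reg, hc'.reg6, hc'.reg0, Ex.eval, v, tmp_ne d]
      by_cases hi : e.eval x s < x.length
      · have : x.length - e.eval x s - (x.length - e.eval x s - 1) = 1 := by omega
        rw [this, mul_one, hc'.inp _ hi, List.getD_eq_getElem?_getD]
      · have : x.length - e.eval x s - (x.length - e.eval x s - 1) = 0 := by omega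
        rw [this, List.getElem?_eq_none (by omega)]
        simp
    · simp [execs, exec, Config.setReg_reg, hr.1, hr.2.1, hr.ne]
  | get a e ih =>
    intro d c hc
    refine (ih d c hc).append le_rfl fun c' b m v k => ?_
    have hc' := hc.congr m (fun r hr => k r (hr.mono (Nat.zero_le d))) b
    have hle := e.eval_le hx hs
    have ha := address_le_wordBound x hle (hψ a)
    have b₁ : (exec c' (.mul (18 + 4 * d) (18 + 4 * d) 8)).Bdd (wordBound x) :=
      b.setReg _ (by rw [v, hc'.reg8]; omega)
    have b₂ : (exec _ (.add (18 + 4 * d) (18 + 4 * d) 0)).Bdd (wordBound x) :=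
      b₁.setReg _ (by
        simp [exec, Config.setReg_reg, v, hc'.reg8, hc'.reg0, tmp_ne d]; omega)
    have b₃ : (exec _ (.const 10 (ψ a))).Bdd (wordBound x) := b₂.setReg _ (by omega)
    have b₄ : (exec _ (.add (18 + 4 * d) (18 + 4 * d) 10)).Bdd (wordBound x) :=
      b₃.setReg _ (by
        simp [exec, Config.setReg_reg, v, hc'.reg8, hc'.reg0, tmp_ne d]; omega)
    refine .of_straight b ⟨rfl, b₁, rfl, b₂, rfl, b₃, rfl, b₄, rfl, b₄.setReg _ (b₄ _).2, trivial⟩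
      rfl ?_ fun r hr => ?_
    · simp [execs, exec, Config.setReg_reg, Config.setReg_mem, hc'.reg8, hc'.reg0, Ex.eval, v,
        tmp_ne d]
      rw [← hc'.arr]
      congr 1
      ring
    · simp [execs, exec, Config.setReg_reg, hr.1, hr.ne]
  | add e f ihe ihf =>
    intro d c hc
    refine .binary hc (ihe d) (ihf (d + 1)) fun c' hc' hv hw => ?_
    refine .clamp hc' (by simp [exec, hv, hw]) ?_
    have h1 := e.eval_le hx hs
    have h2 := f.eval_le hx hs
    have h3 := address_le_wordBound x h1 (show 0 < 16 by norm_num)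
    have h4 := address_le_wordBound x (le_refl (cap x)) (show 0 < 16 by norm_num)
    omega
  | sub e f ihe ihf =>
    intro d c hc
    refine .binary hc (ihe d) (ihf (d + 1)) fun c' hc' hv hw => ?_
    refine .of_straight hc'.bdd ⟨rfl, hc'.bdd.sub _ _ _, trivial⟩ rfl ?_ fun r hr => ?_
    · simp [execs, exec, Config.setReg_reg, Ex.eval, hv, hw]
    · simp [execs, exec, Config.setReg_reg, hr.ne]
  | mul e f ihe ihf =>
    intro d c hc
    refine .binary hc (ihe d) (ihf (d + 1)) fun c' hc' hv hw => ?_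
    exact .clamp hc' (by simp [exec, hv, hw]) (mul_le_wordBound x (e.eval_le hx hs)
      (f.eval_le hx hs))
  | div e f ihe ihf =>
    intro d c hc
    refine .binary hc (ihe d) (ihf (d + 1)) fun c' hc' hv hw => ?_
    refine .of_straight hc'.bdd
      ⟨rfl, hc'.bdd.setReg _ ((Nat.div_le_self _ _).trans (hc'.bdd _).1), trivial⟩ rfl ?_
      fun r hr => ?_
    · simp [execs, exec, Config.setReg_reg, Ex.eval, hv, hw]
    · simp [execs, exec, Config.setReg_reg, hr.ne]

end RAM

/-! ### Correctness and running time of the machine code -/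

namespace RAM

variable {V A : Type} [DecidableEq V] [DecidableEq A] {φ : V → ℕ} {ψ : A → ℕ}

theorem Kept.counter (d j : ℕ) : Kept d (16 + 4 * j) := ⟨by omega, by omega, by omega⟩

theorem Rel.setVar (hφ : Function.Injective φ) {x : List ℕ} {s : Store V A} {c : Config}
    (h : Rel φ ψ x s c) (v : V) {n : ℕ} (hn : n ≤ wordBound x) :
    Rel φ ψ x (s.setVar v n) (c.setReg (2 * φ v + 1) n) where
  var w := by
    rw [Config.setReg_reg, Store.setVar_var, h.var]
    refine if_congr ⟨fun h => hφ (by omega), fun h => by rw [h]⟩ rfl rfl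
  arr := h.arr
  inp := h.inp
  reg0 := by rw [Config.setReg_reg, if_neg (by omega), h.reg0]
  reg2 := by rw [Config.setReg_reg, if_neg (by omega), h.reg2]
  reg4 := by rw [Config.setReg_reg, if_neg (by omega), h.reg4]
  reg6 := by rw [Config.setReg_reg, if_neg (by omega), h.reg6]
  reg8 := by rw [Config.setReg_reg, if_neg (by omega), h.reg8]
  bdd := h.bdd.setReg _ hn

theorem Rel.setCounter {x : List ℕ} {s : Store V A} {c : Config} (h : Rel φ ψ x s c) (d : ℕ) {n : ℕ}
    (hn : n ≤ wordBound x) : Rel φ ψ x s (c.setReg (16 + 4 * d) n) where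
  var w := by rw [Config.setReg_reg, if_neg (by omega), h.var]
  arr := h.arr
  inp := h.inp
  reg0 := by rw [Config.setReg_reg, if_neg (by omega), h.reg0]
  reg2 := by rw [Config.setReg_reg, if_neg (by omega), h.reg2]
  reg4 := by rw [Config.setReg_reg, if_neg (by omega), h.reg4]
  reg6 := by rw [Config.setReg_reg, if_neg (by omega), h.reg6]
  reg8 := by rw [Config.setReg_reg, if_neg (by omega), h.reg8]
  bdd := h.bdd.setReg _ hn

/-- Specification of the code `l` of a command inside `d` loops: it takes the store `s` to the
store `s'` in at most `T` steps. -/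
def Transforms (φ : V → ℕ) (ψ : A → ℕ) (x : List ℕ) (d : ℕ) (l : List Instr) (T : ℕ)
    (s' : Store V A) (c : Config) : Prop :=
  ∀ ⦃P : Program⦄, CodeAt P c.pc l → ∃ t ≤ T, ∃ c' : Config, Steps P (wordBound x) c t c' ∧
    c'.pc = c.pc + l.length ∧ Rel φ ψ x s' c' ∧ ∀ j < d, c'.reg (16 + 4 * j) = c.reg (16 + 4 * j)

theorem Transforms.put (hψ : Function.Injective ψ) (hψ' : ∀ a, ψ a < 16)
    {x : List ℕ} (hx : ∀ i, x.getD i 0 ≤ cap x) {s : Store V A}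
    (hs : s.Bdd x) (a : A) (e f : Ex V A) (d o : ℕ) {c : Config} (hc : Rel φ ψ x s c) :
    Transforms φ ψ x d ((Cmd.put a e f).comp φ ψ d o) ((Cmd.put a e f).cost φ ψ (size x))
      ((Cmd.put a e f).eval x s) c := by
  intro P hP
  obtain ⟨c₁, s₁, p₁, m₁, v₁, k₁⟩ := e.comp_correct hx hψ' hs 0 c hc hP.left
  have r₁ := hc.congr m₁ k₁ s₁.bdd
  obtain ⟨c₂, s₂, p₂, m₂, v₂, k₂⟩ :=
    f.comp_correct hx hψ' hs 1 c₁ r₁ (P := P) (p₁ ▸ hP.right.left)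
  have r₂ := r₁.congr m₂ (fun r hr => k₂ r (hr.mono (Nat.zero_le _))) s₂.bdd
  have w₂ : c₂.reg 18 = e.eval x s := by rw [k₂ _ ⟨by omega, by omega, by omega⟩, ← v₁]
  have hle := e.eval_le hx hs
  have ha := address_le_wordBound x hle (hψ' a)
  have v₂ : c₂.reg 22 = f.eval x s := v₂
  have b₁ : (exec c₂ (.mul 18 18 8)).Bdd (wordBound x) :=
    s₂.bdd.setReg _ (by rw [w₂, r₂.reg8]; omega)
  have b₂ : (exec _ (.add 18 18 0)).Bdd (wordBound x) :=
    b₁.setReg _ (by simp [exec, Config.setReg_reg, w₂, r₂.reg8, r₂.reg0]; omega)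
  have b₃ : (exec _ (.const 10 (ψ a))).Bdd (wordBound x) := b₂.setReg _ (by omega)
  have b₄ : (exec _ (.add 18 18 10)).Bdd (wordBound x) :=
    b₃.setReg _ (by simp [exec, Config.setReg_reg, w₂, r₂.reg8, r₂.reg0]; omega)
  have b₅ : (exec _ (.store 18 22)).Bdd (wordBound x) := fun i => ⟨(b₄ i).1, by
    simp only [exec, Function.update_apply]
    split_ifs
    exacts [(b₄ _).1, (b₄ i).2]⟩
  obtain ⟨s₃, p₃⟩ := Steps.straight (P := P) (c := c₂) (l := [.mul 18 18 8, .add 18 18 0,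
    .const 10 (ψ a), .add 18 18 10, .store 18 22]) (p₂ ▸ p₁ ▸ hP.right.right) s₂.bdd
    ⟨rfl, b₁, rfl, b₂, rfl, b₃, rfl, b₄, rfl, b₅, trivial⟩
  have hreg : ∀ r, r ≠ 10 → r ≠ 18 → (execs [.mul 18 18 8, .add 18 18 0, .const 10 (ψ a),
      .add 18 18 10, .store 18 22] c₂).reg r = c₂.reg r := fun r h h' => by
    simp [execs, exec, Config.setReg_reg, h, h']
  have hmem : (execs [.mul 18 18 8, .add 18 18 0, .const 10 (ψ a), .add 18 18 10, .store 18 22]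
      c₂).mem = Function.update c₂.mem (x.length + 16 * e.eval x s + ψ a) (f.eval x s) := by
    simp [execs, exec, Config.setReg_reg, w₂, v₂, r₂.reg8, r₂.reg0, Config.setReg_mem]
    congr 1
    ring
  refine ⟨_, le_of_eq ?_, _, s₁.trans (s₂.trans s₃), ?_, ?_, ?_⟩
  · simp [Cmd.cost]; omega
  · rw [p₃, p₂, p₁]; simp [Cmd.comp]; omega
  · refine ⟨fun v => ?_, fun b j => ?_, fun i hi => ?_, ?_, ?_, ?_, ?_, ?_, s₃.bdd⟩
    · rw [hreg _ (by omega) (by omega), r₂.var]; rfl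
    · rw [hmem, Function.update_apply, Cmd.eval, Store.setArr_arr, r₂.arr]
      refine if_congr ⟨fun h => ?_, fun h => by rw [h.1, h.2]⟩ rfl rfl
      have h1 := hψ' a
      have h2 := hψ' b
      exact ⟨hψ (by omega), by omega⟩
    · rw [hmem, Function.update_apply, if_neg (by omega), r₂.inp i hi]
    · rw [hreg _ (by omega) (by omega), r₂.reg0]
    · rw [hreg _ (by omega) (by omega), r₂.reg2]
    · rw [hreg _ (by omega) (by omega), r₂.reg4]
    · rw [hreg _ (by omega) (by omega), r₂.reg6]
    · rw [hreg _ (by omega) (by omega), r₂.reg8]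
  · intro j _
    rw [hreg _ (by omega) (by omega), k₂ _ (Kept.counter _ _), k₁ _ (Kept.counter _ _)]

/-- The compiled code of a command has its effect, within the time `Cmd.cost`, and all numbers that
occur are at most `wordBound x`. -/
theorem Cmd.comp_correct (hφ : Function.Injective φ) (hψ : Function.Injective ψ)
    (hψ' : ∀ a, ψ a < 16) {x : List ℕ} (hx : ∀ i, x.getD i 0 ≤ cap x) (cmd : Cmd V A) :
    ∀ (d o : ℕ) (s : Store V A) (c : Config), s.Bdd x → Rel φ ψ x s c → c.pc = o →
      Transforms φ ψ x d (cmd.comp φ ψ d o) (cmd.cost φ ψ (size x)) (cmd.eval x s) c := by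
  have hB := cap_le_wordBound x
  induction cmd with
  | skip => exact fun d o s c hs hc ho P hP => ⟨0, le_rfl, c, .refl hc.bdd, rfl, hc, fun _ _ => rfl⟩
  | set v e =>
    intro d o s c hs hc ho P hP
    obtain ⟨c₁, s₁, p₁, m₁, v₁, k₁⟩ := e.comp_correct hx hψ' hs 0 c hc hP.left
    have r₁ := hc.congr m₁ k₁ s₁.bdd
    have hle : e.eval x s ≤ wordBound x := (e.eval_le hx hs).trans hB
    have e₁ : exec c₁ (.move (2 * φ v + 1) 18) = c₁.setReg (2 * φ v + 1) (e.eval x s) := by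
      rw [← v₁]; rfl
    have s₂ := Steps.single (P := P) (p₁ ▸ hP.right.head) s₁.bdd (e₁ ▸ s₁.bdd.setReg _ hle)
    refine ⟨_, le_of_eq (by simp [Cmd.cost]), _, s₁.trans s₂, ?_, ?_, fun j _ => ?_⟩
    · rw [e₁, Config.setReg_pc, p₁]; simp [Cmd.comp]; omega
    · rw [e₁]; exact r₁.setVar hφ v hle
    · rw [e₁, Config.setReg_reg, if_neg (by omega), k₁ _ (Kept.counter _ _)]
  | put a e f => exact fun d o s c hs hc _ => .put hψ hψ' hx hs a e f d o hc
  | seq a b iha ihb =>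
    intro d o s c hs hc ho P hP
    obtain ⟨t₁, l₁, c₁, s₁, p₁, r₁, k₁⟩ := iha d o s c hs hc ho hP.left
    obtain ⟨t₂, l₂, c₂, s₂, p₂, r₂, k₂⟩ :=
      ihb d _ _ c₁ (Cmd.eval_bdd hx a hs) r₁ (by rw [p₁, ho]) (P := P) (p₁ ▸ hP.right)
    refine ⟨_, Nat.add_le_add l₁ l₂, c₂, s₁.trans s₂, ?_, r₂, fun j hj => ?_⟩
    · rw [p₂, p₁]; simp [Cmd.comp]; omega
    · rw [k₂ j hj, k₁ j hj]
  | ite e a b iha ihb =>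
    intro d o s c hs hc ho P hP
    have iha := iha d (o + (e.comp φ ψ 0).length + 1) s
    have ihb := ihb d (o + (e.comp φ ψ 0).length + 1 +
      (a.comp φ ψ d (o + (e.comp φ ψ 0).length + 1)).length + 1) s
    simp only [Cmd.comp] at hP ⊢
    generalize a.comp φ ψ d (o + (e.comp φ ψ 0).length + 1) = la at *
    generalize hq : o + (e.comp φ ψ 0).length + 1 + la.length + 1 = q at *
    generalize b.comp φ ψ d q = lb at *
    obtain ⟨c₁, s₁, p₁, m₁, v₁, k₁⟩ := e.comp_correct hx hψ' hs 0 c hc hP.left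
    have r₁ := hc.congr m₁ k₁ s₁.bdd
    have v₁ : c₁.reg 18 = e.eval x s := v₁
    have hP₁ := p₁ ▸ hP.right
    have hb : (exec c₁ (.jumpIfZero 18 q)).Bdd (wordBound x) := s₁.bdd
    have s₂ := Steps.single hP₁.head s₁.bdd hb
    have r₂ := r₁.congr (c' := exec c₁ (.jumpIfZero 18 q)) rfl (fun _ _ => rfl) hb
    by_cases he : e.eval x s = 0
    · have hpc : (exec c₁ (.jumpIfZero 18 q)).pc = q := if_pos (v₁.trans he)
      obtain ⟨t₃, l₃, c₃, s₃, p₃, r₃, k₃⟩ := ihb _ hs r₂ hpc (P := P) (by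
        have := hP₁.tail.right.tail
        rw [hpc]
        convert this using 1
        omega)
      refine ⟨_, ?_, c₃, s₁.trans (s₂.trans s₃), ?_, ?_, fun j hj => ?_⟩
      · simp only [Cmd.cost]; omega
      · rw [p₃, hpc]; simp; omega
      · rw [Cmd.eval, if_pos he]; exact r₃
      · rw [k₃ j hj]; exact k₁ _ (Kept.counter _ _)
    · have hpc : (exec c₁ (.jumpIfZero 18 q)).pc = c₁.pc + 1 := if_neg (by rwa [v₁])
      obtain ⟨t₃, l₃, c₃, s₃, p₃, r₃, k₃⟩ := iha _ hs r₂ (by rw [hpc, p₁, ho])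
        (P := P) (by rw [hpc]; exact hP₁.tail.left)
      have s₄ := Steps.single (P := P) (c := c₃) (i := .jump (q + lb.length)) (by
        have := hP₁.tail.right.head
        rw [p₃, hpc]
        exact this) s₃.bdd s₃.bdd
      refine ⟨_, ?_, _, s₁.trans (s₂.trans (s₃.trans s₄)), ?_, ?_, fun j hj => ?_⟩
      · simp only [Cmd.cost]; omega
      · simp [exec]; omega
      · rw [Cmd.eval, if_neg he]; exact r₃.congr rfl (fun _ _ => rfl) s₃.bdd
      · exact (k₃ j hj).trans (k₁ _ (Kept.counter _ _))
  | loop v b ih =>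
    intro d o s c hs hc ho P hP
    have ih := ih (d + 1) (o + 4)
    simp only [Cmd.comp] at hP ⊢
    generalize b.comp φ ψ (d + 1) (o + 4) = lb at *
    rw [ho] at hP
    have hN : size x ≤ wordBound x := (size_le_cap x).trans hB
    have b₀ : (exec c (.const (16 + 4 * d) 0)).Bdd (wordBound x) := hc.bdd.setReg _ (Nat.zero_le _)
    have s₀ := Steps.single (ho ▸ hP.head) hc.bdd b₀
    have r₀ : Rel φ ψ x s (exec c (.const (16 + 4 * d) 0)) := hc.setCounter d (Nat.zero_le _)
    -- `k` iterations have been made, and the machine is at the beginning of the loop again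
    have key : ∀ k ≤ size x, ∃ t ≤ k * (b.cost φ ψ (size x) + 5), ∃ c' : Config,
        Steps P (wordBound x) (exec c (.const (16 + 4 * d) 0)) t c' ∧ c'.pc = o + 1 ∧
        Rel φ ψ x (iter (fun k t => b.eval x (t.setVar v k)) k s) c' ∧
        (iter (fun k t => b.eval x (t.setVar v k)) k s).Bdd x ∧ c'.reg (16 + 4 * d) = k ∧
        ∀ j < d, c'.reg (16 + 4 * j) = c.reg (16 + 4 * j) := by
      intro k
      induction k with
      | zero =>
        refine fun _ => ⟨0, le_rfl.trans (Nat.zero_le _), _, .refl b₀, ?_, r₀, hs, ?_,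
          fun j hj => ?_⟩
        · simp [exec, Config.setReg_pc, ho]
        · simp [exec, Config.setReg_reg]
        · rw [exec, Config.setReg_reg, if_neg (by omega)]
      | succ k ihk =>
        intro hk
        obtain ⟨t₁, l₁, c₁, s₁, p₁, r₁, bd₁, v₁, k₁⟩ := ihk (by omega)
        have b₂ := s₁.bdd.sub 10 2 (16 + 4 * d)
        have s₂ := Steps.single (p₁ ▸ hP.tail.head) s₁.bdd b₂
        have r₂ := r₁.congr (c' := exec c₁ (.sub 10 2 (16 + 4 * d))) rfl
          (fun r hr => by rw [exec, Config.setReg_reg, if_neg hr.1]) b₂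
        have s₃ := Steps.single (P := P) (c := exec c₁ (.sub 10 2 (16 + 4 * d)))
          (i := .jumpIfZero 10 (o + 4 + lb.length + 2))
          (by rw [exec, Config.setReg_pc, p₁]; exact hP.tail.tail.head) b₂ b₂
        have hne : ¬ (exec c₁ (.sub 10 2 (16 + 4 * d))).reg 10 = 0 := by
          simp only [exec, Config.setReg_reg, if_true, r₁.reg2, v₁]
          omega
        have hpc : (exec (exec c₁ (.sub 10 2 (16 + 4 * d)))
            (.jumpIfZero 10 (o + 4 + lb.length + 2))).pc = o + 3 := by
          refine (if_neg hne).trans ?_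
          simp only [exec, Config.setReg_pc, p₁]
        have hρ : (exec (exec c₁ (.sub 10 2 (16 + 4 * d)))
            (.jumpIfZero 10 (o + 4 + lb.length + 2))).reg (16 + 4 * d) = k := by
          simp only [exec, Config.setReg_reg]
          rw [if_neg (by omega), v₁]
        generalize hc₃ : exec (exec c₁ (.sub 10 2 (16 + 4 * d)))
          (.jumpIfZero 10 (o + 4 + lb.length + 2)) = c₃ at *
        have r₃ := r₂.congr (c' := c₃) (by rw [← hc₃]; rfl) (by rw [← hc₃]; exact fun _ _ => rfl)
          s₃.bdd
        have e₄ : exec c₃ (.move (2 * φ v + 1) (16 + 4 * d)) = c₃.setReg (2 * φ v + 1) k := by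
          rw [exec, hρ]
        have hkB : k ≤ wordBound x := by omega
        have s₄ := Steps.single (P := P) (c := c₃) (hpc ▸ hP.tail.tail.tail.head) s₃.bdd
          (e₄ ▸ s₃.bdd.setReg _ hkB)
        rw [e₄] at s₄
        obtain ⟨t₅, l₅, c₅, s₅, p₅, r₅, k₅⟩ := ih _ _
          (bd₁.setVar v (show k ≤ cap x by have := size_le_cap x; omega))
          (r₃.setVar hφ v hkB) (by rw [Config.setReg_pc, hpc]) (P := P)
          (by rw [Config.setReg_pc, hpc]; exact hP.tail.tail.tail.tail.left)
        have hP₅ := hP.tail.tail.tail.tail.right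
        have v₅ : c₅.reg (16 + 4 * d) = k := by
          rw [k₅ d (by omega), Config.setReg_reg, if_neg (by omega), hρ]
        have e₆ : exec c₅ (.add (16 + 4 * d) (16 + 4 * d) 6) = c₅.setReg (16 + 4 * d) (k + 1) := by
          rw [exec, r₅.reg6, v₅]
        have s₆ := Steps.single (P := P) (c := c₅) (by
          rw [p₅, Config.setReg_pc, hpc]; exact hP₅.head) s₅.bdd
          (e₆ ▸ s₅.bdd.setReg _ (by omega))
        rw [e₆] at s₆
        have s₇ := Steps.single (P := P) (c := c₅.setReg (16 + 4 * d) (k + 1))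
          (i := .jump (o + 1)) (by
          rw [Config.setReg_pc, p₅, Config.setReg_pc, hpc]; exact hP₅.tail.head) s₆.bdd s₆.bdd
        refine ⟨_, ?_, _, s₁.trans (s₂.trans (s₃.trans (s₄.trans (s₅.trans (s₆.trans s₇))))), rfl,
          ?_, ?_, ?_, fun j hj => ?_⟩
        · rw [Nat.succ_mul]; omega
        · exact (r₅.setCounter d (by omega)).congr rfl (fun _ _ => rfl) s₇.bdd
        · exact Cmd.eval_bdd hx b (bd₁.setVar v (show k ≤ cap x by
            have := size_le_cap x; omega))
        · simp [exec, Config.setReg_reg]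
        · simp only [exec]
          rw [Config.setReg_reg, if_neg (by omega), k₅ j (by omega), Config.setReg_reg,
            if_neg (by omega), ← hc₃, ← k₁ j hj]
          simp only [exec]
          rw [Config.setReg_reg, if_neg (by omega)]
    obtain ⟨t₁, l₁, c₁, s₁, p₁, r₁, bd₁, v₁, k₁⟩ := key (size x) le_rfl
    have b₂ := s₁.bdd.sub 10 2 (16 + 4 * d)
    have s₂ := Steps.single (p₁ ▸ hP.tail.head) s₁.bdd b₂
    have r₂ := r₁.congr (c' := exec c₁ (.sub 10 2 (16 + 4 * d))) rfl
      (fun r hr => by rw [exec, Config.setReg_reg, if_neg hr.1]) b₂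
    have s₃ := Steps.single (P := P) (c := exec c₁ (.sub 10 2 (16 + 4 * d)))
          (i := .jumpIfZero 10 (o + 4 + lb.length + 2))
      (by rw [exec, Config.setReg_pc, p₁]; exact hP.tail.tail.head) b₂ b₂
    have hz : (exec c₁ (.sub 10 2 (16 + 4 * d))).reg 10 = 0 := by
      simp only [exec, Config.setReg_reg, if_true, r₁.reg2, v₁]
      omega
    refine ⟨_, ?_, _, s₀.trans (s₁.trans (s₂.trans s₃)), ?_, ?_, fun j hj => ?_⟩
    · simp only [Cmd.cost]; omega
    · refine (if_pos hz).trans ?_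
      simp [ho]
      omega
    · exact r₂.congr rfl (fun _ _ => rfl) b₂
    · rw [← k₁ j hj]
      simp only [exec]
      rw [Config.setReg_reg, if_neg (by omega)]

/-- The nesting depth of the loops of a command. -/
def Cmd.depth : Cmd V A → ℕ
  | .skip => 0
  | .set _ _ => 0
  | .put _ _ _ => 0
  | .seq c d => max c.depth d.depth
  | .ite _ c d => max c.depth d.depth
  | .loop _ c => c.depth + 1

/-- The running time is polynomial, and its degree is the nesting depth of the loops. -/
theorem Cmd.exists_cost_le (c : Cmd V A) :
    ∃ C, ∀ N ≥ 1, c.cost φ ψ N ≤ C * N ^ c.depth := by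
  have aux : ∀ c d : Cmd V A, (∃ C, ∀ N ≥ 1, c.cost φ ψ N ≤ C * N ^ c.depth) →
      (∃ C, ∀ N ≥ 1, d.cost φ ψ N ≤ C * N ^ d.depth) →
      ∃ C, ∀ N ≥ 1, c.cost φ ψ N + d.cost φ ψ N ≤ C * N ^ max c.depth d.depth := by
    rintro c d ⟨C, hC⟩ ⟨D, hD⟩
    refine ⟨C + D, fun N hN => ?_⟩
    rw [add_mul]
    gcongr
    · refine (hC N hN).trans ?_
      exact Nat.mul_le_mul_left _ (Nat.pow_le_pow_right hN (le_max_left _ _))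
    · refine (hD N hN).trans ?_
      exact Nat.mul_le_mul_left _ (Nat.pow_le_pow_right hN (le_max_right _ _))
  induction c with
  | skip => exact ⟨0, fun N _ => by simp [Cmd.cost]⟩
  | set v e => exact ⟨_, fun N _ => by simp only [Cmd.cost, depth, pow_zero, mul_one]; rfl⟩
  | put a e f => exact ⟨_, fun N _ => by simp only [Cmd.cost, depth, pow_zero, mul_one]; rfl⟩
  | seq c d ihc ihd => exact aux c d ihc ihd
  | ite e c d ihc ihd =>
    obtain ⟨C, hC⟩ := aux c d ihc ihd
    refine ⟨C + ((e.comp φ ψ 0).length + 2), fun N hN => ?_⟩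
    have h1 := hC N hN
    have h2 : 1 ≤ N ^ max c.depth d.depth := Nat.one_le_pow _ _ hN
    have h3 := Nat.le_mul_of_pos_right ((e.comp φ ψ 0).length + 2) h2
    simp only [Cmd.cost, depth, add_mul _ _ (N ^ max c.depth d.depth)] at *
    omega
  | loop v c ih =>
    obtain ⟨C, hC⟩ := ih
    refine ⟨C + 8, fun N hN => ?_⟩
    have h2 : 1 ≤ N ^ c.depth := Nat.one_le_pow _ _ hN
    have h1 := Nat.mul_le_mul_left N (hC N hN)
    simp only [Cmd.cost, depth, pow_succ]
    nlinarith

/-- The store in which everything is `0`. -/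
def Store.zero : Store V A := ⟨fun _ => 0, fun _ _ => 0⟩

/-- Machine code that sets up the constant registers. -/
def prologue : List Instr :=
  [.const 2 16, .add 2 2 0, .mul 4 2 2, .const 10 8, .mul 4 4 10, .const 6 1, .const 8 16]

theorem run_of_halted {P : Program} {c : Config} (h : P[c.pc]? = none) (t : ℕ) : run P c t = c := by
  induction t with
  | zero => rfl
  | succ t ih => rw [run_add, ih]; simp [run, step, h]

theorem Steps.run_eq {P : Program} {B t : ℕ} {c c' : Config} (h : Steps P B c t c')
    (hc' : P[c'.pc]? = none) {u : ℕ} (hu : t ≤ u) : run P c u = c' := by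
  obtain ⟨v, rfl⟩ := Nat.exists_eq_add_of_le hu
  rw [run_add, h.1, run_of_halted hc']

theorem prologue_correct {x : List ℕ} (hx : ∀ i, x.getD i 0 ≤ cap x)
    {P : Program} (hP : CodeAt P 0 prologue) :
    ∃ c : Config, Steps P (wordBound x) (init x) 7 c ∧ c.pc = 7 ∧
      Rel φ ψ x (Store.zero : Store V A) c := by
  have hB := cap_le_wordBound x
  have hN := size_le_cap x
  have hn := length_le_size x
  have h8 : size x * size x * 8 = cap x := by rw [cap]; ring
  have b₀ : (init x).Bdd (wordBound x) := fun i => by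
    refine ⟨?_, (hx i).trans hB⟩
    simp only [init]
    split_ifs <;> omega
  have b₁ : (exec (init x) (.const 2 16)).Bdd (wordBound x) := b₀.setReg _ (by omega)
  have b₂ : (exec _ (.add 2 2 0)).Bdd (wordBound x) := b₁.setReg _ (by
    simp [exec, Config.setReg_reg, init]; omega)
  have b₃ : (exec _ (.mul 4 2 2)).Bdd (wordBound x) := b₂.setReg _ (by
    simp [exec, Config.setReg_reg, init]
    rw [add_comm, ← size]
    omega)
  have b₄ : (exec _ (.const 10 8)).Bdd (wordBound x) := b₃.setReg _ (by omega)
  have b₅ : (exec _ (.mul 4 4 10)).Bdd (wordBound x) := b₄.setReg _ (by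
    simp [exec, Config.setReg_reg, init]
    rw [add_comm, ← size]
    omega)
  have b₆ : (exec _ (.const 6 1)).Bdd (wordBound x) := b₅.setReg _ (by omega)
  have b₇ : (exec _ (.const 8 16)).Bdd (wordBound x) := b₆.setReg _ (by omega)
  obtain ⟨s, p⟩ := Steps.straight (P := P) (l := prologue) (c := init x) hP b₀
    ⟨rfl, b₁, rfl, b₂, rfl, b₃, rfl, b₄, rfl, b₅, rfl, b₆, rfl, b₇, trivial⟩
  refine ⟨_, s, p, ⟨fun v => ?_, fun a i => ?_, fun i _ => rfl, ?_, ?_, ?_, ?_, ?_, s.bdd⟩⟩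
  · have h : ∀ r, r % 2 = 0 → 2 * φ v + 1 ≠ r := by omega
    simp [execs, prologue, exec, Config.setReg_reg, init, h, Store.zero]
  · change x.getD _ 0 = 0
    rw [List.getD_eq_default]
    omega
  · simp [execs, prologue, exec, Config.setReg_reg, init]
  · simp [execs, prologue, exec, Config.setReg_reg, init, size, add_comm]
  · simp [execs, prologue, exec, Config.setReg_reg, init, cap, size]
    ring
  · simp [execs, prologue, exec, Config.setReg_reg, init]
  · simp [execs, prologue, exec, Config.setReg_reg, init]

/-- A language that is decided by a command with loops of nesting depth at most `k` is decidable in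
time `O(n ^ k)`. -/
theorem decidableInTime_of_cmd {α : Type*} {code : α → ℕ} {L : Language α} (cmd : Cmd V A) (out : V)
    (hφ : Function.Injective φ) (hψ : Function.Injective ψ) (hψ' : ∀ a, ψ a < 16)
    (hcode : ∀ y, code y ≤ 2048) {k : ℕ} (hk : cmd.depth ≤ k)
    (h : ∀ w : List α, (w ∈ L → (cmd.eval (w.map code) Store.zero).var out = 1) ∧
      (w ∉ L → (cmd.eval (w.map code) Store.zero).var out = 0)) :
    DecidableInTime code L fun n => (n : ℝ) ^ k := by
  obtain ⟨C, hC⟩ := cmd.exists_cost_le (φ := φ) (ψ := ψ)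
  refine ⟨prologue ++ (cmd.comp φ ψ 0 7 ++ [Instr.move 0 (2 * φ out + 1)]),
    fun n => 8 + cmd.cost φ ψ (n + 16), (8 * (Polynomial.X + 16) ^ 2) ^ 2, ?_, fun w => ?_⟩
  · refine IsBigO.of_bound (8 + C * 17 ^ k : ℕ) ?_
    filter_upwards [eventually_ge_atTop 1] with n hn
    have h1 := hC (n + 16) (by omega)
    have h2 : (n + 16) ^ cmd.depth ≤ (17 * n) ^ k :=
      (Nat.pow_le_pow_right (by omega) hk).trans (Nat.pow_le_pow_left (by omega) k)
    have h3 : 1 ≤ n ^ k := Nat.one_le_pow _ _ hn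
    have h4 : 8 + cmd.cost φ ψ (n + 16) ≤ (8 + C * 17 ^ k) * n ^ k := by
      rw [mul_pow] at h2
      have := h1.trans (Nat.mul_le_mul_left C h2)
      nlinarith
    rw [Real.norm_of_nonneg (by positivity), Real.norm_of_nonneg (by positivity)]
    exact_mod_cast h4
  · intro c₀
    set x := w.map code with hxdef
    have hx : ∀ i, x.getD i 0 ≤ cap x := by
      intro i
      by_cases hi : i < x.length
      · rw [List.getD_eq_getElem _ _ hi]
        exact le_cap_of_le x (by simp [x]; exact hcode _)
      · rw [List.getD_eq_default _ _ (by omega)]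
        exact Nat.zero_le _
    have hP : CodeAt (prologue ++ (cmd.comp φ ψ 0 7 ++ [Instr.move 0 (2 * φ out + 1)])) 0
        (prologue ++ (cmd.comp φ ψ 0 7 ++ [Instr.move 0 (2 * φ out + 1)])) := fun i _ => by
      rw [Nat.zero_add]
    have hlen : (prologue ++ (cmd.comp φ ψ 0 7 ++ [Instr.move 0 (2 * φ out + 1)])).length =
      7 + (cmd.comp φ ψ 0 7).length + 1 := by simp [prologue]; omega
    generalize hPdef : prologue ++ (cmd.comp φ ψ 0 7 ++ [Instr.move 0 (2 * φ out + 1)]) = P at *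
    rw [← hPdef] at hP
    obtain ⟨c₁, s₁, p₁, r₁⟩ := prologue_correct (V := V) (A := A) (φ := φ) (ψ := ψ) hx
      (P := P) (by simpa [hPdef] using hP.left)
    have hP₂ : CodeAt P 7 (cmd.comp φ ψ 0 7 ++ [Instr.move 0 (2 * φ out + 1)]) := by
      have := hP.right
      rwa [hPdef] at this
    obtain ⟨t₂, l₂, c₂, s₂, p₂, r₂, -⟩ := cmd.comp_correct hφ hψ hψ' hx 0 7 Store.zero c₁
      ⟨fun _ => Nat.zero_le _, fun _ _ => Nat.zero_le _⟩ r₁ p₁ (P := P) (p₁ ▸ hP₂.left)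
    have s₃ := Steps.single (P := P) (c := c₂) (i := .move 0 (2 * φ out + 1))
      (by rw [p₂, p₁]; exact hP₂.right.head) s₂.bdd (s₂.bdd.setReg _ (s₂.bdd _).1)
    have s := s₁.trans (s₂.trans s₃)
    have hend : P[(exec c₂ (.move 0 (2 * φ out + 1))).pc]? = none := by
      rw [List.getElem?_eq_none]
      simp only [exec, Config.setReg_pc, p₂, p₁, hlen]
      omega
    have hB : ((8 * (Polynomial.X + 16) ^ 2) ^ 2 : Polynomial ℕ).eval w.length = wordBound x := by
      simp [wordBound, cap, size, x]
    have hsize : size x = w.length + 16 := by simp [size, x]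
    have hrun := s.run_eq hend (u := 8 + cmd.cost φ ψ (w.length + 16)) (by
      rw [hsize] at l₂; omega)
    refine ⟨?_, ?_, fun t i => ?_⟩
    · rw [hrun]; exact Or.inl hend
    · rw [hrun]
      simp only [exec, Config.setReg_reg, if_true, r₂.var]
      split_ifs with hw
      · exact (h w).1 hw
      · exact (h w).2 hw
    · rw [hB]
      rcases le_total t (7 + (t₂ + 1)) with ht | ht
      · exact s.2 t ht i
      · rw [s.run_eq hend ht]
        exact s.bdd i

end RAM

/-! ### Saturating arithmetic with signed dyadic sums -/

namespace Baumslag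

/-- The pair `(u, v)` of natural numbers, one of which is `0`, stands for the integer `a`: either
`u - v = a` holds exactly, or `a` and `u - v` have the same sign and absolute values of at least
`K - w`. Here `K` is the number at which the arithmetic saturates, and `w` bounds the loss since
the last saturation. -/
def Near (K w u v : ℕ) (a : ℤ) : Prop :=
  ((u : ℤ) - v = a ∧ (u = 0 ∨ v = 0)) ∨ (v = 0 ∧ K ≤ u + w ∧ (K : ℤ) ≤ a + w) ∨
    (u = 0 ∧ K ≤ v + w ∧ (K : ℤ) ≤ -a + w)

/-- Adding `P - Q` with saturating arithmetic, and making one component `0` again. The loss grows by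
`P + Q`, since after a saturation the sum may be less than it should be by that much. -/
theorem Near.add {K w u v P Q : ℕ} {a : ℤ} (h : Near K w u v a) (hu : u ≤ K) (hv : v ≤ K)
    (hw : 2 * (w + P + Q) ≤ K) :
    Near K (w + P + Q) (min (u + P) K - min (v + Q) K) (min (v + Q) K - min (u + P) K)
      (a + P - Q) := by
  unfold Near at *
  omega

/-- Multiplication by a power of `2` that is known up to saturation does not increase the loss. -/
theorem Near.mul {K w u v : ℕ} {a : ℤ} (h : Near K w u v a) (d : ℕ) (hK : w < K) :
    Near K w (min (u * min (2 ^ d) K) K) (min (v * min (2 ^ d) K) K) (a * 2 ^ d) := by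
  have h2 : 1 ≤ 2 ^ d := Nat.one_le_two_pow
  have pos : ∀ u : ℕ, Near K w u 0 u →
      Near K w (min (u * min (2 ^ d) K) K) 0 (u * 2 ^ d) := by
    intro u _
    rcases Nat.eq_zero_or_pos u with rfl | hu
    · left; simp
    rcases le_or_gt (u * 2 ^ d) K with h | h
    · left
      have h3 : 2 ^ d ≤ K := (Nat.le_mul_of_pos_left _ hu).trans h
      rw [min_eq_left h3, min_eq_left h]
      exact ⟨by push_cast; ring, Or.inr rfl⟩
    · right; left
      have h4 : min (u * min (2 ^ d) K) K = K := by
        apply min_eq_right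
        rcases le_total (2 ^ d) K with h5 | h5
        · rw [min_eq_left h5]; exact h.le
        · rw [min_eq_right h5]; exact Nat.le_mul_of_pos_left _ hu
      rw [h4]
      refine ⟨rfl, by omega, ?_⟩
      have : (K : ℤ) < u * 2 ^ d := by exact_mod_cast h
      omega
  have sat : ∀ (u : ℕ) (a : ℤ), K ≤ u + w → (K : ℤ) ≤ a + w →
      K ≤ min (u * min (2 ^ d) K) K + w ∧ (K : ℤ) ≤ a * 2 ^ d + w := by
    intro u a h3 h4
    have h5 : u ≤ u * min (2 ^ d) K := Nat.le_mul_of_pos_right _ (by omega)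
    refine ⟨by omega, ?_⟩
    have h6 : (1 : ℤ) ≤ 2 ^ d := by exact_mod_cast h2
    nlinarith
  rcases h with ⟨h, rfl | rfl⟩ | ⟨rfl, h3, h4⟩ | ⟨rfl, h3, h4⟩
  · have := pos v (Or.inl ⟨by simp, Or.inr rfl⟩)
    have ha : a = -v := by omega
    subst ha
    unfold Near at *
    rw [neg_mul]
    simp only [zero_mul, Nat.zero_min]
    generalize min (v * min (2 ^ d) K) K = V at *
    generalize (v : ℤ) * 2 ^ d = X at *
    clear pos sat
    simp only [true_and, true_or, and_true, or_true] at this ⊢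
    omega
  · have ha : a = u := by omega
    subst ha
    simpa using pos u (Or.inl ⟨by simp, Or.inr rfl⟩)
  · obtain ⟨h5, h6⟩ := sat u a h3 h4
    exact Or.inr (Or.inl ⟨by simp, h5, h6⟩)
  · obtain ⟨h5, h6⟩ := sat v (-a) h3 h4
    refine Or.inr (Or.inr ⟨by simp, h5, ?_⟩)
    rwa [← neg_mul]

theorem Near.eq_zero_iff {K w u v : ℕ} {a : ℤ} (h : Near K w u v a) (hw : w < K) :
    u + v = 0 ↔ a = 0 := by
  unfold Near at h
  omega

theorem Near.pos_iff {K w u v : ℕ} {a : ℤ} (h : Near K w u v a) (hw : w < K) :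
    0 < v ↔ a < 0 := by
  unfold Near at h
  omega

/-- A capped power of two with capped exponent. -/
theorem Near.min_pow {K w u v N : ℕ} {a : ℤ} (h : Near K w u v a) (hw : w + N < K)
    (hN : K ≤ 2 ^ N) (ha : 0 ≤ a) : min (2 ^ min u N) K = min (2 ^ a.toNat) K := by
  have big : ∀ m, N ≤ m → min (2 ^ m) K = K := fun m hm =>
    min_eq_right (hN.trans (Nat.pow_le_pow_right (by norm_num) hm))
  rcases le_or_gt N a.toNat with h1 | h1
  · have : N ≤ min u N := by unfold Near at h; omega
    rw [big _ h1, big _ this]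
  · have : min u N = a.toNat := by unfold Near at h; omega
    rw [this]

/-- Exact division by a capped power of two, for numbers below the cap. -/
theorem dvd_iff_of_lt {K d a : ℕ} (ha : a < K) :
    (a - a / min (2 ^ d) K * min (2 ^ d) K = 0 ↔ 2 ^ d ∣ a) ∧
      (2 ^ d ∣ a → a / min (2 ^ d) K * 2 ^ d = a) := by
  rcases le_or_gt (2 ^ d) K with h | h
  · rw [min_eq_left h]
    refine ⟨⟨fun h' => ?_, fun h' => ?_⟩, Nat.div_mul_cancel⟩
    · have := Nat.div_mul_le_self a (2 ^ d)
      exact ⟨a / 2 ^ d, by rw [mul_comm]; omega⟩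
    · rw [Nat.div_mul_cancel h', Nat.sub_self]
  · rw [min_eq_right h.le, Nat.div_eq_of_lt ha]
    have h0 : 2 ^ d ∣ a → a = 0 := fun h' => Nat.eq_zero_of_dvd_of_lt h' (ha.trans h)
    refine ⟨⟨fun h' => ?_, fun h' => by simp [h0 h']⟩, fun h' => by simp [h0 h']⟩
    have : a = 0 := by omega
    simp [this]

/-- The dyadic sum `∑ cⱼ 2 ^ eⱼ` over `j` from `J` to `K - 1`. -/
def dsum (c e : ℕ → ℤ) (J K : ℕ) : ℚ := ∑ j ∈ Finset.Ico J K, (c j : ℚ) * 2 ^ e j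

theorem dsum_self (c e : ℕ → ℤ) (J : ℕ) : dsum c e J J = 0 := by simp [dsum]

theorem dsum_succ_right (c e : ℕ → ℤ) {J K : ℕ} (h : J ≤ K) :
    dsum c e J (K + 1) = dsum c e J K + c K * 2 ^ e K := by
  rw [dsum, Finset.sum_Ico_succ_top h, dsum]

theorem dsum_succ_left (c e : ℕ → ℤ) {J K : ℕ} (h : J < K) :
    dsum c e J K = c J * 2 ^ e J + dsum c e (J + 1) K := by
  rw [dsum, Finset.sum_eq_sum_Ico_succ_bot h, dsum]

theorem dsum_add_dsum (c e : ℕ → ℤ) {I J K : ℕ} (h : I ≤ J) (h' : J ≤ K) :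
    dsum c e I J + dsum c e J K = dsum c e I K :=
  Finset.sum_Ico_consecutive _ h h'

/-- A sum of terms with exponents at least `f` is an integral multiple of `2 ^ f`. -/
theorem exists_dsum_eq (c e : ℕ → ℤ) {J K : ℕ} {f : ℤ} (h : ∀ j, J ≤ j → j < K → f ≤ e j) :
    ∃ t : ℤ, dsum c e J K = t * 2 ^ f := by
  refine ⟨∑ j ∈ Finset.Ico J K, c j * 2 ^ (e j - f).toNat, ?_⟩
  push_cast
  rw [dsum, Finset.sum_mul]
  refine Finset.sum_congr rfl fun j hj => ?_
  rw [Finset.mem_Ico] at hj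
  rw [mul_assoc, ← zpow_natCast, ← zpow_add₀ two_ne_zero]
  congr 2
  have := h j hj.1 hj.2
  omega

/-- If `a 2 ^ e + t 2 ^ f` is an integer and `e ≤ f ≤ 0`, then `2 ^ (f - e) ∣ a`. -/
theorem dvd_of_mul_zpow_add {a t M : ℤ} {e f : ℤ} (hef : e ≤ f) (hf : f ≤ 0)
    (h : (a : ℚ) * 2 ^ e + t * 2 ^ f = M) : ((2 ^ (f - e).toNat : ℕ) : ℤ) ∣ a := by
  refine ⟨M * 2 ^ (-f).toNat - t, ?_⟩
  have h1 : (a : ℚ) = (M - t * 2 ^ f) * 2 ^ (-e) := by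
    rw [← h, add_sub_cancel_right, mul_assoc, ← zpow_add₀ two_ne_zero]
    simp
  have h2 : ((2 ^ (f - e).toNat : ℕ) : ℚ) = 2 ^ f * 2 ^ (-e) := by
    rw [← zpow_add₀ two_ne_zero, Nat.cast_pow, ← zpow_natCast]
    congr 1
    omega
  have h3 : ((2 : ℚ) ^ (-f).toNat) = 2 ^ (-f) := by
    rw [← zpow_natCast]
    congr 1
    omega
  have : (a : ℚ) = (2 ^ (f - e).toNat : ℕ) * (M * 2 ^ (-f).toNat - t) := by
    rw [h1, h2, h3, zpow_neg 2 f]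
    field_simp
  exact_mod_cast this

end Baumslag

/-! ### Reasoning about commands -/

namespace RAM

variable {V A : Type} [DecidableEq V] [DecidableEq A]

/-- The variables that a command may change. -/
def Cmd.vars : Cmd V A → List V
  | .skip => []
  | .set v _ => [v]
  | .put _ _ _ => []
  | .seq c d => c.vars ++ d.vars
  | .ite _ c d => c.vars ++ d.vars
  | .loop v c => v :: c.vars

/-- The arrays that a command may change. -/
def Cmd.arrs : Cmd V A → List A
  | .skip => []
  | .set _ _ => []
  | .put a _ _ => [a]
  | .seq c d => c.arrs ++ d.arrs
  | .ite _ c d => c.arrs ++ d.arrs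
  | .loop _ c => c.arrs

/-- The stores `s` and `t` agree outside the given variables and arrays. -/
structure Agree (vs : List V) (as : List A) (s t : Store V A) : Prop where
  var : ∀ v, v ∉ vs → t.var v = s.var v
  arr : ∀ a, a ∉ as → t.arr a = s.arr a

theorem Agree.refl (vs : List V) (as : List A) (s : Store V A) : Agree vs as s s :=
  ⟨fun _ _ => rfl, fun _ _ => rfl⟩

theorem Agree.trans {vs : List V} {as : List A} {s t u : Store V A} (h : Agree vs as s t)
    (h' : Agree vs as t u) : Agree vs as s u :=
  ⟨fun v hv => (h'.var v hv).trans (h.var v hv), fun a ha => (h'.arr a ha).trans (h.arr a ha)⟩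

theorem Agree.mono {vs vs' : List V} {as as' : List A} {s t : Store V A} (h : Agree vs as s t)
    (hv : ∀ v ∈ vs, v ∈ vs') (ha : ∀ a ∈ as, a ∈ as') : Agree vs' as' s t :=
  ⟨fun v h' => h.var v fun h => h' (hv v h), fun a h' => h.arr a fun h => h' (ha a h)⟩

theorem Cmd.agree (x : List ℕ) (c : Cmd V A) : ∀ s, Agree c.vars c.arrs s (c.eval x s) := by
  induction c with
  | skip => exact fun s => .refl _ _ s
  | set v e =>
    refine fun s => ⟨fun w hw => ?_, fun _ _ => rfl⟩
    rw [eval, Store.setVar_var, if_neg (by simpa [vars] using hw)]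
  | put a e f =>
    refine fun s => ⟨fun w hw => rfl, fun b hb => ?_⟩
    ext i
    rw [eval, Store.setArr_arr, if_neg (fun h => hb (by simp [arrs, h.1]))]
  | seq c d hc hd =>
    exact fun s => ((hc s).mono (by simp +contextual [vars]) (by simp +contextual [arrs])).trans
      ((hd _).mono (by simp +contextual [vars]) (by simp +contextual [arrs]))
  | ite e c d hc hd =>
    intro s
    rw [eval]
    split_ifs
    · exact (hd s).mono (by simp +contextual [vars]) (by simp +contextual [arrs])
    · exact (hc s).mono (by simp +contextual [vars]) (by simp +contextual [arrs])
  | loop v c hc =>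
    intro s
    rw [eval]
    refine iter_induction (fun _ t => Agree (v :: c.vars) c.arrs s t) (.refl _ _ s)
      fun k _ t ht => ht.trans (Agree.trans (t := t.setVar v k) ⟨fun w hw => ?_, fun _ _ => rfl⟩ ?_)
    · rw [Store.setVar_var, if_neg (fun h => hw (by simp [h]))]
    · exact (hc _).mono (by simp +contextual) (by simp)

theorem Cmd.eval_var (x : List ℕ) (c : Cmd V A) (s : Store V A) {v : V} (hv : v ∉ c.vars) :
    (c.eval x s).var v = s.var v := (c.agree x s).var v hv

theorem Cmd.eval_arr (x : List ℕ) (c : Cmd V A) (s : Store V A) {a : A} (ha : a ∉ c.arrs) :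
    (c.eval x s).arr a = s.arr a := (c.agree x s).arr a ha

/-- The loop rule. The invariant may rely on everything that the loop does not change. -/
theorem Cmd.loop_induction {x : List ℕ} {v : V} {c : Cmd V A} {s : Store V A}
    (I : ℕ → Store V A → Prop) (h0 : I 0 s)
    (hs : ∀ k < RAM.size x, ∀ t, Agree (v :: c.vars) c.arrs s t → I k t →
      I (k + 1) (c.eval x (t.setVar v k))) :
    I (RAM.size x) ((Cmd.loop v c).eval x s) := by
  rw [eval]
  refine (iter_induction (fun k t => Agree (v :: c.vars) c.arrs s t ∧ I k t) ⟨.refl _ _ s, h0⟩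
    fun k hk t ht => ⟨ht.1.trans (Agree.trans (t := t.setVar v k) ⟨fun w hw => ?_, fun _ _ => rfl⟩
      ((c.agree x _).mono (by simp +contextual) (by simp))), hs k hk t ht.1 ht.2⟩).2
  rw [Store.setVar_var, if_neg (fun h => hw (by simp [h]))]

namespace Ex

instance : Add (Ex V A) := ⟨.add⟩
instance : Sub (Ex V A) := ⟨.sub⟩
instance : Mul (Ex V A) := ⟨.mul⟩
instance : Div (Ex V A) := ⟨.div⟩

/-- `1` if the two values are equal, and `0` otherwise -/
def eq (e f : Ex V A) : Ex V A := .lit 1 - ((e - f) + (f - e))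

variable (x : List ℕ) (s : Store V A)

@[simp] theorem eval_add (e f : Ex V A) :
    (e + f).eval x s = min (e.eval x s + f.eval x s) (cap x) := rfl
@[simp] theorem eval_sub (e f : Ex V A) : (e - f).eval x s = e.eval x s - f.eval x s := rfl
@[simp] theorem eval_mul (e f : Ex V A) :
    (e * f).eval x s = min (e.eval x s * f.eval x s) (cap x) := rfl
@[simp] theorem eval_div (e f : Ex V A) : (e / f).eval x s = e.eval x s / f.eval x s := rfl
@[simp] theorem eval_lit (c : Fin 16) : (lit c : Ex V A).eval x s = c := rfl
@[simp] theorem eval_var (v : V) : (var v : Ex V A).eval x s = s.var v := rfl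
@[simp] theorem eval_size : (size : Ex V A).eval x s = RAM.size x := rfl
@[simp] theorem eval_inp (e : Ex V A) : (inp e).eval x s = x.getD (e.eval x s) 0 := rfl
@[simp] theorem eval_get (a : A) (e : Ex V A) : (get a e).eval x s = s.arr a (e.eval x s) := rfl

@[simp] theorem eval_eq (e f : Ex V A) :
    (eq e f).eval x s = if e.eval x s = f.eval x s then 1 else 0 := by
  have := le_cap_of_le x (c := 1) (by norm_num)
  simp only [eq, eval_sub, eval_add, eval_lit]
  split_ifs with h
  · simp [h]
  · have : 1 ≤ min (e.eval x s - f.eval x s + (f.eval x s - e.eval x s)) (cap x) := by omega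
    omega

end Ex

namespace Cmd

variable (x : List ℕ) (s : Store V A)

@[simp] theorem eval_skip : (skip : Cmd V A).eval x s = s := rfl
@[simp] theorem eval_set (v : V) (e : Ex V A) : (set v e).eval x s = s.setVar v (e.eval x s) := rfl
@[simp] theorem eval_put (a : A) (e f : Ex V A) :
    (put a e f).eval x s = s.setArr a (e.eval x s) (f.eval x s) := rfl
@[simp] theorem eval_seq (c d : Cmd V A) : (seq c d).eval x s = d.eval x (c.eval x s) := rfl
@[simp] theorem eval_ite (e : Ex V A) (c d : Cmd V A) :
    (ite e c d).eval x s = if e.eval x s = 0 then d.eval x s else c.eval x s := rfl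

end Cmd

end RAM

/-! ### The program -/

namespace Baumslag

open RAM

/-- The variables of the program. Those that keep their values from one letter of the input to the
next are `len`, the length of the list of letters, and `h`, the number of the top piece of the stack
(the lowest piece has number `0`). The letter that is processed is in position `k` of the input. The
results of an evaluation are `flag`, which tells whether the sum is an integer, and `p`, `q`, such
that the sum is `p - q`, up to saturation. -/
inductive Var : Type
  | a | b | c | flag | g | h | i | i' | j | j' | k | key | len | lt | nr | nv | o | ok | out | p | q
  | u | v | x | y | z
  deriving DecidableEq

/-- The arrays of the program.
* `t` is the list of letters, sorted by their exponents, and `g` holds the gaps: the exponents of the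
  letters in the positions `i` and `i + 1` differ by the binary logarithm of `g[i]`, up to
  saturation;
* `row` is the square array of coefficients: its row number `l` represents the exponent of the letter
  number `l` as a sum of terms of other letters;
* `st` is the status of a letter: `0` if it is not in use, `1` if it serves only for the
  representation of exponents, `2 j + 2` if it belongs to the translation part of the piece number
  `j` of the stack, and `2 j + 3` if it belongs to its scaling part;
* `stk` is the stack of powers of `b`: `stk[j + 1]` is the code of the one that follows the piece
  number `j`;
* `p`, `q` are the coefficients of a sum that is to be evaluated, by position in the list;
* `f` flags the letters whose exponents change;
* `rl`, `vl` are the lists of the other letters and of the flagged letters;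
* `t'`, `g'` are the merged list and its gaps. -/
inductive Arr : Type
  | f | g | g' | p | q | rl | row | st | stk | t | t' | vl
  deriving DecidableEq

/-- Numbering of the variables. -/
def Var.code : Var → ℕ := Var.ctorIdx

/-- Numbering of the arrays. -/
def Arr.code : Arr → ℕ := Arr.ctorIdx

theorem Var.code_injective : Function.Injective Var.code := by
  intro m n; cases m <;> cases n <;> simp [Var.code, Var.ctorIdx]

theorem Arr.code_injective : Function.Injective Arr.code := by
  intro a b; cases a <;> cases b <;> simp [Arr.code, Arr.ctorIdx]

theorem Arr.code_lt (a : Arr) : a.code < 16 := by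
  cases a <;> simp [Arr.code, Arr.ctorIdx]

local infixr:50 " ;; " => Cmd.seq
local infix:55 " ≔ " => Cmd.set

/-- Expressions of the program. -/
abbrev E : Type := Ex Var Arr

/-- Commands of the program. -/
abbrev C : Type := Cmd Var Arr

/-- The body of the loop of `locate`. -/
def locateBody : C :=
  .ite (.var .len - .var .i) (.ite (.get .t (.var .i)) .skip (.z ≔ .var .i)) .skip

/-- Finds the position `z` of the zero letter in the list. -/
def locate : C := .loop .i locateBody

/-- The body of the loop of `sumLow`: adds a coefficient to the partial sum `p - q`, and divides it
by the gap to the next exponent. -/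
def sumLowBody : C :=
  .ite (.var .z - .var .i)
    (.a ≔ .var .p + .get .p (.var .i) ;; .b ≔ .var .q + .get .q (.var .i) ;;
      .p ≔ .var .a - .var .b ;; .q ≔ .var .b - .var .a ;; .g ≔ .get .g (.var .i) ;;
      .ite ((.var .p - .var .p / .var .g * .var .g) + (.var .q - .var .q / .var .g * .var .g))
        (.flag ≔ .lit 0) .skip ;;
      .p ≔ .var .p / .var .g ;; .q ≔ .var .q / .var .g)
    .skip

/-- Sums up the terms below the zero letter, from the smallest exponent on. -/
def sumLow : C := .p ≔ .lit 0 ;; .q ≔ .lit 0 ;; .flag ≔ .lit 1 ;; .loop .i sumLowBody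

/-- The body of the loop of `sumHigh`: adds a coefficient to the partial sum `u - v`, and multiplies
it by the gap to the next exponent. -/
def sumHighBody : C :=
  .ite (.var .len - (.var .i + .var .z + .lit 1))
    (.j ≔ .var .len - .lit 1 - .var .i ;;
      .a ≔ .var .u + .get .p (.var .j) ;; .b ≔ .var .v + .get .q (.var .j) ;;
      .g ≔ .get .g (.var .j - .lit 1) ;;
      .u ≔ (.var .a - .var .b) * .var .g ;; .v ≔ (.var .b - .var .a) * .var .g)
    .skip

/-- Sums up the terms above the zero letter, from the largest exponent on, saturating. -/
def sumHigh : C := .u ≔ .lit 0 ;; .v ≔ .lit 0 ;; .loop .i sumHighBody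

/-- Evaluates the sum of all terms `(p[i] - q[i]) 2 ^ E`, where `E` is the exponent of the letter
`t[i]`. -/
def evalSum : C :=
  locate ;; sumLow ;; sumHigh ;;
  .a ≔ .var .u + .get .p (.var .z) ;; .b ≔ .var .v + .get .q (.var .z) ;;
  .u ≔ .var .a - .var .b ;; .v ≔ .var .b - .var .a ;;
  .a ≔ .var .u + .var .p ;; .b ≔ .var .v + .var .q ;;
  .p ≔ .var .a - .var .b ;; .q ≔ .var .b - .var .a

/-- The element in row `e` and column `f` of the square array of coefficients. -/
def entry (e f : E) : E := .get .row (e * .size + f)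

/-- The body of the loop of `compare`: the coefficient of `t[i]` in the difference of the rows `y` and
`x`, with the sign of that letter. -/
def compareBody : C :=
  .j ≔ .get .t (.var .i) ;;
  .ite (.inp (.var .j - .lit 1))
    (.put .p (.var .i) (entry (.var .y) (.var .j)) ;;
      .put .q (.var .i) (entry (.var .x) (.var .j)))
    (.put .p (.var .i) (entry (.var .x) (.var .j)) ;;
      .put .q (.var .i) (entry (.var .y) (.var .j)))

/-- Compares the exponents of the letters `x` and `y`, by evaluation of the difference of the exponent
of `y` and that of `x`. -/
def compare : C := .loop .i compareBody ;; evalSum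

/-- The body of the loop of `test`: the sign of the letter `t[i]`, if its status is `key`. -/
def testBody : C :=
  .put .p (.var .i) (.lit 0) ;; .put .q (.var .i) (.lit 0) ;;
  .ite (.eq (.get .st (.get .t (.var .i))) (.var .key))
    (.ite (.inp (.get .t (.var .i) - .lit 1)) (.put .p (.var .i) (.lit 1))
      (.put .q (.var .i) (.lit 1)))
    .skip

/-- Evaluates the sum over all letters of status `key`. -/
def test (key : E) : C := .key ≔ key ;; .loop .i testBody ;; evalSum

/-- The body of the loop of `split`. -/
def splitBody : C :=
  .ite (.var .len - .var .i)
    (.j ≔ .get .t (.var .i) ;;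
      .ite (.get .st (.var .j))
        (.ite (.get .f (.var .j))
          (.put .vl (.var .nv) (.var .j) ;; .nv ≔ .var .nv + .lit 1)
          (.put .rl (.var .nr) (.var .j) ;; .nr ≔ .var .nr + .lit 1))
        .skip)
    .skip

/-- Splits the list into the flagged letters and the others, and drops those of status `0`. -/
def split : C := .nr ≔ .lit 0 ;; .nv ≔ .lit 0 ;; .loop .i splitBody

/-- Decides which of the two lists provides the next letter of the merged list. -/
def choose : C :=
  .x ≔ .get .rl (.var .i') ;; .y ≔ .get .vl (.var .j') ;; .lt ≔ .lit 0 ;;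
  .ite (.var .nv - .var .j')
    (.ite (.var .nr - .var .i') (compare ;; .lt ≔ .var .q) (.lt ≔ .lit 1)) .skip

/-- The body of the loop of `merge`. -/
def mergeBody : C :=
  .ite (.var .nr + .var .nv - .var .o)
    (choose ;;
      .ite (.var .lt) (.put .t' (.var .o) (.var .y) ;; .j' ≔ .var .j' + .lit 1)
        (.put .t' (.var .o) (.var .x) ;; .i' ≔ .var .i' + .lit 1))
    .skip

/-- Merges the two lists made by `split`. -/
def merge : C := .i' ≔ .lit 0 ;; .j' ≔ .lit 0 ;; .loop .o mergeBody

/-- Computes the power `2 ^ p`, saturating. -/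
def power : C := .g ≔ .lit 1 ;; .loop .i (.ite (.var .p - .var .i) (.g ≔ .var .g * .lit 2) .skip)

/-- The body of the loop of `gaps`. -/
def gapsBody : C :=
  .ite (.var .nr + .var .nv - (.var .o + .lit 1))
    (.x ≔ .get .t' (.var .o) ;; .y ≔ .get .t' (.var .o + .lit 1) ;; compare ;; power ;;
      .put .g' (.var .o) (.var .g))
    .skip

/-- Computes the gaps of the merged list. The old list still serves for the comparisons. -/
def gaps : C := .loop .o gapsBody

/-- Replaces the list by the merged list. -/
def copy : C :=
  .loop .i (.put .t (.var .i) (.get .t' (.var .i)) ;; .put .g (.var .i) (.get .g' (.var .i))) ;;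
  .len ≔ .var .nr + .var .nv

/-- Sorts the list again after a change of the exponents of the flagged letters. -/
def resort : C := split ;; merge ;; gaps ;; copy

/-- The body of the inner loop of `shift`. -/
def shiftBody : C :=
  .ite (.eq (.get .st (.var .j)) (.var .key))
    (.put .row (.var .i * .size + .var .j) (entry (.var .i) (.var .j) + .lit 1)) .skip

/-- Adds the scaling part of the top piece to the exponents of the flagged letters: in their rows, the
coefficient of each letter of that scaling part is increased by `1`. -/
def shift : C :=
  .key ≔ .var .h + .var .h + .lit 3 ;;
  .loop .i (.ite (.get .f (.var .i)) (.loop .j shiftBody) .skip)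

/-- Appends the letter in position `k` of the input, whose number is `k + 1`, to the list, and flags
it. Its gap is provisional. -/
def append : C :=
  .put .t (.var .len) (.var .k + .lit 1) ;; .put .g (.var .len - .lit 1) (.lit 1) ;;
  .len ≔ .var .len + .lit 1 ;;
  .put .st (.var .k + .lit 1) (.var .h + .var .h + .lit 2) ;;
  .loop .i (.put .f (.var .i) (.lit 0)) ;; .put .f (.var .k + .lit 1) (.lit 1)

/-- Multiplies the top piece by the letter in position `k` of the input, a power of `a`. -/
def mulLetter : C := append ;; shift ;; resort

/-- The body of the loop of `popInt`. -/
def popIntBody : C :=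
  .ite (.eq (.get .st (.var .i)) (.var .h + .var .h + .lit 3))
    (.put .st (.var .i) (.lit 1))
    (.ite (.eq (.get .st (.var .i)) (.var .h + .var .h + .lit 2))
      (.put .st (.var .i) (.var .h + .var .h + .lit 1)) .skip)

/-- Carries out the pinch `b (k, 0) b⁻¹ = (0, k)`: the letters of the translation part of the top piece
go to the scaling part of the piece below. Those of its scaling part, the sum of which is `0`, are
kept, since exponents may refer to them. -/
def popInt : C := .loop .i popIntBody ;; .h ≔ .var .h - .lit 1

/-- The body of the loop of `popScale`. -/
def popScaleBody : C :=
  .put .f (.var .i) (.lit 0) ;;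
  .ite (.eq (.get .st (.var .i)) (.var .h + .var .h + .lit 2))
    (.put .st (.var .i) (.lit 0))
    (.ite (.eq (.get .st (.var .i)) (.var .h + .var .h + .lit 3))
      (.put .st (.var .i) (.var .h + .var .h) ;; .put .f (.var .i) (.lit 1)) .skip)

/-- Carries out the pinch `b⁻¹ (0, m) b = (m, 0)`: the letters of the scaling part of the top piece go
to the translation part of the piece below, where their exponents are increased by the scaling part
of that piece. Those of the translation part of the top piece, the sum of which is `0`, are removed;
no exponent refers to them. -/
def popScale : C := .loop .i popScaleBody ;; .h ≔ .var .h - .lit 1 ;; shift ;; resort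

/-- Decides whether the letter `c`, a power of `b`, makes a pinch with the top of the stack. The codes
of `b⁻¹` and `b` are `2` and `3`. -/
def testPinch : C :=
  .ok ≔ .lit 0 ;;
  .ite (.var .h)
    (.ite (.eq (.get .stk (.var .h)) (.var .c)) .skip
      (.ite (.eq (.var .c) (.lit 2))
        (test (.var .h + .var .h + .lit 3) ;; .ok ≔ .lit 1 - (.var .p + .var .q) ;;
          test (.var .h + .var .h + .lit 2) ;; .ok ≔ .var .ok * .var .flag)
        (test (.var .h + .var .h + .lit 2) ;;
          .ok ≔ .var .flag * (.lit 1 - (.var .p + .var .q)))))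
    .skip

/-- Processes a letter `c` that is a power of `b`. -/
def stepB : C :=
  testPinch ;;
  .ite (.var .ok) (.ite (.eq (.var .c) (.lit 2)) popInt popScale)
    (.h ≔ .var .h + .lit 1 ;; .put .stk (.var .h) (.var .c))

/-- Decides whether the stack represents the identity. -/
def finish : C :=
  .out ≔ .lit 0 ;;
  .ite (.var .h) .skip
    (test (.lit 2) ;; .ok ≔ .var .flag * (.lit 1 - (.var .p + .var .q)) ;;
      test (.lit 3) ;; .out ≔ .var .ok * (.lit 1 - (.var .p + .var .q)))

/-- Processes the letter in the position `k` of the input. -/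
def programBody : C :=
  .ite (.size - .lit 15 - .lit 1 - .var .k)
    (.c ≔ .inp (.var .k) ;; .ite (.lit 2 - .var .c) mulLetter stepB) .skip

/-- The program that decides the word problem of the Baumslag group. Letter number `0` is an
auxiliary letter of exponent `0`; the letter in the position `k` of the input has number `k + 1`. -/
def program : C :=
  .put .st (.lit 0) (.lit 1) ;; .len ≔ .lit 1 ;; .loop .k programBody ;; finish

end Baumslag

/-! ### Evaluation of dyadic sums by the program -/

namespace Baumslag

open RAM

theorem Near.mono {K w w' u v : ℕ} {a : ℤ} (h : Near K w u v a) (hw : w ≤ w') :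
    Near K w' u v a := by
  unfold Near at *
  omega

/-- The store holds a list of letters, the letter in position `i` having the exponent `e i` and the
zero letter being in position `z`, and the sum of the coefficients `p[i]`, `q[i]` is at most `W`,
which is small. -/
structure EvalPre (x : List ℕ) (s : Store Var Arr) (e : ℕ → ℤ) (z W : ℕ) : Prop where
  len : s.var .len ≤ size x
  lt : z < s.var .len
  eq_zero : ∀ i < s.var .len, s.arr .t i = 0 ↔ i = z
  exp_zero : e z = 0
  mono : ∀ i, i + 1 < s.var .len → e i ≤ e (i + 1)
  gap : ∀ i, i + 1 < s.var .len → s.arr .g i = min (2 ^ (e (i + 1) - e i).toNat) (cap x)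
  sum_le : ∑ j ∈ Finset.range (s.var .len), (s.arr .p j + s.arr .q j) ≤ W
  le_cap : 4 * W < cap x

/-- The coefficients of the sum that is to be evaluated. -/
def coef (s : Store Var Arr) (j : ℕ) : ℤ := (s.arr .p j : ℤ) - s.arr .q j

theorem EvalPre.le {x : List ℕ} {s : Store Var Arr} {e : ℕ → ℤ} {z W : ℕ} (h : EvalPre x s e z W)
    {i j : ℕ} (hij : i ≤ j) (hj : j < s.var .len) : e i ≤ e j := by
  induction j, hij using Nat.le_induction with
  | base => exact le_rfl
  | succ k _ ih => exact (ih (by omega)).trans (h.mono k hj)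

theorem EvalPre.sum_Ico_le {x : List ℕ} {s : Store Var Arr} {e : ℕ → ℤ} {z W : ℕ}
    (h : EvalPre x s e z W) {i j : ℕ} (hj : j ≤ s.var .len) :
    ∑ l ∈ Finset.Ico i j, (s.arr .p l + s.arr .q l) ≤ W := by
  refine le_trans (Finset.sum_le_sum_of_subset fun l hl => ?_) h.sum_le
  simp at hl ⊢
  omega

theorem EvalPre.congr {x : List ℕ} {s t : Store Var Arr} {e : ℕ → ℤ} {z W : ℕ}
    (h : EvalPre x s e z W) (hl : t.var .len = s.var .len) (ha : t.arr = s.arr) :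
    EvalPre x t e z W :=
  ⟨hl ▸ h.len, hl ▸ h.lt, by rw [hl, ha]; exact h.eq_zero, h.exp_zero, by rw [hl]; exact h.mono,
    by rw [hl, ha]; exact h.gap, by rw [hl, ha]; exact h.sum_le, h.le_cap⟩

theorem locate_spec {x : List ℕ} {s : Store Var Arr} {e : ℕ → ℤ} {z W : ℕ}
    (h : EvalPre x s e z W) : (locate.eval x s).var .z = z := by
  have key := Cmd.loop_induction (x := x) (v := Var.i) (s := s) (c := locateBody)
    (fun k t => z < k → t.var .z = z) (fun h => by omega) ?_
  · exact key (h.lt.trans_le h.len)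
  intro k hk t ht ih hz
  have hl : t.var .len = s.var .len := ht.var _ (by decide)
  have ha : t.arr .t = s.arr .t := ht.arr _ (by decide)
  have h1 := h.eq_zero k
  have h2 := h.lt
  simp [hl, ha, locateBody]
  split_ifs with h3 h4
  · simp; exact ih (by omega)
  · simp; exact ((h1 (by omega)).1 h4)
  · simp; exact ih (by
      rcases Nat.lt_succ_iff_lt_or_eq.1 hz with h5 | h5
      · exact h5
      · exact absurd ((h1 (by omega)).2 h5.symm) h4)

/-- One step of the summation from below, if the division is possible. -/
theorem dsum_step_of_dvd {c e : ℕ → ℤ} {k d : ℕ} (hd : e (k + 1) = e k + d) {A B A' B' : ℕ}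
    (h : ((A : ℚ) - B) * 2 ^ e k = dsum c e 0 (k + 1)) (hA : A' * 2 ^ d = A) (hB : B' * 2 ^ d = B) :
    ((A' : ℚ) - B') * 2 ^ e (k + 1) = dsum c e 0 (k + 1) := by
  rw [← h, ← hA, ← hB, hd, zpow_add₀ two_ne_zero, zpow_natCast]
  push_cast
  ring

/-- If a step of the summation from below requires an impossible division, then the sum is not an
integer. -/
theorem dvd_of_dsum_eq {c e : ℕ → ℤ} {k z d : ℕ} (hk : k < z) (hd : e (k + 1) = e k + d)
    (h0 : e (k + 1) ≤ 0) (hle : ∀ j, k + 1 ≤ j → j < z → e (k + 1) ≤ e j) {A B : ℕ}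
    (hAB : A = 0 ∨ B = 0) (h : ((A : ℚ) - B) * 2 ^ e k = dsum c e 0 (k + 1)) {M : ℤ}
    (hM : dsum c e 0 z = M) : 2 ^ d ∣ A ∧ 2 ^ d ∣ B := by
  obtain ⟨T, hT⟩ := exists_dsum_eq (J := k + 1) (K := z) (f := e (k + 1)) c e hle
  rw [← dsum_add_dsum c e (Nat.zero_le (k + 1)) hk, ← h, hT] at hM
  have hdvd := dvd_of_mul_zpow_add (a := (A : ℤ) - B) (e := e k) (f := e (k + 1)) (by omega) h0
    (by push_cast; exact hM)
  rw [show (e (k + 1) - e k).toNat = d by omega] at hdvd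
  rcases hAB with rfl | rfl
  · rw [Nat.cast_zero, zero_sub, dvd_neg] at hdvd
    exact ⟨dvd_zero _, Int.natCast_dvd_natCast.1 hdvd⟩
  · rw [Nat.cast_zero, sub_zero] at hdvd
    exact ⟨Int.natCast_dvd_natCast.1 hdvd, dvd_zero _⟩

/-- The invariant of the summation from below, after `i` steps: `p - q` is the partial sum in units of
`2 ^ e i`, or an impossible division has shown that the sum is not an integer. -/
def LowInv (s : Store Var Arr) (e : ℕ → ℤ) (z i : ℕ) (t : Store Var Arr) : Prop :=
  (t.var .flag = 1 ∧ (t.var .p = 0 ∨ t.var .q = 0) ∧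
    t.var .p + t.var .q ≤ ∑ l ∈ Finset.Ico 0 i, (s.arr .p l + s.arr .q l) ∧
    ((t.var .p : ℚ) - t.var .q) * 2 ^ e i = dsum (coef s) e 0 i) ∨
  (t.var .flag = 0 ∧ ¬ ∃ M : ℤ, dsum (coef s) e 0 z = M)

theorem sumLowBody_spec {x : List ℕ} {s : Store Var Arr} {e : ℕ → ℤ} {z W k : ℕ}
    (h : EvalPre x s e z W) {t : Store Var Arr} (hzt : t.var .z = z) (hat : t.arr = s.arr)
    (hkz : k < z) (ih : LowInv s e z k t) :
    LowInv s e z (k + 1) (sumLowBody.eval x (t.setVar .i k)) := by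
  have hkz' : ¬ z - k = 0 := by omega
  rcases ih with ⟨hf, hpq, hle, heq⟩ | ⟨hf, hM⟩
  · have hzs := h.lt
    have hk1 : k + 1 < s.var .len := by omega
    have hsum := h.sum_Ico_le (i := 0) (j := k + 1) (by omega)
    have hcap := h.le_cap
    rw [Finset.sum_Ico_succ_top (Nat.zero_le k)] at hsum
    have hgap := h.gap k hk1
    have hmono := h.mono k hk1
    have hneg : e (k + 1) ≤ 0 := by
      rw [← h.exp_zero]
      exact h.le hkz h.lt
    obtain ⟨d, hd⟩ := Int.eq_ofNat_of_zero_le (sub_nonneg.2 hmono)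
    rw [hd, Int.toNat_natCast] at hgap
    -- the two parts of the partial sum after the coefficient number `k` has been added
    obtain ⟨A, hA⟩ : ∃ A, A = t.var .p + s.arr .p k - (t.var .q + s.arr .q k) := ⟨_, rfl⟩
    obtain ⟨B, hB⟩ : ∃ B, B = t.var .q + s.arr .q k - (t.var .p + s.arr .p k) := ⟨_, rfl⟩
    have hcond : ∀ a : ℕ, a ≤ cap x → min (a / s.arr .g k * s.arr .g k) (cap x) =
        a / s.arr .g k * s.arr .g k := fun a ha =>
      min_eq_left ((Nat.div_mul_le_self _ _).trans ha)
    have hp : min (t.var .p + s.arr .p k) (cap x) = t.var .p + s.arr .p k :=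
      min_eq_left (by omega)
    have hq : min (t.var .q + s.arr .q k) (cap x) = t.var .q + s.arr .q k :=
      min_eq_left (by omega)
    have hAc : A < cap x := by omega
    have hBc : B < cap x := by omega
    have hAB : A = 0 ∨ B = 0 := by omega
    obtain ⟨hA1, hA2⟩ := dvd_iff_of_lt (K := cap x) (d := d) hAc
    obtain ⟨hB1, hB2⟩ := dvd_iff_of_lt (K := cap x) (d := d) hBc
    rw [← hgap] at hA1 hA2 hB1 hB2
    have hsumk : ((A : ℚ) - B) * 2 ^ e k = dsum (coef s) e 0 (k + 1) := by
      rw [dsum_succ_right _ _ (Nat.zero_le k), ← heq, ← add_mul]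
      congr 1
      have hAB' : ((A : ℤ) - B : ℤ) = t.var .p - t.var .q + coef s k := by
        simp only [coef]; omega
      exact_mod_cast hAB'
    by_cases hdiv : 2 ^ d ∣ A ∧ 2 ^ d ∣ B
    · left
      have hA3 := hA1.2 hdiv.1
      have hB3 := hB1.2 hdiv.2
      have hA5 := Nat.div_le_self A (s.arr .g k)
      have hB5 := Nat.div_le_self B (s.arr .g k)
      simp only [sumLowBody, Cmd.eval_seq, Cmd.eval_set, Cmd.eval_ite, Cmd.eval_skip, Ex.eval_add,
        Ex.eval_sub, Ex.eval_mul, Ex.eval_div, Ex.eval_var, Ex.eval_get, Ex.eval_lit,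
        Store.setVar_var, Store.setVar_arr, reduceCtorEq, if_false, if_true, hat, hp, hq, ← hA,
        ← hB, hcond _ hAc.le, hcond _ hBc.le, hA3, hB3, hzt, hkz', Nat.add_zero, Nat.zero_min]
      refine ⟨hf, ?_, ?_, dsum_step_of_dvd (by omega) hsumk (hA2 hdiv.1) (hB2 hdiv.2)⟩
      · exact hAB.imp (fun h => by rw [h, Nat.zero_div]) (fun h => by rw [h, Nat.zero_div])
      · rw [Finset.sum_Ico_succ_top (Nat.zero_le k)]
        refine (Nat.add_le_add hA5 hB5).trans ?_
        omega
    · right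
      have hne : ¬ min (A - A / s.arr .g k * s.arr .g k + (B - B / s.arr .g k * s.arr .g k))
          (cap x) = 0 := by
        intro h0
        exact hdiv ⟨hA1.1 (by omega), hB1.1 (by omega)⟩
      simp only [sumLowBody, Cmd.eval_seq, Cmd.eval_set, Cmd.eval_ite, Ex.eval_add, Ex.eval_sub,
        Ex.eval_mul, Ex.eval_div, Ex.eval_var, Ex.eval_get, Ex.eval_lit, Store.setVar_var,
        Store.setVar_arr, reduceCtorEq, if_false, if_true, hat, hp, hq, ← hA, ← hB,
        hcond _ hAc.le, hcond _ hBc.le, hne, hzt, hkz']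
      refine ⟨rfl, ?_⟩
      rintro ⟨M, hM⟩
      exact hdiv (dvd_of_dsum_eq hkz (by omega) hneg (fun j hj hj' => h.le hj (by omega)) hAB hsumk
        hM)
  · right
    refine ⟨?_, hM⟩
    simp only [sumLowBody, Cmd.eval_ite, Cmd.eval_seq, Cmd.eval_set, Cmd.eval_skip]
    split_ifs <;> simp [hf]

theorem sumLow_spec {x : List ℕ} {s : Store Var Arr} {e : ℕ → ℤ} {z W : ℕ}
    (h : EvalPre x s e z W) (hz : s.var .z = z) : LowInv s e z z (sumLow.eval x s) := by
  have hzs := h.lt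
  have hlen := h.len
  simp only [sumLow, Cmd.eval_seq]
  generalize hs₁ : Cmd.eval x (.set .flag (.lit 1)) (Cmd.eval x (.set .q (.lit 0))
    (Cmd.eval x (.set .p (.lit 0)) s)) = s₁
  have ha₁ : s₁.arr = s.arr := by rw [← hs₁]; simp
  have hz₁ : s₁.var .z = z := by rw [← hs₁]; simp [hz]
  have key := Cmd.loop_induction (x := x) (v := Var.i) (s := s₁) (c := sumLowBody)
    (fun k t => LowInv s e z (min k z) t) ?_ ?_
  · rwa [min_eq_right (by omega)] at key
  · left
    subst hs₁
    simp [dsum_self]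
  · intro k hk t ht ih
    have hzt : t.var .z = z := (ht.var _ (by decide)).trans hz₁
    have hat : t.arr = s.arr := by
      rw [← ha₁]
      funext a
      exact ht.arr a (by cases a <;> decide)
    rcases le_or_gt z k with hkz | hkz
    · rw [show min (k + 1) z = min k z by omega]
      simpa [sumLowBody, hzt, Nat.sub_eq_zero_of_le hkz, LowInv] using ih
    · rw [show min (k + 1) z = k + 1 by omega]
      rw [show min k z = k by omega] at ih
      exact sumLowBody_spec h hzt hat hkz ih

/-- The invariant of the summation from above, before the term number `J - 1` is added: `u - v` is the
partial sum in units of `2 ^ e (J - 1)`, up to saturation. -/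
def HighInv (x : List ℕ) (s : Store Var Arr) (e : ℕ → ℤ) (J : ℕ) (t : Store Var Arr) : Prop :=
  ∃ a : ℤ, (a : ℚ) * 2 ^ e (J - 1) = dsum (coef s) e J (s.var .len) ∧ t.var .u ≤ cap x ∧
    t.var .v ≤ cap x ∧ Near (cap x) (∑ l ∈ Finset.Ico J (s.var .len), (s.arr .p l + s.arr .q l))
      (t.var .u) (t.var .v) a

theorem sumHighBody_spec {x : List ℕ} {s : Store Var Arr} {e : ℕ → ℤ} {z W J k : ℕ}
    (h : EvalPre x s e z W) {t : Store Var Arr} (hzt : t.var .z = z)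
    (hlt : t.var .len = s.var .len) (hat : t.arr = s.arr)
    (hk : J = s.var .len - 1 - k) (hJ : z + 1 ≤ J) (hJ' : J < s.var .len)
    (ih : HighInv x s e (J + 1) t) : HighInv x s e J (sumHighBody.eval x (t.setVar .i k)) := by
  obtain ⟨a, h1, h2, h3, h4⟩ := ih
  have hN := size_le_cap x
  have hlen := h.len
  have h16 : ((1 : Fin 16) : ℕ) = 1 := rfl
  have hg1 : ¬ s.var .len - min (min (k + z) (cap x) + 1) (cap x) = 0 := by omega
  rw [Nat.add_sub_cancel] at h1
  have hsum := h.sum_Ico_le (i := J) (j := s.var .len) le_rfl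
  have hcap := h.le_cap
  have hgap := h.gap (J - 1) (by omega)
  have hmono := h.mono (J - 1) (by omega)
  rw [show J - 1 + 1 = J by omega] at hgap hmono
  obtain ⟨d, hd⟩ := Int.eq_ofNat_of_zero_le (sub_nonneg.2 hmono)
  rw [hd, Int.toNat_natCast] at hgap
  have hS := Finset.sum_eq_sum_Ico_succ_bot hJ' (fun l => s.arr .p l + s.arr .q l)
  rw [hS] at hsum
  have h5 := h4.add (P := s.arr .p J) (Q := s.arr .q J) h2 h3 (by omega)
  have h6 := h5.mul d (by omega)
  rw [← hgap] at h6
  simp only [HighInv, sumHighBody, Cmd.eval_seq, Cmd.eval_set, Cmd.eval_ite, Ex.eval_add,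
    Ex.eval_sub, Ex.eval_mul, Ex.eval_var, Ex.eval_get, Ex.eval_lit, Store.setVar_var,
    Store.setVar_arr, reduceCtorEq, if_false, if_true, hat, hzt, hlt, hg1, h16, ← hk]
  refine ⟨(a + s.arr .p J - s.arr .q J) * 2 ^ d, ?_, min_le_right _ _, min_le_right _ _, ?_⟩
  · have hg2 : (2 : ℚ) ^ d * 2 ^ e (J - 1) = 2 ^ e J := by
      rw [← zpow_natCast, ← zpow_add₀ two_ne_zero]
      congr 1
      omega
    rw [dsum_succ_left _ _ hJ', ← h1]
    push_cast [coef]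
    rw [mul_assoc, hg2]
    ring
  · rw [hS, add_comm (s.arr .p J + s.arr .q J), ← add_assoc]
    exact h6

theorem sumHigh_spec {x : List ℕ} {s : Store Var Arr} {e : ℕ → ℤ} {z W : ℕ}
    (h : EvalPre x s e z W) (hz : s.var .z = z) : HighInv x s e (z + 1) (sumHigh.eval x s) := by
  have hzs := h.lt
  have hlen := h.len
  have hN := size_le_cap x
  simp only [sumHigh, Cmd.eval_seq]
  generalize hs₁ : Cmd.eval x (.set .v (.lit 0)) (Cmd.eval x (.set .u (.lit 0)) s) = s₁
  have ha₁ : s₁.arr = s.arr := by rw [← hs₁]; simp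
  have hz₁ : s₁.var .z = z := by rw [← hs₁]; simp [hz]
  have hl₁ : s₁.var .len = s.var .len := by rw [← hs₁]; simp
  have key := Cmd.loop_induction (x := x) (v := Var.i) (s := s₁) (c := sumHighBody)
    (fun k t => HighInv x s e (max (s.var .len - k) (z + 1)) t) ?_ ?_
  · rwa [show max (s.var .len - size x) (z + 1) = z + 1 by omega] at key
  · subst hs₁
    rw [show max (s.var .len - 0) (z + 1) = s.var .len by omega]
    exact ⟨0, by simp [dsum_self], by simp, by simp, by left; simp⟩
  · intro k hk t ht ih
    have hzt : t.var .z = z := (ht.var _ (by decide)).trans hz₁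
    have hlt : t.var .len = s.var .len := (ht.var _ (by decide)).trans hl₁
    have hat : t.arr = s.arr := by
      rw [← ha₁]
      funext a
      exact ht.arr a (by cases a <;> decide)
    rcases le_or_gt (s.var .len) (k + z + 1) with hkz | hkz
    · rw [show max (s.var .len - (k + 1)) (z + 1) = max (s.var .len - k) (z + 1) by omega]
      have hg : s.var .len - min (min (k + z) (cap x) + 1) (cap x) = 0 := by omega
      simpa [sumHighBody, hzt, hlt, hg, HighInv] using ih
    · rw [show max (s.var .len - (k + 1)) (z + 1) = s.var .len - (k + 1) by omega]
      rw [show max (s.var .len - k) (z + 1) = s.var .len - (k + 1) + 1 by omega] at ih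
      exact sumHighBody_spec h hzt hlt hat (by omega) (by omega) (by omega) ih

/-- The program evaluates a dyadic sum: it decides whether it is an integer, and if so computes it
up to saturation. -/
theorem evalSum_spec {x : List ℕ} {s : Store Var Arr} {e : ℕ → ℤ} {z W : ℕ}
    (h : EvalPre x s e z W) :
    ((evalSum.eval x s).var .flag = 1 ∧ ∃ M : ℤ, dsum (coef s) e 0 (s.var .len) = M ∧
      Near (cap x) (2 * W) ((evalSum.eval x s).var .p) ((evalSum.eval x s).var .q) M) ∨
    ((evalSum.eval x s).var .flag = 0 ∧ ¬ ∃ M : ℤ, dsum (coef s) e 0 (s.var .len) = M) := by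
  have hz := locate_spec h
  have hlt := h.lt
  have hcap := h.le_cap
  have a₁ : (locate.eval x s).arr = s.arr :=
    funext fun a => Cmd.eval_arr x _ s (by cases a <;> decide)
  have l₁ : (locate.eval x s).var .len = s.var .len := Cmd.eval_var x _ s (by decide)
  have h₁ : EvalPre x (locate.eval x s) e z W := h.congr l₁ a₁
  have low := sumLow_spec h₁ hz
  simp only [evalSum, Cmd.eval_seq]
  generalize locate.eval x s = s₁ at *
  have a₂ : (sumLow.eval x s₁).arr = s.arr :=
    (funext fun a => Cmd.eval_arr x _ _ (by cases a <;> decide)).trans a₁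
  have l₂ : (sumLow.eval x s₁).var .len = s.var .len := (Cmd.eval_var x _ _ (by decide)).trans l₁
  have z₂ : (sumLow.eval x s₁).var .z = z := (Cmd.eval_var x _ _ (by decide)).trans hz
  have h₂ : EvalPre x (sumLow.eval x s₁) e z W := h.congr l₂ a₂
  generalize sumLow.eval x s₁ = s₂ at *
  obtain ⟨a, h3, h4, h5, h6⟩ := sumHigh_spec h₂ z₂
  have a₃ : (sumHigh.eval x s₂).arr = s.arr :=
    (funext fun a => Cmd.eval_arr x _ _ (by cases a <;> decide)).trans a₂
  have z₃ : (sumHigh.eval x s₂).var .z = z := (Cmd.eval_var x _ _ (by decide)).trans z₂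
  have p₃ : (sumHigh.eval x s₂).var .p = s₂.var .p := Cmd.eval_var x _ _ (by decide)
  have q₃ : (sumHigh.eval x s₂).var .q = s₂.var .q := Cmd.eval_var x _ _ (by decide)
  have f₃ : (sumHigh.eval x s₂).var .flag = s₂.var .flag := Cmd.eval_var x _ _ (by decide)
  generalize sumHigh.eval x s₂ = s₃ at *
  have c₁ : coef s₁ = coef s := by funext j; simp only [coef, a₁]
  have c₂ : coef s₂ = coef s := by funext j; simp only [coef, a₂]
  rw [l₂, c₂] at h3
  rw [l₂, a₂] at h6
  have hsum := h.sum_le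
  rw [← Nat.Ico_zero_eq_range, ← Finset.sum_Ico_consecutive _ (Nat.zero_le z) hlt.le,
    Finset.sum_eq_sum_Ico_succ_bot hlt] at hsum
  have hdsum : dsum (coef s) e 0 (s.var .len) = dsum (coef s) e 0 z + ((coef s z + a : ℤ) : ℚ) := by
    rw [← dsum_add_dsum _ _ (Nat.zero_le z) hlt.le, dsum_succ_left _ _ hlt, ← h3, h.exp_zero]
    simp [h.exp_zero]
  simp only [Cmd.eval_set, Ex.eval_add, Ex.eval_sub, Ex.eval_var, Ex.eval_get, Store.setVar_var,
    Store.setVar_arr, reduceCtorEq, if_false, if_true, a₃, z₃, p₃, q₃, f₃]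
  rw [hdsum]
  rcases low with ⟨hf, hpq, hle, heq⟩ | ⟨hf, hM⟩
  · left
    rw [c₁] at heq
    rw [a₁] at hle
    have e0 : dsum (coef s) e 0 z = (((s₂.var .p : ℤ) - s₂.var .q : ℤ) : ℚ) := by
      rw [← heq, h.exp_zero]; simp
    refine ⟨hf, (s₂.var .p : ℤ) - s₂.var .q + (coef s z + a), ?_, ?_⟩
    · rw [e0]; push_cast; ring
    · have n1 := h6.add (P := s.arr .p z) (Q := s.arr .q z) h4 h5 (by omega)
      have n2 := n1.add (P := s₂.var .p) (Q := s₂.var .q) (by omega) (by omega) (by omega)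
      rw [show (s₂.var .p : ℤ) - s₂.var .q + (coef s z + a) =
        a + s.arr .p z - s.arr .q z + s₂.var .p - s₂.var .q by simp only [coef]; ring]
      exact n2.mono (by omega)
  · right
    rw [c₁] at hM
    refine ⟨hf, fun ⟨M, h⟩ => hM ⟨M - (coef s z + a), ?_⟩⟩
    rw [Int.cast_sub, ← h]
    ring

end Baumslag

/-! ### Comparing exponents and testing sums -/

namespace Baumslag

open RAM

/-- The sign of the letter number `l`: `1` if it is `a`, and `-1` if it is `a⁻¹`, the code of which is
`0`. The sign of letter number `0` is irrelevant. -/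
def sgn (x : List ℕ) (l : ℕ) : ℤ := if x.getD (l - 1) 0 = 0 then -1 else 1

/-- The sum that is represented by the row `l` of the array of coefficients. -/
def rowSum (x : List ℕ) (A : ℕ → ℕ) (e : ℕ → ℤ) (l : ℕ) : ℚ :=
  ∑ j ∈ Finset.range (size x), ((A (l * size x + j) * sgn x j : ℤ) : ℚ) * 2 ^ e j

/-- The sum that is represented by the letters of status `key`. -/
def statSum (x : List ℕ) (st : ℕ → ℕ) (e : ℕ → ℤ) (key : ℕ) : ℚ :=
  ∑ j ∈ Finset.range (size x), ((if st j = key then sgn x j else 0 : ℤ) : ℚ) * 2 ^ e j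

/-- The list of letters `L` is held by the store, along with its gaps, and sorted by the exponents `e`.
It contains letter number `0`, of exponent `0`. -/
structure Sorted (x : List ℕ) (s : Store Var Arr) (L : List ℕ) (e : ℕ → ℤ) : Prop where
  len : s.var .len = L.length
  get : ∀ i (h : i < L.length), s.arr .t i = L[i]
  nodup : L.Nodup
  lt : ∀ l ∈ L, l < size x
  zero_mem : 0 ∈ L
  exp_zero : e 0 = 0
  sorted : L.Pairwise fun l m => e l ≤ e m
  gap : ∀ i (h : i + 1 < L.length),
    s.arr .g i = min (2 ^ (e L[i + 1] - e L[i]).toNat) (cap x)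

variable {x : List ℕ} {s : Store Var Arr} {L : List ℕ} {e : ℕ → ℤ}

theorem length_le_size_of_nodup (h : L.Nodup) (hl : ∀ l ∈ L, l < size x) : L.length ≤ size x := by
  rw [← List.toFinset_card_of_nodup h, ← Finset.card_range (size x)]
  exact Finset.card_le_card fun l hl' => Finset.mem_range.2 (hl l (List.mem_toFinset.1 hl'))

theorem Sorted.congr (h : Sorted x s L e) {t : Store Var Arr} (hl : t.var .len = s.var .len)
    (ht : t.arr .t = s.arr .t) (hg : t.arr .g = s.arr .g) : Sorted x t L e :=
  ⟨hl ▸ h.len, ht ▸ h.get, h.nodup, h.lt, h.zero_mem, h.exp_zero, h.sorted, hg ▸ h.gap⟩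

theorem Sorted.length_le (h : Sorted x s L e) : L.length ≤ size x :=
  length_le_size_of_nodup h.nodup h.lt

theorem getD_eq_of_lt {i : ℕ} (h : i < L.length) : L.getD i 0 = L[i] := by
  simp [List.getD_eq_getElem?_getD, h]

/-- The hypotheses for the evaluation of a sum over a sorted list. -/
theorem Sorted.evalPre (h : Sorted x s L e) {W : ℕ}
    (hW : ∀ i < L.length, s.arr .p i + s.arr .q i ≤ W) (hc : 4 * (size x * W) < cap x) :
    EvalPre x s (fun i => e (L.getD i 0)) (L.idxOf 0) (size x * W) where
  len := h.len ▸ h.length_le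
  lt := by rw [h.len]; exact List.idxOf_lt_length_of_mem h.zero_mem
  eq_zero := by
    intro i hi
    rw [h.len] at hi
    have h1 := List.idxOf_lt_length_of_mem h.zero_mem
    rw [h.get i hi, ← h.nodup.getElem_inj_iff (hi := hi) (hj := h1), List.getElem_idxOf]
  exp_zero := by
    have h1 := List.idxOf_lt_length_of_mem h.zero_mem
    rw [getD_eq_of_lt h1, List.getElem_idxOf, h.exp_zero]
  mono := by
    intro i hi
    rw [h.len] at hi
    rw [getD_eq_of_lt hi, getD_eq_of_lt (Nat.lt_of_succ_lt hi)]
    exact List.pairwise_iff_getElem.1 h.sorted _ _ _ _ (Nat.lt_succ_self i)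
  gap := by
    intro i hi
    rw [h.len] at hi
    rw [getD_eq_of_lt hi, getD_eq_of_lt (Nat.lt_of_succ_lt hi), h.gap i hi]
  sum_le := by
    rw [h.len]
    refine (Finset.sum_le_card_nsmul _ _ W fun i hi => hW i (Finset.mem_range.1 hi)).trans ?_
    rw [Finset.card_range, smul_eq_mul]
    exact Nat.mul_le_mul_right _ h.length_le
  le_cap := hc

/-- A sum over the positions in the list as a sum over all letters. -/
theorem dsum_eq_sum_range (h : Sorted x s L e) {c C : ℕ → ℤ}
    (hc : ∀ i (h : i < L.length), c i = C L[i]) (hC : ∀ l < size x, C l ≠ 0 → l ∈ L) :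
    dsum c (fun i => e (L.getD i 0)) 0 L.length =
      ∑ l ∈ Finset.range (size x), (C l : ℚ) * 2 ^ e l := by
  have h1 : ∑ l ∈ Finset.range (size x), (C l : ℚ) * 2 ^ e l =
      ∑ l ∈ L.toFinset, (C l : ℚ) * 2 ^ e l := by
    symm
    refine Finset.sum_subset (fun l hl => Finset.mem_range.2 (h.lt l (List.mem_toFinset.1 hl)))
      fun l hl hl' => ?_
    have : C l = 0 := by
      by_contra h0
      exact hl' (List.mem_toFinset.2 (hC l (Finset.mem_range.1 hl) h0))
    simp [this]
  rw [h1, List.sum_toFinset _ h.nodup, dsum, Nat.Ico_zero_eq_range, Finset.sum_range,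
    ← Fin.sum_univ_getElem, ← (finCongr (List.length_map (as := L) _)).sum_comp]
  refine Finset.sum_congr rfl fun i _ => ?_
  have hi : (i : ℕ) < L.length := by simpa using i.2
  simp [hc _ hi, hi]

theorem cap_le_two_pow_size (x : List ℕ) : cap x ≤ 2 ^ size x := by
  have : ∀ m, 16 ≤ m → 8 * m ^ 2 ≤ 2 ^ m := by
    intro m hm
    induction m, hm using Nat.le_induction with
    | base => norm_num
    | succ k hk ih =>
      rw [pow_succ 2 k]
      nlinarith
  exact this _ (by simp [size])

theorem compareBody_spec (t : Store Var Arr) {k a b N : ℕ} (hN : N = size x) (hk : k < N)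
    (ht : t.arr .t k < N) (ha : t.var .x = a) (hb : t.var .y = b) (haN : a < N) (hbN : b < N) :
    coef (compareBody.eval x (t.setVar .i k)) k =
        ((t.arr .row (b * N + t.arr .t k) : ℤ) - t.arr .row (a * N + t.arr .t k)) *
          sgn x (t.arr .t k) ∧
      (compareBody.eval x (t.setVar .i k)).arr .p k +
        (compareBody.eval x (t.setVar .i k)).arr .q k =
          t.arr .row (b * N + t.arr .t k) + t.arr .row (a * N + t.arr .t k) := by
  subst hN ha hb
  have h1 : ∀ c < size x, c * size x + size x ≤ cap x := by
    intro c hc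
    have : (c + 1) * size x ≤ size x * size x := Nat.mul_le_mul_right _ hc
    have h2 : cap x = 8 * size x ^ 2 := rfl
    nlinarith
  have h2 : ∀ c < size x, min (min (c * size x) (cap x) + t.arr .t k) (cap x) =
      c * size x + t.arr .t k := by
    intro c hc
    have := h1 c hc
    omega
  have h16 : ((1 : Fin 16) : ℕ) = 1 := rfl
  by_cases h0 : x.getD (t.arr .t k - 1) 0 = 0
  · simp [compareBody, entry, coef, sgn, h0, h2, haN, hbN, -List.getD_eq_getElem?_getD]
    exact add_comm _ _
  · simp [compareBody, entry, coef, sgn, h0, h2, haN, hbN, -List.getD_eq_getElem?_getD]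

theorem compareBody_other (x : List ℕ) (t : Store Var Arr) {k i : ℕ} (hi : i ≠ k) :
    (compareBody.eval x (t.setVar .i k)).arr .p i = t.arr .p i ∧
      (compareBody.eval x (t.setVar .i k)).arr .q i = t.arr .q i := by
  simp only [compareBody, Cmd.eval_seq, Cmd.eval_ite]
  split_ifs <;> simp [hi]

/-- The exponents of the two letters `a`, `b` are compared correctly, if they are given by rows that
refer to listed letters only. If `b` has the greater exponent, then the difference is found exactly
enough to yield the gap: beyond `size x`, the power of `2` exceeds `cap x` anyway. -/
theorem compare_spec (h : Sorted x s L e) {a b : ℕ} (ha : s.var .x = a) (hb : s.var .y = b)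
    (haN : a < size x) (hbN : b < size x)
    (hm : ∀ i, s.arr .row i ≤ x.length)
    (hsa : ∀ j < size x, s.arr .row (a * size x + j) ≠ 0 → j ∈ L)
    (hsb : ∀ j < size x, s.arr .row (b * size x + j) ≠ 0 → j ∈ L)
    {f : ℕ → ℤ} (hfa : rowSum x (s.arr .row) e a = f a) (hfb : rowSum x (s.arr .row) e b = f b) :
    ((0 < (compare.eval x s).var .q) ↔ f b < f a) ∧
      (f a ≤ f b → min (2 ^ min ((compare.eval x s).var .p) (size x)) (cap x) =
        min (2 ^ (f b - f a).toNat) (cap x)) := by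
  have key := Cmd.loop_induction (x := x) (v := Var.i) (s := s) (c := compareBody)
    (fun k t => ∀ i (h : i < L.length), i < k →
      coef t i = ((s.arr .row (b * size x + L[i]) : ℤ) - s.arr .row (a * size x + L[i])) *
        sgn x L[i] ∧
      t.arr .p i + t.arr .q i =
        s.arr .row (b * size x + L[i]) + s.arr .row (a * size x + L[i]))
    (by simp) ?_
  · have hl : (Cmd.eval x (.loop .i compareBody) s).var .len = s.var .len :=
      Cmd.eval_var x _ _ (by decide)
    have ht : (Cmd.eval x (.loop .i compareBody) s).arr .t = s.arr .t :=
      Cmd.eval_arr x _ _ (by decide)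
    have hg : (Cmd.eval x (.loop .i compareBody) s).arr .g = s.arr .g :=
      Cmd.eval_arr x _ _ (by decide)
    rw [compare, Cmd.eval_seq]
    generalize Cmd.eval x (.loop .i compareBody) s = s₁ at *
    have h' := h.congr hl ht hg
    have hcap : cap x = 8 * size x ^ 2 := rfl
    have hN : size x = x.length + 16 := rfl
    have hlen := h.length_le
    have hsmall : 2 * (size x * (2 * x.length)) + size x < cap x := by
      have : ∀ n : ℕ, 2 * ((n + 16) * (2 * n)) + (n + 16) < 8 * (n + 16) ^ 2 := fun n => by
        ring_nf
        omega
      exact this _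
    have pre := h'.evalPre (W := 2 * x.length)
      (fun i hi => by
        rw [(key i hi (hi.trans_le hlen)).2]
        have h1 := hm (b * size x + L[i])
        have h2 := hm (a * size x + L[i])
        omega) (by rw [hcap]; nlinarith)
    have hd : dsum (coef s₁) (fun i => e (L.getD i 0)) 0 L.length = ((f b - f a : ℤ) : ℚ) := by
      rw [dsum_eq_sum_range h' (C := fun l => ((s.arr .row (b * size x + l) : ℤ) -
        s.arr .row (a * size x + l)) * sgn x l) (fun i hi => (key i hi (hi.trans_le hlen)).1),
        Int.cast_sub, ← hfa,
        ← hfb, rowSum, rowSum, ← Finset.sum_sub_distrib]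
      · refine Finset.sum_congr rfl fun j _ => ?_
        push_cast
        ring
      · intro l hl h0
        by_contra hl'
        have h1 := mt (hsa l hl) hl'
        have h2 := mt (hsb l hl) hl'
        rw [not_not] at h1 h2
        simp [h1, h2] at h0
    have spec := evalSum_spec pre
    rw [h'.len, hd] at spec
    rcases spec with ⟨_, M, hM, near⟩ | ⟨_, hM⟩
    · have hM' := Int.cast_injective hM
      subst hM'
      constructor
      · rw [near.pos_iff (by omega)]
        omega
      · intro hab
        exact near.min_pow hsmall (cap_le_two_pow_size x) (by omega)
    · exact absurd ⟨_, rfl⟩ hM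
  · intro k hk t ht ih i hi hik
    have ht' : t.arr .t = s.arr .t := ht.arr _ (by decide)
    have hr : t.arr .row = s.arr .row := ht.arr _ (by decide)
    have hx : t.var .x = a := (ht.var _ (by decide)).trans ha
    have hy : t.var .y = b := (ht.var _ (by decide)).trans hb
    rcases Nat.lt_succ_iff_lt_or_eq.1 hik with h1 | rfl
    · rw [← (ih i hi h1).1, ← (ih i hi h1).2]
      have := compareBody_other x t (k := k) (i := i) (by omega)
      simp only [coef, this.1, this.2, and_self]
    · have h2 : t.arr .t i = L[i] := by rw [ht', h.get i hi]
      have := compareBody_spec t rfl hk (h2 ▸ h.lt _ (List.getElem_mem hi)) hx hy haN hbN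
      rw [h2, hr] at this
      exact this

theorem testBody_spec (x : List ℕ) (t : Store Var Arr) (k : ℕ) :
    coef (testBody.eval x (t.setVar .i k)) k =
        (if t.arr .st (t.arr .t k) = t.var .key then sgn x (t.arr .t k) else 0) ∧
      (testBody.eval x (t.setVar .i k)).arr .p k +
        (testBody.eval x (t.setVar .i k)).arr .q k ≤ 1 ∧
      ∀ i ≠ k, (testBody.eval x (t.setVar .i k)).arr .p i = t.arr .p i ∧
        (testBody.eval x (t.setVar .i k)).arr .q i = t.arr .q i := by
  have h16 : ((1 : Fin 16) : ℕ) = 1 := rfl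
  by_cases h1 : t.arr .st (t.arr .t k) = t.var .key <;>
    by_cases h0 : x.getD (t.arr .t k - 1) 0 = 0 <;>
    simp +contextual [testBody, coef, sgn, h0, h1, -List.getD_eq_getElem?_getD]

/-- Testing whether a sum is an integer, and whether it is zero. -/
theorem test_spec (h : Sorted x s L e) (ex : E)
    (hs : ∀ j < size x, s.arr .st j = ex.eval x s → j ∈ L) :
    ((test ex).eval x s).var .flag = 1 ∧ (∃ M : ℤ, statSum x (s.arr .st) e (ex.eval x s) = M ∧
        (((test ex).eval x s).var .p + ((test ex).eval x s).var .q = 0 ↔ M = 0)) ∨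
      ((test ex).eval x s).var .flag = 0 ∧
        ¬ ∃ M : ℤ, statSum x (s.arr .st) e (ex.eval x s) = M := by
  rw [test, Cmd.eval_seq, Cmd.eval_seq]
  generalize hkey : ex.eval x s = key at *
  have hk₁ : (Cmd.eval x (.set .key ex) s).var .key = key := by simp [hkey]
  have ha₁ : (Cmd.eval x (.set .key ex) s).arr = s.arr := by simp
  have hl₁ : (Cmd.eval x (.set .key ex) s).var .len = s.var .len := by simp
  generalize Cmd.eval x (.set .key ex) s = s₁ at *
  have ind := Cmd.loop_induction (x := x) (v := Var.i) (s := s₁) (c := testBody)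
    (fun k t => ∀ i (h : i < L.length), i < k →
      coef t i = (if s.arr .st L[i] = key then sgn x L[i] else 0) ∧
      t.arr .p i + t.arr .q i ≤ 1)
    (by simp) ?_
  · have hl : (Cmd.eval x (.loop .i testBody) s₁).var .len = s₁.var .len :=
      Cmd.eval_var x _ _ (by decide)
    have ht : (Cmd.eval x (.loop .i testBody) s₁).arr .t = s₁.arr .t :=
      Cmd.eval_arr x _ _ (by decide)
    have hg : (Cmd.eval x (.loop .i testBody) s₁).arr .g = s₁.arr .g :=
      Cmd.eval_arr x _ _ (by decide)
    generalize Cmd.eval x (.loop .i testBody) s₁ = s₂ at *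
    have h' := h.congr (hl.trans hl₁) (ht.trans (by rw [ha₁])) (hg.trans (by rw [ha₁]))
    have hcap : cap x = 8 * size x ^ 2 := rfl
    have hN : size x = x.length + 16 := rfl
    have hlen := h.length_le
    have hsmall : 4 * (size x * 1) < cap x := by
      rw [hcap, hN]
      generalize x.length = n
      nlinarith
    have pre := h'.evalPre (W := 1) (fun i hi => (ind i hi (hi.trans_le hlen)).2) hsmall
    have hd : dsum (coef s₂) (fun i => e (L.getD i 0)) 0 L.length =
        statSum x (s.arr .st) e key := by
      rw [dsum_eq_sum_range h' (C := fun l => if s.arr .st l = key then sgn x l else 0)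
        (fun i hi => (ind i hi (hi.trans_le hlen)).1), statSum]
      intro l hl h0
      exact hs l hl (by by_contra h1; simp [h1] at h0)
    have spec := evalSum_spec pre
    rw [h'.len, hd] at spec
    refine spec.imp (fun ⟨h1, M, hM, near⟩ => ⟨h1, M, hM, near.eq_zero_iff (by omega)⟩) id
  · intro k hk t ht ih i hi hik
    have ht' : t.arr .t = s.arr .t := (ht.arr _ (by decide)).trans (by rw [ha₁])
    have hr : t.arr .st = s.arr .st := (ht.arr _ (by decide)).trans (by rw [ha₁])
    have hx : t.var .key = key := (ht.var _ (by decide)).trans hk₁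
    obtain ⟨b1, b2, b3⟩ := testBody_spec x t k
    rcases Nat.lt_succ_iff_lt_or_eq.1 hik with h1 | rfl
    · have := b3 i (by omega)
      simpa only [coef, this.1, this.2] using ih i hi h1
    · have h2 : t.arr .t i = L[i] := by rw [ht', h.get i hi]
      rw [h2, hr, hx] at b1
      exact ⟨b1, b2⟩

end Baumslag

/-! ### Sorting the list of letters again -/

namespace Baumslag

open RAM

/-- The array `f` begins with the list `M` of length `n`. -/
def Holds (f : ℕ → ℕ) (n : ℕ) (M : List ℕ) : Prop :=
  n = M.length ∧ ∀ i (h : i < M.length), f i = M[i]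

theorem Holds.nil (f : ℕ → ℕ) : Holds f 0 [] := ⟨rfl, by simp⟩

theorem Holds.push {f g : ℕ → ℕ} {n : ℕ} {M : List ℕ} (h : Holds f n M) {a : ℕ} (ha : g n = a)
    (hg : ∀ i < n, g i = f i) : Holds g (n + 1) (M ++ [a]) := by
  refine ⟨by simp [h.1], fun i hi => ?_⟩
  simp only [List.length_append, List.length_singleton] at hi
  rcases Nat.lt_succ_iff_lt_or_eq.1 hi with h1 | rfl
  · rw [List.getElem_append_left h1, ← h.2 i h1, hg i (h.1 ▸ h1)]
  · rw [List.getElem_concat_length rfl, ← ha, h.1]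

/-- A sorted list of letters with exponents `e`, where the rows of the letters that are not removed
evaluate to new exponents `e'`. -/
structure Rows (x : List ℕ) (s : Store Var Arr) (L : List ℕ) (e e' : ℕ → ℤ) : Prop where
  sorted : Sorted x s L e
  le : ∀ i, s.arr .row i ≤ x.length
  supp : ∀ l ∈ L, s.arr .st l ≠ 0 → ∀ j < size x, s.arr .row (l * size x + j) ≠ 0 → j ∈ L
  sum : ∀ l ∈ L, s.arr .st l ≠ 0 → rowSum x (s.arr .row) e l = e' l

variable {x : List ℕ} {s : Store Var Arr} {L : List ℕ} {e e' : ℕ → ℤ}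

theorem Rows.congr (h : Rows x s L e e') {t : Store Var Arr} (hl : t.var .len = s.var .len)
    (ht : t.arr .t = s.arr .t) (hg : t.arr .g = s.arr .g) (hr : t.arr .row = s.arr .row)
    (hs : t.arr .st = s.arr .st) : Rows x t L e e' :=
  ⟨h.sorted.congr hl ht hg, hr ▸ h.le, by rw [hr, hs]; exact h.supp, by rw [hr, hs]; exact h.sum⟩

theorem Rows.compare (h : Rows x s L e e') {a b : ℕ} (ha : s.var .x = a) (hb : s.var .y = b)
    (haL : a ∈ L) (hbL : b ∈ L) (has : s.arr .st a ≠ 0) (hbs : s.arr .st b ≠ 0) :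
    ((0 < (compare.eval x s).var .q) ↔ e' b < e' a) ∧
      (e' a ≤ e' b → min (2 ^ min ((compare.eval x s).var .p) (size x)) (cap x) =
        min (2 ^ (e' b - e' a).toNat) (cap x)) :=
  compare_spec h.sorted ha hb (h.sorted.lt a haL) (h.sorted.lt b hbL) h.le (h.supp a haL has)
    (h.supp b hbL hbs) (h.sum a haL has) (h.sum b hbL hbs)

/-- The letters in the list that are neither removed nor flagged. -/
def keepList (s : Store Var Arr) (L : List ℕ) : List ℕ :=
  L.filter fun l => s.arr .st l ≠ 0 ∧ s.arr .f l = 0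

/-- The letters in the list that are flagged and not removed. -/
def flagList (s : Store Var Arr) (L : List ℕ) : List ℕ :=
  L.filter fun l => s.arr .st l ≠ 0 ∧ s.arr .f l ≠ 0

theorem split_spec (h : Sorted x s L e) :
    Holds ((split.eval x s).arr .rl) ((split.eval x s).var .nr) (keepList s L) ∧
      Holds ((split.eval x s).arr .vl) ((split.eval x s).var .nv) (flagList s L) := by
  have hlen := h.length_le
  simp only [split, Cmd.eval_seq]
  generalize hs₁ : Cmd.eval x (.set .nv (.lit 0)) (Cmd.eval x (.set .nr (.lit 0)) s) = s₁
  have ha₁ : s₁.arr = s.arr := by rw [← hs₁]; simp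
  have hl₁ : s₁.var .len = s.var .len := by rw [← hs₁]; simp
  have key := Cmd.loop_induction (x := x) (v := Var.i) (s := s₁) (c := splitBody)
    (fun k t => Holds (t.arr .rl) (t.var .nr) (keepList s (L.take k)) ∧
      Holds (t.arr .vl) (t.var .nv) (flagList s (L.take k))) ?_ ?_
  · rwa [List.take_of_length_le hlen] at key
  · subst hs₁
    constructor <;> simp [keepList, flagList, Holds]
  · rintro k hk t ht ⟨ihr, ihv⟩
    have hlt : t.var .len = L.length := ((ht.var _ (by decide)).trans hl₁).trans h.len
    have htt : t.arr .t = s.arr .t := (ht.arr _ (by decide)).trans (by rw [ha₁])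
    have hst : t.arr .st = s.arr .st := (ht.arr _ (by decide)).trans (by rw [ha₁])
    have hft : t.arr .f = s.arr .f := (ht.arr _ (by decide)).trans (by rw [ha₁])
    have h16 : ((1 : Fin 16) : ℕ) = 1 := rfl
    rcases le_or_gt L.length k with hkL | hkL
    · rw [List.take_of_length_le (by omega)]
      rw [List.take_of_length_le hkL] at ihr ihv
      simpa [splitBody, hlt, Nat.sub_eq_zero_of_le hkL] using And.intro ihr ihv
    · have hcap := size_le_cap x
      have hkL' : ¬ L.length - k = 0 := by omega
      have hr := (L.take k).length_filter_le fun l => s.arr .st l ≠ 0 ∧ s.arr .f l = 0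
      have hv := (L.take k).length_filter_le fun l => s.arr .st l ≠ 0 ∧ s.arr .f l ≠ 0
      change (keepList s _).length ≤ _ at hr
      change (flagList s _).length ≤ _ at hv
      rw [List.length_take] at hr hv
      have hr' : min (t.var .nr + 1) (cap x) = t.var .nr + 1 := by have := ihr.1; omega
      have hv' : min (t.var .nv + 1) (cap x) = t.var .nv + 1 := by have := ihv.1; omega
      rw [List.take_succ_eq_append_getElem hkL]
      simp only [keepList, flagList, List.filter_append] at *
      by_cases h1 : s.arr .st L[k] = 0
      · simpa [splitBody, hlt, hkL', htt, hst, h.get k hkL, h1] using And.intro ihr ihv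
      · by_cases h2 : s.arr .f L[k] = 0
        · simp [splitBody, hlt, hkL', htt, hst, hft, h.get k hkL, h1, h2, hr'] at *
          exact ⟨ihr.push (by simp) fun i hi => by simp [hi.ne], ihv⟩
        · simp [splitBody, hlt, hkL', htt, hst, hft, h.get k hkL, h1, h2, hv'] at *
          exact ⟨ihr, ihv.push (by simp) fun i hi => by simp [hi.ne]⟩

/-- The choice of the next letter of the merged list. -/
theorem choose_spec (h : Rows x s L e e') {R V : List ℕ} (hR : Holds (s.arr .rl) (s.var .nr) R)
    (hV : Holds (s.arr .vl) (s.var .nv) V) (hRL : ∀ l ∈ R, l ∈ L ∧ s.arr .st l ≠ 0)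
    (hVL : ∀ l ∈ V, l ∈ L ∧ s.arr .st l ≠ 0) :
    (choose.eval x s).var .x = s.arr .rl (s.var .i') ∧
    (choose.eval x s).var .y = s.arr .vl (s.var .j') ∧
    (¬ (choose.eval x s).var .lt = 0 ↔ s.var .j' < V.length ∧ (s.var .i' < R.length →
      e' (s.arr .vl (s.var .j')) < e' (s.arr .rl (s.var .i')))) := by
  simp only [choose, Cmd.eval_seq]
  generalize hs₁ : Cmd.eval x (.set .lt (.lit 0)) (Cmd.eval x (.set .y (.get .vl (.var .j')))
    (Cmd.eval x (.set .x (.get .rl (.var .i'))) s)) = s₁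
  have ha₁ : s₁.arr = s.arr := by rw [← hs₁]; simp
  have hx₁ : s₁.var .x = s.arr .rl (s.var .i') := by rw [← hs₁]; simp
  have hy₁ : s₁.var .y = s.arr .vl (s.var .j') := by rw [← hs₁]; simp
  have hl₁ : s₁.var .len = s.var .len := by rw [← hs₁]; simp
  have ht₁ : s₁.var .lt = 0 := by rw [← hs₁]; simp
  have hi₁ : s₁.var .i' = s.var .i' := by rw [← hs₁]; simp
  have hj₁ : s₁.var .j' = s.var .j' := by rw [← hs₁]; simp
  have hr₁ : s₁.var .nr = R.length := by rw [← hR.1, ← hs₁]; simp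
  have hv₁ : s₁.var .nv = V.length := by rw [← hV.1, ← hs₁]; simp
  have h₁ : Rows x s₁ L e e' := h.congr hl₁ (by rw [ha₁]) (by rw [ha₁]) (by rw [ha₁]) (by rw [ha₁])
  clear hs₁
  have hx₂ : (compare.eval x s₁).var .x = s₁.var .x := Cmd.eval_var x _ _ (by decide)
  have hy₂ : (compare.eval x s₁).var .y = s₁.var .y := Cmd.eval_var x _ _ (by decide)
  have h16 : ((1 : Fin 16) : ℕ) = 1 := rfl
  simp only [Cmd.eval_ite, Ex.eval_sub, Ex.eval_var, Cmd.eval_seq, Cmd.eval_set, Cmd.eval_skip,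
    hr₁, hv₁, hi₁, hj₁]
  split_ifs with h1 h2
  · refine ⟨hx₁, hy₁, ?_⟩
    rw [ht₁]
    have : ¬ s.var .j' < V.length := by omega
    simp [this]
  · refine ⟨by simpa using hx₁, by simpa using hy₁, ?_⟩
    have h3 : ¬ s.var .i' < R.length := by omega
    have h4 : s.var .j' < V.length := by omega
    simp [h3, h4]
  · refine ⟨by simpa using hx₂.trans hx₁, by simpa using hy₂.trans hy₁, ?_⟩
    have h3 : s.var .i' < R.length := by omega
    have h4 : s.var .j' < V.length := by omega
    have m3 : s.arr .rl (s.var .i') ∈ R := by rw [hR.2 _ h3]; exact List.getElem_mem _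
    have m4 : s.arr .vl (s.var .j') ∈ V := by rw [hV.2 _ h4]; exact List.getElem_mem _
    have := (h₁.compare hx₁ hy₁ (hRL _ m3).1 (hVL _ m4).1 (by rw [ha₁]; exact (hRL _ m3).2)
      (by rw [ha₁]; exact (hVL _ m4).2)).1
    simp only [Store.setVar_var, if_true, h3, h4, true_and, true_implies]
    rw [← this]
    omega

/-- The invariant of `merge` after `o` steps. -/
def MergeInv (e' : ℕ → ℤ) (R V : List ℕ) (o : ℕ) (t : Store Var Arr) : Prop :=
  t.var .i' ≤ R.length ∧ t.var .j' ≤ V.length ∧ t.var .i' + t.var .j' = o ∧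
    ∃ M, Holds (t.arr .t') o M ∧
      M ++ (R.drop (t.var .i')).merge (V.drop (t.var .j')) (fun a b => e' a ≤ e' b) =
        R.merge V (fun a b => e' a ≤ e' b)

theorem mergeBody_spec {R V : List ℕ} {o : ℕ} {t : Store Var Arr} (h : Rows x t L e e')
    (hR : Holds (t.arr .rl) (t.var .nr) R)
    (hV : Holds (t.arr .vl) (t.var .nv) V) (hRL : ∀ l ∈ R, l ∈ L ∧ t.arr .st l ≠ 0)
    (hVL : ∀ l ∈ V, l ∈ L ∧ t.arr .st l ≠ 0) (ho : o < R.length + V.length)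
    (hcap : R.length + V.length ≤ cap x)
    (ih : MergeInv e' R V o t) :
    MergeInv e' R V (o + 1) (mergeBody.eval x (t.setVar .o o)) := by
  obtain ⟨h1, h2, h3, M, hM, heq⟩ := ih
  obtain ⟨c1, c2, c3⟩ := choose_spec (s := t.setVar .o o)
    (h.congr (by simp) (by simp) (by simp) (by simp) (by simp))
    (by simpa using hR) (by simpa using hV) (by simpa using hRL) (by simpa using hVL)
  have c4 : (choose.eval x (t.setVar .o o)).var .o = o :=
    (Cmd.eval_var x _ _ (by decide)).trans (by simp)
  have c5 : (choose.eval x (t.setVar .o o)).var .i' = t.var .i' :=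
    (Cmd.eval_var x _ _ (by decide)).trans (by simp)
  have c6 : (choose.eval x (t.setVar .o o)).var .j' = t.var .j' :=
    (Cmd.eval_var x _ _ (by decide)).trans (by simp)
  have c7 : (choose.eval x (t.setVar .o o)).arr .t' = t.arr .t' :=
    (Cmd.eval_arr x _ _ (by decide)).trans (by simp)
  have hne : ¬ min (R.length + V.length) (cap x) - o = 0 := by omega
  have h16 : ((1 : Fin 16) : ℕ) = 1 := rfl
  have hm1 : min (t.var .i' + 1) (cap x) = t.var .i' + 1 := by omega
  have hm2 : min (t.var .j' + 1) (cap x) = t.var .j' + 1 := by omega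
  simp only [Store.setVar_var, Store.setVar_arr, reduceCtorEq, if_false] at c1 c2 c3
  rw [mergeBody]
  simp only [Cmd.eval_ite, Cmd.eval_seq, Cmd.eval_set, Cmd.eval_put, Cmd.eval_skip,
    Ex.eval_sub, Ex.eval_add, Ex.eval_var, Ex.eval_lit, Store.setVar_var, reduceCtorEq, if_false,
    if_true]
  rw [hR.1, hV.1, if_neg hne]
  generalize choose.eval x (t.setVar .o o) = t' at *
  by_cases hlt : t'.var .lt = 0
  · simp only [hlt, if_true]
    have c3 := not_iff_not.2 c3
    rw [not_not] at c3
    have hlt := c3.1 hlt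
    have hi : t.var .i' < R.length := by
      by_contra h'
      exact hlt ⟨by omega, fun h => absurd h h'⟩
    refine ⟨?_, ?_, ?_, M ++ [R[t.var .i']], hM.push ?_ ?_, ?_⟩
    · simp [c5]; omega
    · simp [c6]; omega
    · simp [c5, c6, hm1]; omega
    · simp [c4, c1, hR.2 _ hi]
    · intro i hi; simp [c4, c7, hi.ne]
    · rw [← heq]
      simp only [Store.setVar_var, Store.setArr_var, reduceCtorEq, if_false, if_true, c5, c6, h16,
        hm1]
      rw [List.append_assoc, List.append_cancel_left_eq, List.drop_eq_getElem_cons hi]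
      rcases h2.eq_or_lt with hj | hj
      · rw [hj, List.drop_length, List.merge_right, List.merge_right]; rfl
      · rw [List.drop_eq_getElem_cons hj, List.cons_merge_cons, if_pos]
        · rfl
        · rw [hR.2 _ hi, hV.2 _ hj] at hlt
          simp only [hi, hj, true_and, true_implies] at hlt
          simpa using hlt
  · simp only [hlt, if_false]
    obtain ⟨hj, hlt⟩ := c3.1 hlt
    refine ⟨?_, ?_, ?_, M ++ [V[t.var .j']], hM.push ?_ ?_, ?_⟩
    · simp [c5]; omega
    · simp [c6]; omega
    · simp [c5, c6, hm2]; omega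
    · simp [c4, c2, hV.2 _ hj]
    · intro i hi; simp [c4, c7, hi.ne]
    · rw [← heq]
      simp only [Store.setVar_var, Store.setArr_var, reduceCtorEq, if_false, if_true, c5, c6, h16,
        hm2]
      rw [List.append_assoc, List.append_cancel_left_eq, List.drop_eq_getElem_cons hj]
      rcases h1.eq_or_lt with hi | hi
      · rw [hi, List.drop_length, List.nil_merge, List.nil_merge]; rfl
      · rw [List.drop_eq_getElem_cons hi, List.cons_merge_cons, if_neg]
        · rfl
        · rw [hR.2 _ hi, hV.2 _ hj] at hlt
          simpa using hlt hi

theorem merge_spec (h : Rows x s L e e') {R V : List ℕ}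
    (hR : Holds (s.arr .rl) (s.var .nr) R)
    (hV : Holds (s.arr .vl) (s.var .nv) V) (hRL : ∀ l ∈ R, l ∈ L ∧ s.arr .st l ≠ 0)
    (hVL : ∀ l ∈ V, l ∈ L ∧ s.arr .st l ≠ 0) (hlen : R.length + V.length ≤ size x) :
    Holds ((merge.eval x s).arr .t') (R.length + V.length)
      (R.merge V (fun a b => e' a ≤ e' b)) := by
  have hcap := size_le_cap x
  simp only [merge, Cmd.eval_seq]
  generalize hs₁ : Cmd.eval x (.set .j' (.lit 0)) (Cmd.eval x (.set .i' (.lit 0)) s) = s₁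
  have ha₁ : s₁.arr = s.arr := by rw [← hs₁]; simp
  have hl₁ : s₁.var .len = s.var .len := by rw [← hs₁]; simp
  have hr₁ : s₁.var .nr = s.var .nr := by rw [← hs₁]; simp
  have hv₁ : s₁.var .nv = s.var .nv := by rw [← hs₁]; simp
  have key := Cmd.loop_induction (x := x) (v := Var.o) (s := s₁) (c := mergeBody)
    (fun k t => MergeInv e' R V (min k (R.length + V.length)) t) ?_ ?_
  · rw [min_eq_right hlen] at key
    obtain ⟨h1, h2, h3, M, hM, heq⟩ := key
    rw [List.drop_eq_nil_of_le (by omega), List.drop_eq_nil_of_le (by omega), List.nil_merge,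
      List.append_nil] at heq
    rwa [← heq]
  · subst hs₁
    refine ⟨by simp, by simp, by simp, [], ?_, by simp⟩
    rw [Nat.zero_min]
    exact Holds.nil _
  · intro k hk t ht ih
    have hlt : t.var .len = s.var .len := (ht.var _ (by decide)).trans hl₁
    have hrt : t.var .nr = s.var .nr := (ht.var _ (by decide)).trans hr₁
    have hvt : t.var .nv = s.var .nv := (ht.var _ (by decide)).trans hv₁
    have hat : ∀ a ∉ mergeBody.arrs, t.arr a = s.arr a := fun a ha =>
      (ht.arr _ ha).trans (by rw [ha₁])
    rcases le_or_gt (R.length + V.length) k with hk' | hk'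
    · rw [min_eq_right (by omega)] at ih ⊢
      have hz : min (R.length + V.length) (cap x) - k = 0 := by omega
      simpa [mergeBody, hrt, hvt, hR.1, hV.1, hz, MergeInv] using ih
    · rw [min_eq_left hk'.le] at ih
      rw [min_eq_left hk']
      exact mergeBody_spec (h.congr hlt (hat _ (by decide)) (hat _ (by decide))
        (hat _ (by decide)) (hat _ (by decide))) (by rwa [hrt, hat _ (by decide)])
        (by rwa [hvt, hat _ (by decide)]) (by rwa [hat _ (by decide)])
        (by rwa [hat _ (by decide)]) hk' (by omega) ih

theorem power_spec (x : List ℕ) (s : Store Var Arr) :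
    (power.eval x s).var .g = min (2 ^ min (s.var .p) (size x)) (cap x) := by
  have hcap := le_cap_of_le x (c := 1) (by norm_num)
  simp only [power, Cmd.eval_seq]
  generalize hs₁ : Cmd.eval x (.set .g (.lit 1)) s = s₁
  have hp : s₁.var .p = s.var .p := by rw [← hs₁]; simp
  refine Cmd.loop_induction (x := x) (v := Var.i) (s := s₁)
    (fun k t => t.var .g = min (2 ^ min (s.var .p) k) (cap x)) ?_ ?_
  · subst hs₁
    simpa using hcap
  · intro k hk t ht ih
    have hpt : t.var .p = s.var .p := (ht.var _ (by decide)).trans hp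
    have h16 : ((2 : Fin 16) : ℕ) = 2 := rfl
    simp only [Cmd.eval_ite, Cmd.eval_set, Cmd.eval_skip, Ex.eval_sub, Ex.eval_var, Ex.eval_mul,
      Ex.eval_lit, Store.setVar_var, reduceCtorEq, if_false, if_true, hpt, h16, ih]
    split_ifs with h1
    · simp only [Store.setVar_var, reduceCtorEq, if_false, ih]
      rw [min_eq_left (a := s.var .p) (by omega), min_eq_left (a := s.var .p) (by omega)]
    · simp only [Store.setVar_var, if_true]
      rw [min_eq_right (a := s.var .p) (by omega), min_eq_right (a := s.var .p) (by omega),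
        pow_succ]
      omega

theorem gaps_spec (h : Rows x s L e e') {M : List ℕ} {n : ℕ}
    (hM : Holds (s.arr .t') n M) (hn : s.var .nr + s.var .nv = n)
    (hML : ∀ l ∈ M, l ∈ L ∧ s.arr .st l ≠ 0) (hlen : n ≤ size x)
    (hs : M.Pairwise fun l m => e' l ≤ e' m) (i : ℕ) (hi : i + 1 < M.length) :
    (gaps.eval x s).arr .g' i = min (2 ^ (e' M[i + 1] - e' M[i]).toNat) (cap x) := by
  have hcap := size_le_cap x
  have hMn := hM.1
  refine Cmd.loop_induction (x := x) (v := Var.o) (s := s) (c := gapsBody)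
    (fun k t => ∀ i (hi : i + 1 < M.length), i < k →
      t.arr .g' i = min (2 ^ (e' M[i + 1] - e' M[i]).toNat) (cap x)) (by simp) ?_ i hi (by omega)
  intro k hk t ht ih i hi hik
  have hlt : t.var .len = s.var .len := ht.var _ (by decide)
  have hrt : t.var .nr = s.var .nr := ht.var _ (by decide)
  have hvt : t.var .nv = s.var .nv := ht.var _ (by decide)
  have hat : ∀ a ∉ gapsBody.arrs, t.arr a = s.arr a := fun a ha => ht.arr _ ha
  have h16 : ((1 : Fin 16) : ℕ) = 1 := rfl
  have hn' : min n (cap x) = n := by omega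
  have hk' : min (k + 1) (cap x) = k + 1 := by omega
  simp only [gapsBody, Cmd.eval_ite, Cmd.eval_seq, Cmd.eval_put, Cmd.eval_skip,
    Ex.eval_sub, Ex.eval_add, Ex.eval_var, Ex.eval_lit, Store.setVar_var, reduceCtorEq, if_false,
    if_true, hrt, hvt, hn, h16, hn', hk']
  generalize hs₁ : Cmd.eval x (.set Var.y (_ : E)) _ = s₁
  simp only [Cmd.eval_set, Ex.eval_get, Ex.eval_add, Ex.eval_var, Ex.eval_lit, Store.setVar_var,
    Store.setVar_arr, reduceCtorEq, if_false, if_true, h16, hk'] at hs₁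
  have a₁ : s₁.arr = t.arr := by rw [← hs₁]; simp
  have l₁ : s₁.var .len = t.var .len := by rw [← hs₁]; simp
  have o₁ : s₁.var .o = k := by rw [← hs₁]; simp
  have x₁ : s₁.var .x = s.arr .t' k := by rw [← hs₁]; simp [hat .t' (by decide)]
  have y₁ : s₁.var .y = s.arr .t' (k + 1) := by rw [← hs₁]; simp [hat .t' (by decide)]
  have h₁ : Rows x s₁ L e e' := h.congr (l₁.trans hlt) (by rw [a₁, hat _ (by decide)])
    (by rw [a₁, hat _ (by decide)]) (by rw [a₁, hat _ (by decide)]) (by rw [a₁, hat _ (by decide)])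
  clear hs₁
  have o₂ : (power.eval x (compare.eval x s₁)).var .o = k :=
    ((Cmd.eval_var x _ _ (by decide)).trans (Cmd.eval_var x _ _ (by decide))).trans o₁
  have g₂ : (power.eval x (compare.eval x s₁)).arr .g' = t.arr .g' :=
    ((Cmd.eval_arr x _ _ (by decide)).trans (Cmd.eval_arr x _ _ (by decide))).trans (by rw [a₁])
  rcases Nat.lt_succ_iff_lt_or_eq.1 hik with h1 | rfl
  · have := ih i hi h1
    split_ifs
    · simpa using this
    · simpa [o₂, g₂, h1.ne] using this
  · rw [if_neg (by omega)]
    have m1 := List.getElem_mem (l := M) (n := i) (by omega)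
    have m2 := List.getElem_mem (l := M) (n := i + 1) (by omega)
    have e1 := hM.2 i (by omega)
    have e2 := hM.2 (i + 1) (by omega)
    have spec := (h₁.compare (x₁.trans e1) (y₁.trans e2) (hML _ m1).1 (hML _ m2).1
      (by rw [a₁, hat _ (by decide)]; exact (hML _ m1).2)
      (by rw [a₁, hat _ (by decide)]; exact (hML _ m2).2)).2
      (List.pairwise_iff_getElem.1 hs _ _ _ _ (Nat.lt_succ_self i))
    rw [← spec, ← power_spec]
    simp [o₂]

theorem copy_spec (x : List ℕ) (s : Store Var Arr) :
    (copy.eval x s).var .len = min (s.var .nr + s.var .nv) (cap x) ∧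
    ∀ i < size x, (copy.eval x s).arr .t i = s.arr .t' i ∧
      (copy.eval x s).arr .g i = s.arr .g' i := by
  simp only [copy, Cmd.eval_seq]
  have key := Cmd.loop_induction (x := x) (v := Var.i) (s := s)
    (c := Cmd.seq (.put .t (.var .i) (.get .t' (.var .i)))
      (.put .g (.var .i) (.get .g' (.var .i) : E)))
    (fun k t => ∀ i < k, t.arr .t i = s.arr .t' i ∧ t.arr .g i = s.arr .g' i) (by simp) ?_
  · refine ⟨?_, by simpa using key⟩
    simp only [Cmd.eval_set, Ex.eval_add, Ex.eval_var, Store.setVar_var, if_true]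
    rw [Cmd.eval_var x _ _ (by decide), Cmd.eval_var x _ _ (by decide)]
  · intro k hk t ht ih i hi
    have h1 : t.arr .t' = s.arr .t' := ht.arr _ (by decide)
    have h2 : t.arr .g' = s.arr .g' := ht.arr _ (by decide)
    rcases Nat.lt_succ_iff_lt_or_eq.1 hi with h | rfl
    · simpa [h.ne] using ih i h
    · simp [h1, h2]

/-- After a change of exponents from `e` to `e'` that keeps the orders of the flagged letters and of
the other letters, sorting yields a list for the exponents `e'`. -/
theorem resort_spec (h : Rows x s L e e') (h0 : s.arr .st 0 ≠ 0) (he0 : e' 0 = 0)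
    (hr : (keepList s L).Pairwise fun l m => e' l ≤ e' m)
    (hv : (flagList s L).Pairwise fun l m => e' l ≤ e' m) :
    ∃ L', (∀ l, l ∈ L' ↔ l ∈ L ∧ s.arr .st l ≠ 0) ∧ Sorted x (resort.eval x s) L' e' := by
  have hcap := size_le_cap x
  have hlenL := h.sorted.length_le
  obtain ⟨M, hMdef⟩ : ∃ M, M = (keepList s L).merge (flagList s L) (fun a b => e' a ≤ e' b) :=
    ⟨_, rfl⟩
  have hperm : M.Perm (L.filter fun l => s.arr .st l ≠ 0) := by
    rw [hMdef]
    refine (List.merge_perm_append _).trans ?_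
    have := List.filter_append_perm (fun l => s.arr .f l = 0)
      (L.filter fun l => s.arr .st l ≠ 0)
    rw [List.filter_filter, List.filter_filter] at this
    refine List.Perm.trans (List.Perm.of_eq ?_) this
    congr 1 <;> refine List.filter_congr fun l _ => ?_ <;> simp [and_comm]
  have hmem : ∀ l, l ∈ M ↔ l ∈ L ∧ s.arr .st l ≠ 0 := fun l => by
    rw [hperm.mem_iff]; simp
  have hlenM : M.length ≤ size x :=
    hperm.length_eq.le.trans ((List.length_filter_le _ _).trans hlenL)
  have hlenM' : M.length = (keepList s L).length + (flagList s L).length := by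
    rw [hMdef, List.length_merge]
  have hsorted : M.Pairwise fun l m => e' l ≤ e' m := by
    have := List.pairwise_merge (le := fun a b => decide (e' a ≤ e' b))
      (fun a b c hab hbc => by simp at *; omega) (fun a b => by simp; omega)
      (keepList s L) (flagList s L) (by simpa using hr) (by simpa using hv)
    rw [hMdef]
    simpa using this
  refine ⟨M, hmem, ?_⟩
  obtain ⟨hR, hV⟩ := split_spec h.sorted
  have hRL : ∀ l ∈ keepList s L, l ∈ L ∧ s.arr .st l ≠ 0 := by
    simp +contextual [keepList]
  have hVL : ∀ l ∈ flagList s L, l ∈ L ∧ s.arr .st l ≠ 0 := by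
    simp +contextual [flagList]
  simp only [resort, Cmd.eval_seq]
  -- after `split`
  have l₁ : (split.eval x s).var .len = s.var .len := Cmd.eval_var x _ _ (by decide)
  have t₁ : (split.eval x s).arr .t = s.arr .t := Cmd.eval_arr x _ _ (by decide)
  have g₁ : (split.eval x s).arr .g = s.arr .g := Cmd.eval_arr x _ _ (by decide)
  have r₁ : (split.eval x s).arr .row = s.arr .row := Cmd.eval_arr x _ _ (by decide)
  have s₁ : (split.eval x s).arr .st = s.arr .st := Cmd.eval_arr x _ _ (by decide)
  have h₁ := h.congr l₁ t₁ g₁ r₁ s₁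
  generalize split.eval x s = u₁ at *
  -- after `merge`
  have hM := merge_spec h₁ hR hV (by rwa [s₁]) (by rwa [s₁]) (by omega)
  rw [← hMdef, ← hlenM'] at hM
  have l₂ : (merge.eval x u₁).var .len = u₁.var .len := Cmd.eval_var x _ _ (by decide)
  have n₂ : (merge.eval x u₁).var .nr = u₁.var .nr := Cmd.eval_var x _ _ (by decide)
  have v₂ : (merge.eval x u₁).var .nv = u₁.var .nv := Cmd.eval_var x _ _ (by decide)
  have t₂ : (merge.eval x u₁).arr .t = u₁.arr .t := Cmd.eval_arr x _ _ (by decide)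
  have g₂ : (merge.eval x u₁).arr .g = u₁.arr .g := Cmd.eval_arr x _ _ (by decide)
  have r₂ : (merge.eval x u₁).arr .row = u₁.arr .row := Cmd.eval_arr x _ _ (by decide)
  have s₂ : (merge.eval x u₁).arr .st = u₁.arr .st := Cmd.eval_arr x _ _ (by decide)
  have h₂ := h₁.congr l₂ t₂ g₂ r₂ s₂
  have c₂ : (merge.eval x u₁).var .nr + (merge.eval x u₁).var .nv = M.length := by
    rw [n₂, v₂, hR.1, hV.1, hlenM']
  generalize merge.eval x u₁ = u₂ at *
  -- after `gaps`
  have hG := gaps_spec h₂ hM c₂ (fun l hl => by rw [s₂, s₁]; exact (hmem l).1 hl) hlenM hsorted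
  have t₃ : (gaps.eval x u₂).arr .t' = u₂.arr .t' := Cmd.eval_arr x _ _ (by decide)
  have n₃ : (gaps.eval x u₂).var .nr = u₂.var .nr := Cmd.eval_var x _ _ (by decide)
  have v₃ : (gaps.eval x u₂).var .nv = u₂.var .nv := Cmd.eval_var x _ _ (by decide)
  generalize gaps.eval x u₂ = u₃ at *
  obtain ⟨c1, c2⟩ := copy_spec x u₃
  refine ⟨?_, ?_, ?_, fun l hl => h.sorted.lt l ((hmem l).1 hl).1, ?_, he0, hsorted, ?_⟩
  · rw [c1, n₃, v₃, c₂]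
    omega
  · intro i hi
    rw [(c2 i (by omega)).1, t₃, hM.2 i hi]
  · exact hperm.nodup_iff.2 (h.sorted.nodup.filter _)
  · exact (hmem 0).2 ⟨h.sorted.zero_mem, h0⟩
  · intro i hi
    rw [(c2 i (by omega)).2, hG i hi]

end Baumslag

/-! ### Changing exponents -/

namespace Baumslag

open RAM

variable {x : List ℕ} {s : Store Var Arr} {L : List ℕ} {e e' : ℕ → ℤ}

theorem statSum_congr {x : List ℕ} {st st' : ℕ → ℕ} {e e' : ℕ → ℤ} {key key' : ℕ}
    (h : ∀ j < size x, st j = key ↔ st' j = key') (he : ∀ j < size x, st j = key → e j = e' j) :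
    statSum x st e key = statSum x st' e' key' := by
  refine Finset.sum_congr rfl fun j hj => ?_
  rw [Finset.mem_range] at hj
  by_cases h1 : st j = key
  · rw [if_pos h1, if_pos ((h j hj).1 h1), he j hj h1]
  · rw [if_neg h1, if_neg (mt (h j hj).2 h1), Int.cast_zero, zero_mul, zero_mul]

theorem rowSum_congr {x : List ℕ} {A : ℕ → ℕ} {e e' : ℕ → ℤ} {l : ℕ}
    (h : ∀ j < size x, A (l * size x + j) ≠ 0 → e j = e' j) :
    rowSum x A e l = rowSum x A e' l := by
  refine Finset.sum_congr rfl fun j hj => ?_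
  rw [Finset.mem_range] at hj
  by_cases h1 : A (l * size x + j) = 0
  · simp [h1]
  · rw [h j hj h1]

theorem statSum_eq_zero {x : List ℕ} {st : ℕ → ℕ} {e : ℕ → ℤ} {key : ℕ}
    (h : ∀ j < size x, st j ≠ key) : statSum x st e key = 0 :=
  Finset.sum_eq_zero fun j hj => by rw [if_neg (h j (Finset.mem_range.1 hj))]; simp

theorem two_mul_length_add_le_cap (x : List ℕ) : 2 * x.length + 16 ≤ cap x := by
  have : ∀ n : ℕ, 2 * n + 16 ≤ 8 * (n + 16) ^ 2 := fun n => by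
    ring_nf
    omega
  exact this _

/-- The value of `.h + .h + c`, the status that belongs to a part of the top piece. -/
theorem eval_key (x : List ℕ) (s : Store Var Arr) (hh : s.var .h ≤ x.length) (c : Fin 16) :
    ((.var .h + .var .h + .lit c : E)).eval x s = 2 * s.var .h + c := by
  have h1 := two_mul_length_add_le_cap x
  have := c.2
  simp
  omega

/-- What `shift` has added to the coefficient at the address `m = l N + j'` when row `i` and column `j`
are about to be processed: `1` if that coefficient comes before and has to be increased. -/
def shiftCount (s : Store Var Arr) (N key i j m : ℕ) : ℕ :=
  if (m / N < i ∨ m / N = i ∧ m % N < j) ∧ s.arr .f (m / N) ≠ 0 ∧ s.arr .st (m % N) = key then 1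
  else 0

theorem shiftBody_spec {t : Store Var Arr} {i j key : ℕ} (hj : j < size x) (hi : i < size x)
    (hm : ∀ m, s.arr .row m + 1 ≤ cap x) (hit : t.var .i = i) (hkey : t.var .key = key)
    (hst : t.arr .st = s.arr .st) (hf : s.arr .f i ≠ 0)
    (ih : ∀ m, t.arr .row m = s.arr .row m + shiftCount s (size x) key i j m) (m : ℕ) :
    (shiftBody.eval x (t.setVar .j j)).arr .row m =
      s.arr .row m + shiftCount s (size x) key i (j + 1) m := by
  have hcap : i * size x + size x ≤ cap x := by
    have h2 : cap x = 8 * size x ^ 2 := rfl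
    have : (i + 1) * size x ≤ size x * size x := Nat.mul_le_mul_right _ hi
    nlinarith
  have h16 : ((1 : Fin 16) : ℕ) = 1 := rfl
  have hmin : min (min (i * size x) (cap x) + j) (cap x) = i * size x + j := by omega
  have hd : (i * size x + j) / size x = i := by
    rw [mul_comm, Nat.mul_add_div (by omega), Nat.div_eq_of_lt hj, add_zero]
  have hr : (i * size x + j) % size x = j := by
    rw [mul_comm, Nat.mul_add_mod, Nat.mod_eq_of_lt hj]
  have hiff : m = i * size x + j ↔ m / size x = i ∧ m % size x = j := by
    refine ⟨fun h => by rw [h]; exact ⟨hd, hr⟩, fun h => ?_⟩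
    rw [← h.1, ← h.2, mul_comm, Nat.div_add_mod]
  have ih1 := ih (i * size x + j)
  have c0 : shiftCount s (size x) key i j (i * size x + j) = 0 := by
    simp [shiftCount, hd, hr]
  rw [c0, add_zero] at ih1
  have hm1 : min (s.arr .row (i * size x + j) + 1) (cap x) = s.arr .row (i * size x + j) + 1 :=
    min_eq_left (hm _)
  by_cases h1 : s.arr .st j = key
  · by_cases h2 : m = i * size x + j
    · have c1 : shiftCount s (size x) key i (j + 1) m = 1 := by
        simp [shiftCount, h2, hd, hr, hf, h1]
      rw [c1]
      simp [shiftBody, entry, hst, hit, hkey, h1, hmin, h2, ih1, hm1]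
    · have c1 : shiftCount s (size x) key i (j + 1) m = shiftCount s (size x) key i j m := by
        rw [hiff] at h2
        unfold shiftCount
        exact if_congr (and_congr_left fun _ => by omega) rfl rfl
      rw [c1]
      simp [shiftBody, entry, hst, hit, hkey, h1, hmin, h2, ih]
  · have c1 : shiftCount s (size x) key i (j + 1) m = shiftCount s (size x) key i j m := by
      unfold shiftCount
      refine if_congr (and_congr_left fun h3 => ?_) rfl rfl
      have : m % size x ≠ j := fun h4 => h1 (h4 ▸ h3.2)
      omega
    rw [c1]
    simp [shiftBody, hst, hkey, h1, ih]

theorem shift_spec (hh : s.var .h ≤ x.length) (hm : ∀ m, s.arr .row m ≤ x.length) (m : ℕ) :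
    (shift.eval x s).arr .row m = s.arr .row m +
      if m / size x < size x ∧ s.arr .f (m / size x) ≠ 0 ∧
        s.arr .st (m % size x) = 2 * s.var .h + 3 then 1 else 0 := by
  have hcap := size_le_cap x
  have hN : size x = x.length + 16 := rfl
  have hm' : ∀ m, s.arr .row m + 1 ≤ cap x := fun m => by have := hm m; omega
  simp only [shift, Cmd.eval_seq]
  generalize hs₁ : Cmd.eval x (.set .key _) s = s₁
  have ha₁ : s₁.arr = s.arr := by rw [← hs₁]; simp
  have hk₁ : s₁.var .key = 2 * s.var .h + 3 := by
    rw [← hs₁, Cmd.eval_set, eval_key x s hh]; simp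
  clear hs₁
  have key := Cmd.loop_induction (x := x) (v := Var.i) (s := s₁)
    (c := .ite (.get .f (.var .i)) (.loop .j shiftBody) .skip)
    (fun i t => ∀ m, t.arr .row m =
      s.arr .row m + shiftCount s (size x) (2 * s.var .h + 3) i 0 m) ?_ ?_
  · rw [key m]
    simp [shiftCount]
  · intro m
    simp [shiftCount, ha₁]
  · intro i hi t ht ih
    have hft : t.arr .f = s.arr .f := (ht.arr _ (by decide)).trans (by rw [ha₁])
    have hst : t.arr .st = s.arr .st := (ht.arr _ (by decide)).trans (by rw [ha₁])
    have hkt : t.var .key = 2 * s.var .h + 3 := (ht.var _ (by decide)).trans hk₁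
    by_cases hf : s.arr .f i = 0
    · intro m
      have : shiftCount s (size x) (2 * s.var .h + 3) (i + 1) 0 m =
          shiftCount s (size x) (2 * s.var .h + 3) i 0 m := by
        unfold shiftCount
        refine if_congr (and_congr_left fun h3 => ?_) rfl rfl
        have : m / size x ≠ i := fun h4 => h3.1 (h4 ▸ hf)
        omega
      rw [this, ← ih m]
      simp [hft, hf]
    · have inner := Cmd.loop_induction (x := x) (v := Var.j) (s := t.setVar .i i) (c := shiftBody)
        (fun j u => ∀ m, u.arr .row m =
          s.arr .row m + shiftCount s (size x) (2 * s.var .h + 3) i j m) (by simpa using ih) ?_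
      · intro m
        have h1 := inner m
        have : shiftCount s (size x) (2 * s.var .h + 3) (i + 1) 0 m =
            shiftCount s (size x) (2 * s.var .h + 3) i (size x) m := by
          unfold shiftCount
          refine if_congr (and_congr_left fun h3 => ?_) rfl rfl
          have : m % size x < size x := Nat.mod_lt _ (by omega)
          omega
        rw [this, ← h1]
        simp [hft, hf]
      · intro j hj u hu ihu
        exact shiftBody_spec hj hi hm' ((hu.var _ (by decide)).trans (by simp))
          ((hu.var _ (by decide)).trans (by simp [hkt]))
          ((hu.arr _ (by decide)).trans (by simp [hst])) hf ihu

/-- The entries of the array of coefficients after a shift. -/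
theorem shift_entry (hh : s.var .h ≤ x.length) (hm : ∀ m, s.arr .row m ≤ x.length) {l j : ℕ}
    (hl : l < size x) (hj : j < size x) :
    (shift.eval x s).arr .row (l * size x + j) = s.arr .row (l * size x + j) +
      if s.arr .f l ≠ 0 ∧ s.arr .st j = 2 * s.var .h + 3 then 1 else 0 := by
  have hd : (l * size x + j) / size x = l := by
    rw [mul_comm, Nat.mul_add_div (by omega), Nat.div_eq_of_lt hj, add_zero]
  have hr : (l * size x + j) % size x = j := by
    rw [mul_comm, Nat.mul_add_mod, Nat.mod_eq_of_lt hj]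
  rw [shift_spec hh hm, hd, hr]
  simp [hl]

theorem rowSum_shift (hh : s.var .h ≤ x.length) (hm : ∀ m, s.arr .row m ≤ x.length) {l : ℕ}
    (hl : l < size x) (e : ℕ → ℤ) :
    rowSum x ((shift.eval x s).arr .row) e l = rowSum x (s.arr .row) e l +
      if s.arr .f l ≠ 0 then statSum x (s.arr .st) e (2 * s.var .h + 3) else 0 := by
  have h1 : ∀ j ∈ Finset.range (size x),
      (((shift.eval x s).arr .row (l * size x + j) * sgn x j : ℤ) : ℚ) * 2 ^ e j =
      ((s.arr .row (l * size x + j) * sgn x j : ℤ) : ℚ) * 2 ^ e j +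
        if s.arr .f l ≠ 0 then
          ((if s.arr .st j = 2 * s.var .h + 3 then sgn x j else 0 : ℤ) : ℚ) * 2 ^ e j else 0 := by
    intro j hj
    rw [shift_entry hh hm hl (Finset.mem_range.1 hj)]
    by_cases h1 : s.arr .f l = 0
    · simp [h1]
    · by_cases h2 : s.arr .st j = 2 * s.var .h + 3
      · simp [h1, h2]; ring
      · simp [h1, h2]
  rw [rowSum, Finset.sum_congr rfl h1, Finset.sum_add_distrib, rowSum]
  congr 1
  split_ifs with h2
  · rfl
  · simp

/-- The combinatorial part of the invariant of the program: the letters up to number `k` have been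
processed, a letter of status `2 i + 2` or `2 i + 3` belongs to the piece number `i`, and refers
only to frozen letters (those of status `1`) or to the scaling part of its own piece. -/
structure Shape (x : List ℕ) (k : ℕ) (s : Store Var Arr) (L : List ℕ) : Prop where
  h_le : s.var .h ≤ k
  le : ∀ l ∈ L, l ≤ k
  mem : ∀ l < size x, s.arr .st l ≠ 0 → l ∈ L
  st_le : ∀ l < size x, s.arr .st l ≤ 2 * s.var .h + 3
  st_zero : s.arr .st 0 = 1
  ref : ∀ l < size x, s.arr .st l ≠ 0 → ∀ j < size x, s.arr .row (l * size x + j) ≠ 0 →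
    s.arr .st j = 1 ∨ ∃ i, s.arr .st l = 2 * i + 2 ∧ s.arr .st j = 2 * i + 3
  row_zero : ∀ l < size x, k < l → ∀ j < size x, s.arr .row (l * size x + j) = 0

/-- The exponents of the flagged letters, which belong to the top piece, are increased by its
scaling part `M`, and the list is sorted again. -/
theorem shift_resort {k : ℕ} {e₀ : ℕ → ℤ} {M : ℤ} (hS : Shape x k s L) (h : Sorted x s L e)
    (hkx : k ≤ x.length) (hm : ∀ m, s.arr .row m + 1 ≤ k)
    (hf : ∀ l < size x, s.arr .f l ≠ 0 → s.arr .st l = 2 * s.var .h + 2)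
    (hM : statSum x (s.arr .st) e (2 * s.var .h + 3) = M)
    (hkeep : ∀ l < size x, s.arr .st l ≠ 0 → s.arr .f l = 0 → rowSum x (s.arr .row) e l = e l)
    (hflag : ∀ l < size x, s.arr .f l ≠ 0 → rowSum x (s.arr .row) e l = e₀ l)
    (hord : ∀ l < size x, ∀ m < size x, s.arr .f l ≠ 0 → s.arr .f m ≠ 0 → e l ≤ e m → e₀ l ≤ e₀ m)
    (he' : ∀ l, e' l = if s.arr .f l ≠ 0 then e₀ l + M else e l) :
    ∃ L', Shape x k (resort.eval x (shift.eval x s)) L' ∧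
      Sorted x (resort.eval x (shift.eval x s)) L' e' ∧
      (∀ m, (resort.eval x (shift.eval x s)).arr .row m ≤ k) ∧
      (∀ l < size x, s.arr .st l ≠ 0 →
        rowSum x ((resort.eval x (shift.eval x s)).arr .row) e' l = e' l) := by
  have hm' : ∀ m, s.arr .row m ≤ x.length := fun m => by have := hm m; omega
  have hh := hS.h_le.trans hkx
  have l₁ : (shift.eval x s).var .len = s.var .len := Cmd.eval_var x _ _ (by decide)
  have h₁ : (shift.eval x s).var .h = s.var .h := Cmd.eval_var x _ _ (by decide)
  have a₁ : ∀ a ∉ shift.arrs, (shift.eval x s).arr a = s.arr a := fun a ha =>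
    Cmd.eval_arr x _ _ ha
  have row₁ : ∀ m, (shift.eval x s).arr .row m ≤ k := fun m => by
    rw [shift_spec hh hm']
    have := hm m
    split_ifs <;> omega
  have ent := fun l hl j hj => shift_entry (x := x) (s := s) hh hm' (l := l) (j := j) hl hj
  have ref₁ : ∀ l < size x, s.arr .st l ≠ 0 → ∀ j < size x,
      (shift.eval x s).arr .row (l * size x + j) ≠ 0 →
      s.arr .st j = 1 ∨ ∃ i, s.arr .st l = 2 * i + 2 ∧ s.arr .st j = 2 * i + 3 := by
    intro l hl hl0 j hj h0
    rw [ent l hl j hj] at h0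
    by_cases h1 : s.arr .row (l * size x + j) = 0
    · rw [h1, zero_add] at h0
      split_ifs at h0 with h2
      · exact Or.inr ⟨s.var .h, hf l hl h2.1, h2.2⟩
      · exact absurd rfl h0
    · exact hS.ref l hl hl0 j hj h1
  have sum₁ : ∀ l < size x, s.arr .st l ≠ 0 →
      rowSum x ((shift.eval x s).arr .row) e l = e' l := by
    intro l hl hl0
    rw [rowSum_shift hh hm' hl, he', hM]
    by_cases h1 : s.arr .f l = 0
    · simp [h1, hkeep l hl hl0 h1]
    · simp [h1, hflag l hl h1]
  have f0 : s.arr .f 0 = 0 := by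
    by_contra h0
    have := hf 0 (h.lt 0 h.zero_mem) h0
    rw [hS.st_zero] at this
    omega
  have rows : Rows x (shift.eval x s) L e e' := by
    refine ⟨h.congr l₁ (a₁ _ (by decide)) (a₁ _ (by decide)), fun m => (row₁ m).trans hkx, ?_, ?_⟩
    · intro l hl hl0 j hj h0
      rw [a₁ _ (by decide)] at hl0
      refine hS.mem j hj ?_
      rcases ref₁ l (h.lt l hl) hl0 j hj h0 with h1 | ⟨i, _, h1⟩ <;> omega
    · intro l hl hl0
      rw [a₁ _ (by decide)] at hl0
      exact sum₁ l (h.lt l hl) hl0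
  have st₁ := a₁ .st (by decide)
  have ff₁ := a₁ .f (by decide)
  have hkeepL : (keepList (shift.eval x s) L).Pairwise fun l m => e' l ≤ e' m := by
    refine (h.sorted.sublist List.filter_sublist).imp_of_mem ?_
    intro l m hl hm hlm
    simp [ff₁] at hl hm
    rw [he', he', hl.2.2, hm.2.2]
    simpa using hlm
  have hflagL : (flagList (shift.eval x s) L).Pairwise fun l m => e' l ≤ e' m := by
    refine (h.sorted.sublist List.filter_sublist).imp_of_mem ?_
    intro l m hl hm hlm
    simp [ff₁] at hl hm
    rw [he', he', if_pos hl.2.2, if_pos hm.2.2]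
    have := hord l (h.lt l hl.1) m (h.lt m hm.1) hl.2.2 hm.2.2 hlm
    omega
  obtain ⟨L', hL', hs'⟩ := resort_spec rows (by rw [st₁, hS.st_zero]; omega)
    (by rw [he', f0, h.exp_zero]; simp) hkeepL hflagL
  refine ⟨L', ?_, hs', ?_, ?_⟩
  · have a₂ : ∀ a, a ∉ resort.arrs → a ∉ shift.arrs →
        (resort.eval x (shift.eval x s)).arr a = s.arr a := fun a h1 h2 =>
      (Cmd.eval_arr x _ _ h1).trans (a₁ a h2)
    have r₂ : (resort.eval x (shift.eval x s)).arr .row = (shift.eval x s).arr .row :=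
      Cmd.eval_arr x _ _ (by decide)
    have h₂ : (resort.eval x (shift.eval x s)).var .h = s.var .h :=
      (Cmd.eval_var x _ _ (by decide)).trans h₁
    have s₂ := a₂ .st (by decide) (by decide)
    refine ⟨h₂ ▸ hS.h_le, fun l hl => hS.le l ((hL' l).1 hl).1, ?_, ?_, s₂ ▸ hS.st_zero, ?_, ?_⟩
    · rw [s₂]
      exact fun l hl hl0 => (hL' l).2 ⟨hS.mem l hl hl0, by rwa [st₁]⟩
    · rw [s₂, h₂]
      exact hS.st_le
    · rw [s₂, r₂]
      exact ref₁
    · intro l hl hkl j hj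
      rw [r₂, ent l hl j hj, hS.row_zero l hl hkl j hj, if_neg]
      rintro ⟨h1, _⟩
      have := hS.le l (hS.mem l hl (by rw [hf l hl h1]; omega))
      omega
  · rw [Cmd.eval_arr x resort (shift.eval x s) (a := .row) (by decide)]
    exact row₁
  · intro l hl hl0
    rw [Cmd.eval_arr x resort (shift.eval x s) (a := .row) (by decide), ← sum₁ l hl hl0]
    refine rowSum_congr fun j hj h0 => ?_
    rw [he', if_neg]
    intro h1
    have := hf j hj h1
    rcases ref₁ l hl hl0 j hj h0 with h2 | ⟨i, _, h2⟩ <;> omega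

end Baumslag

/-! ### The invariant of the program -/

namespace Baumslag

open RAM

variable {x : List ℕ} {s : Store Var Arr} {L : List ℕ} {e e' : ℕ → ℤ} {k : ℕ} {X : Grp} {μ : ℕ → ℤ}

/-- The stack below the piece number `h`: the translation part of the piece number `j` is given by
the letters of status `2 j + 2`, its scaling part is `μ j`, and `stk (j + 1)` is the code of the
power of `b` that follows it. -/
def pieces (x : List ℕ) (st stk : ℕ → ℕ) (e μ : ℕ → ℤ) : ℕ → List (Dyad × ℤˣ)
  | 0 => []
  | j + 1 => (⟨statSum x st e (2 * j + 2), μ j⟩, if stk (j + 1) = 3 then 1 else -1) ::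
      pieces x st stk e μ j

theorem pieces_congr {st st' stk stk' : ℕ → ℕ} {e e' μ μ' : ℕ → ℤ} : ∀ {h : ℕ},
    (∀ j < h, statSum x st e (2 * j + 2) = statSum x st' e' (2 * j + 2)) →
    (∀ j < h, μ j = μ' j) → (∀ j < h, stk (j + 1) = stk' (j + 1)) →
    pieces x st stk e μ h = pieces x st' stk' e' μ' h
  | 0, _, _, _ => rfl
  | h + 1, h1, h2, h3 => by
    rw [pieces, pieces, h1 h (Nat.lt_succ_self h), h2 h (Nat.lt_succ_self h),
      h3 h (Nat.lt_succ_self h), pieces_congr (fun j hj => h1 j (hj.trans (Nat.lt_succ_self h)))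
        (fun j hj => h2 j (hj.trans (Nat.lt_succ_self h)))
        fun j hj => h3 j (hj.trans (Nat.lt_succ_self h))]

/-- The invariant of the program after `k` letters, the product of which is `X`: the letters that
are not removed have the exponents `e`, which are given by their rows, and the store holds a
reduced stack for `X`. -/
structure Inv (x : List ℕ) (k : ℕ) (X : Grp) (s : Store Var Arr) (L : List ℕ) (e μ : ℕ → ℤ) :
    Prop where
  shape : Shape x k s L
  sorted : Sorted x s L e
  row_le : ∀ m, s.arr .row m ≤ k
  sum : ∀ l < size x, s.arr .st l ≠ 0 → rowSum x (s.arr .row) e l = e l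
  scale : ∀ j ≤ s.var .h, statSum x (s.arr .st) e (2 * j + 3) = μ j
  stk : ∀ j < s.var .h, s.arr .stk (j + 1) = 2 ∨ s.arr .stk (j + 1) = 3
  stack : IsStack X ⟨statSum x (s.arr .st) e (2 * s.var .h + 2), μ (s.var .h)⟩
    (pieces x (s.arr .st) (s.arr .stk) e μ (s.var .h))

theorem Inv.congr (h : Inv x k X s L e μ) {t : Store Var Arr} (hh : t.var .h = s.var .h)
    (hl : t.var .len = s.var .len) (ha : ∀ a, a ≠ .p → a ≠ .q → t.arr a = s.arr a) :
    Inv x k X t L e μ := by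
  have h1 := ha .row (by decide) (by decide)
  have h2 := ha .st (by decide) (by decide)
  have h3 := ha .stk (by decide) (by decide)
  refine ⟨⟨hh ▸ h.shape.h_le, h.shape.le, h2 ▸ h.shape.mem, by rw [h2, hh]; exact h.shape.st_le,
    h2 ▸ h.shape.st_zero, by rw [h1, h2]; exact h.shape.ref, h1 ▸ h.shape.row_zero⟩,
    h.sorted.congr hl (ha _ (by decide) (by decide)) (ha _ (by decide) (by decide)), h1 ▸ h.row_le,
    by rw [h1, h2]; exact h.sum, by rw [h2, hh]; exact h.scale, by rw [h3, hh]; exact h.stk,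
    by rw [h2, h3, hh]; exact h.stack⟩

/-- Two sets of letters are united, after the exponents of the second have been shifted. -/
theorem statSum_union {st st' : ℕ → ℕ} {e e' : ℕ → ℤ} {key key₁ key₂ : ℕ} {M : ℤ}
    (h : ∀ j < size x, st' j = key ↔ st j = key₁ ∨ st j = key₂) (hne : key₁ ≠ key₂)
    (h₁ : ∀ j < size x, st j = key₁ → e' j = e j)
    (h₂ : ∀ j < size x, st j = key₂ → e' j = e j + M) :
    statSum x st' e' key = statSum x st e key₁ + 2 ^ M * statSum x st e key₂ := by
  rw [statSum, statSum, statSum, Finset.mul_sum, ← Finset.sum_add_distrib]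
  refine Finset.sum_congr rfl fun j hj => ?_
  rw [Finset.mem_range] at hj
  by_cases h3 : st j = key₁
  · rw [if_pos ((h j hj).2 (Or.inl h3)), if_pos h3, if_neg (h3 ▸ hne), h₁ j hj h3]
    simp
  · by_cases h4 : st j = key₂
    · rw [if_pos ((h j hj).2 (Or.inr h4)), if_neg h3, if_pos h4, h₂ j hj h4, zpow_add₀ two_ne_zero]
      simp
      ring
    · rw [if_neg (fun h5 => ((h j hj).1 h5).elim h3 h4), if_neg h3, if_neg h4]
      simp

/-- A letter is added to a set of letters. -/
theorem statSum_insert {st st' : ℕ → ℕ} {e e' : ℕ → ℤ} {key l : ℕ} (hl : l < size x)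
    (h0 : st l ≠ key) (h1 : st' l = key) (hst : ∀ j ≠ l, st' j = st j)
    (he : ∀ j ≠ l, e' j = e j) :
    statSum x st' e' key = statSum x st e key + sgn x l * 2 ^ e' l := by
  have : ((sgn x l : ℚ)) * 2 ^ e' l =
      ∑ j ∈ Finset.range (size x), if j = l then ((sgn x l : ℚ)) * 2 ^ e' l else 0 := by
    rw [Finset.sum_ite_eq', if_pos (Finset.mem_range.2 hl)]
  rw [this, statSum, statSum, ← Finset.sum_add_distrib]
  refine Finset.sum_congr rfl fun j _ => ?_
  by_cases h2 : j = l
  · subst h2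
    simp [h0, h1]
  · simp [h2, hst j h2, he j h2]

/-! ### Multiplication by a power of `a` -/

theorem append_spec (h : Sorted x s L e) (hk : s.var .k = k) (hkx : k < x.length)
    (hh : s.var .h ≤ x.length) (hL : L.length ≤ x.length) :
    (append.eval x s).var .len = L.length + 1 ∧
    (∀ i, (append.eval x s).arr .t i = if i = L.length then k + 1 else s.arr .t i) ∧
    (∀ i, (append.eval x s).arr .g i = if i = L.length - 1 then 1 else s.arr .g i) ∧
    (∀ i, (append.eval x s).arr .st i = if i = k + 1 then 2 * s.var .h + 2 else s.arr .st i) ∧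
    ∀ i < size x, (append.eval x s).arr .f i = if i = k + 1 then 1 else 0 := by
  have hcap := size_le_cap x
  have hN : size x = x.length + 16 := rfl
  have h16 : ((1 : Fin 16) : ℕ) = 1 := rfl
  have h16' : ((2 : Fin 16) : ℕ) = 2 := rfl
  have hk1 : min (k + 1) (cap x) = k + 1 := by omega
  have hl1 : min (L.length + 1) (cap x) = L.length + 1 := by omega
  simp only [append, Cmd.eval_seq]
  generalize hs₁ : Cmd.eval x (.set Var.len (_ : E)) _ = s₁
  have l₁ : s₁.var .len = L.length + 1 := by rw [← hs₁]; simp [h.len, hl1]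
  have h₁ : s₁.var .h = s.var .h := by rw [← hs₁]; simp
  have k₁ : s₁.var .k = k := by rw [← hs₁]; simp [hk]
  have t₁ : ∀ i, s₁.arr .t i = if i = L.length then k + 1 else s.arr .t i := fun i => by
    rw [← hs₁]; simp [h.len, hk, hk1]
  have g₁ : ∀ i, s₁.arr .g i = if i = L.length - 1 then 1 else s.arr .g i := fun i => by
    rw [← hs₁]; simp [h.len]
  have st₁ : s₁.arr .st = s.arr .st := by rw [← hs₁]; funext i; simp
  clear hs₁
  generalize hs₂ : Cmd.eval x (.put Arr.st (_ : E) _) s₁ = s₂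
  have l₂ : s₂.var .len = L.length + 1 := by rw [← hs₂]; simp [l₁]
  have k₂ : s₂.var .k = k := by rw [← hs₂]; simp [k₁]
  have t₂ : s₂.arr .t = s₁.arr .t := by rw [← hs₂]; funext i; simp
  have g₂ : s₂.arr .g = s₁.arr .g := by rw [← hs₂]; funext i; simp
  have st₂ : ∀ i, s₂.arr .st i = if i = k + 1 then 2 * s.var .h + 2 else s.arr .st i := fun i => by
    have := eval_key x s₁ (h₁ ▸ hh) 2
    rw [← hs₂, Cmd.eval_put, this]
    simp [st₁, k₁, h₁, hk1]
  clear hs₂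
  have key := Cmd.loop_induction (x := x) (v := Var.i) (s := s₂)
    (c := (.put .f (.var .i) (.lit 0) : C)) (fun i t => ∀ j < i, t.arr .f j = 0) (by simp) ?_
  · have l₃ : (Cmd.eval x (.loop .i (.put .f (.var .i) (.lit 0) : C)) s₂).var .len = s₂.var .len :=
      Cmd.eval_var x _ _ (by decide)
    have k₃ : (Cmd.eval x (.loop .i (.put .f (.var .i) (.lit 0) : C)) s₂).var .k = s₂.var .k :=
      Cmd.eval_var x _ _ (by decide)
    have a₃ : ∀ a ≠ Arr.f, (Cmd.eval x (.loop .i (.put .f (.var .i) (.lit 0) : C)) s₂).arr a =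
        s₂.arr a := fun a ha => Cmd.eval_arr x _ _ (by simpa [Cmd.arrs] using ha)
    generalize Cmd.eval x (.loop .i (.put .f (.var .i) (.lit 0) : C)) s₂ = s₃ at *
    refine ⟨by simp [l₃, l₂], fun i => ?_, fun i => ?_, fun i => ?_, fun i hi => ?_⟩
    · simp [a₃, t₂, t₁]
    · simp [a₃, g₂, g₁]
    · simp [a₃, st₂]
    · simp [k₃, k₂, hk1, key i hi]
  · intro i hi t ht ih j hj
    rcases Nat.lt_succ_iff_lt_or_eq.1 hj with h1 | rfl
    · simpa [h1.ne] using ih j h1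
    · simp

/-- With gap `1`, a new letter at the end of the list counts as having the exponent of the last letter
before it, whatever its true exponent: it is not referred to before the list is sorted again. -/
theorem sorted_append (h : Sorted x s L e) (hk : k + 1 < size x) (hkL : k + 1 ∉ L)
    {t : Store Var Arr} (hl : t.var .len = L.length + 1)
    (ht : ∀ i, t.arr .t i = if i = L.length then k + 1 else s.arr .t i)
    (hg : ∀ i, t.arr .g i = if i = L.length - 1 then 1 else s.arr .g i) :
    ∃ d : ℤ, Sorted x t (L ++ [k + 1]) (Function.update e (k + 1) d) := by
  have hpos : 0 < L.length := List.length_pos_of_mem h.zero_mem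
  have hup : ∀ l ∈ L, ∀ d, Function.update e (k + 1) d l = e l := fun l hl d =>
    Function.update_of_ne (fun h1 : l = k + 1 => hkL (h1 ▸ hl)) _ _
  refine ⟨e (L[L.length - 1]), by simp [hl], ?_, ?_, ?_, by simp [h.zero_mem], ?_, ?_, ?_⟩
  · intro i hi
    rw [List.length_append, List.length_singleton] at hi
    rw [ht]
    split_ifs with h1
    · subst h1
      simp
    · rw [List.getElem_append_left (by omega), h.get]
  · rw [List.nodup_append]
    exact ⟨h.nodup, by simp, by simpa using fun l hl (h1 : l = k + 1) => hkL (h1 ▸ hl)⟩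
  · intro l hl'
    rw [List.mem_append, List.mem_singleton] at hl'
    rcases hl' with h1 | rfl
    · exact h.lt l h1
    · exact hk
  · rw [hup 0 h.zero_mem, h.exp_zero]
  · rw [List.pairwise_append]
    refine ⟨h.sorted.imp_of_mem fun ha hb hab => by rwa [hup _ ha, hup _ hb], by simp, ?_⟩
    intro l hl' m hm
    rw [List.mem_singleton] at hm
    rw [hm, hup l hl', Function.update_self]
    obtain ⟨i, hi, rfl⟩ := List.getElem_of_mem hl'
    rcases Nat.lt_or_ge i (L.length - 1) with h1 | h1
    · exact List.pairwise_iff_getElem.1 h.sorted _ _ _ _ h1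
    · exact (by congr; omega : e L[i] = e L[L.length - 1]).le
  · intro i hi
    rw [List.length_append, List.length_singleton] at hi
    rw [hg]
    split_ifs with h1
    · subst h1
      have h2 : (L ++ [k + 1])[L.length - 1 + 1] = k + 1 := by
        rw [List.getElem_append_right (by omega)]; simp
      have h3 : (L ++ [k + 1])[L.length - 1] = L[L.length - 1] :=
        List.getElem_append_left (by omega)
      rw [h2, h3, hup _ (List.getElem_mem _), Function.update_self, sub_self]
      have := le_cap_of_le x (c := 1) (by norm_num)
      simp [this]
    · rw [List.getElem_append_left (by omega), List.getElem_append_left (by omega),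
        hup _ (List.getElem_mem _), hup _ (List.getElem_mem _), h.gap]

/-- Multiplication by `a ^ (±1)`: the new letter gets the exponent `μ h`, where `h` is the number of
the top piece. -/
theorem Inv.mulLetter (h : Inv x k X s L e μ) (hk : s.var .k = k) (hkx : k < x.length) :
    ∃ L' e' μ', Inv x (k + 1) (X * ga ^ sgn x (k + 1)) (mulLetter.eval x s) L' e' μ' := by
  have hS := h.shape
  have hN : size x = x.length + 16 := rfl
  have hkN : k + 1 < size x := by omega
  have hh : s.var .h ≤ x.length := hS.h_le.trans hkx.le
  have hkL : k + 1 ∉ L := fun h1 => by have := hS.le _ h1; omega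
  have hst0 : s.arr .st (k + 1) = 0 := by
    by_contra h1
    exact hkL (hS.mem _ hkN h1)
  have hLlen : L.length ≤ x.length := by
    rw [← List.toFinset_card_of_nodup h.sorted.nodup, ← Finset.card_range x.length]
    refine Finset.card_le_card fun l hl => ?_
    have := hS.le l (List.mem_toFinset.1 hl)
    rw [Finset.mem_range]
    omega
  obtain ⟨l₁, t₁, g₁, st₁, f₁⟩ := append_spec h.sorted hk hkx hh hLlen
  have r₁ : (append.eval x s).arr .row = s.arr .row := Cmd.eval_arr x _ _ (by decide)
  have k₁ : (append.eval x s).arr .stk = s.arr .stk := Cmd.eval_arr x _ _ (by decide)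
  have h₁ : (append.eval x s).var .h = s.var .h := Cmd.eval_var x _ _ (by decide)
  obtain ⟨d, hd⟩ := sorted_append h.sorted hkN hkL l₁ t₁ g₁
  simp only [Baumslag.mulLetter, Cmd.eval_seq]
  generalize append.eval x s = s₁ at *
  have hup : ∀ l ≠ k + 1, Function.update e (k + 1) d l = e l := fun l hl =>
    Function.update_of_ne hl _ _
  have st₁' : ∀ l ≠ k + 1, s₁.arr .st l = s.arr .st l := fun l hl => by rw [st₁, if_neg hl]
  have st₁'' : s₁.arr .st (k + 1) = 2 * s.var .h + 2 := by rw [st₁, if_pos rfl]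
  have f₁' : ∀ l < size x, s₁.arr .f l ≠ 0 ↔ l = k + 1 := fun l hl => by
    rw [f₁ l hl]
    split_ifs with h1 <;> simp [h1]
  have shape : Shape x (k + 1) s₁ (L ++ [k + 1]) := by
    refine ⟨by have := hS.h_le; omega, ?_, ?_, ?_, by rw [st₁' 0 (by omega), hS.st_zero], ?_, ?_⟩
    · intro l hl
      rw [List.mem_append, List.mem_singleton] at hl
      rcases hl with h1 | rfl
      · exact (hS.le l h1).trans (Nat.le_succ k)
      · exact le_rfl
    · intro l hl h1
      rw [List.mem_append, List.mem_singleton]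
      by_cases h2 : l = k + 1
      · exact Or.inr h2
      · exact Or.inl (hS.mem l hl (st₁' l h2 ▸ h1))
    · intro l hl
      rw [st₁, h₁]
      split_ifs
      · omega
      · exact hS.st_le l hl
    · intro l hl h1 j hj h2
      rw [r₁] at h2
      by_cases h3 : l = k + 1
      · exact absurd (hS.row_zero l hl (by omega) j hj) h2
      · rw [st₁' l h3] at h1 ⊢
        have h4 := hS.ref l hl h1 j hj h2
        have h5 : j ≠ k + 1 := by
          rintro rfl
          rw [hst0] at h4
          omega
        rwa [st₁' j h5]
    · intro l hl hkl
      rw [r₁]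
      exact hS.row_zero l hl (by omega)
  have hM : statSum x (s₁.arr .st) (Function.update e (k + 1) d) (2 * s₁.var .h + 3) =
      μ (s.var .h) := by
    rw [← h.scale _ le_rfl, h₁]
    refine (statSum_congr (fun j hj => ?_) fun j hj h1 => (hup j ?_).symm).symm
    · by_cases h1 : j = k + 1
      · rw [h1, hst0, st₁'']; omega
      · rw [st₁' j h1]
    · rintro rfl
      omega
  have hkeep : ∀ l < size x, s₁.arr .st l ≠ 0 → s₁.arr .f l = 0 →
      rowSum x (s₁.arr .row) (Function.update e (k + 1) d) l =
        (Function.update e (k + 1) d l : ℤ) := by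
    intro l hl hl0 hl1
    have h1 : l ≠ k + 1 := fun h1 => (f₁' l hl).2 h1 hl1
    rw [st₁' l h1] at hl0
    rw [r₁, hup l h1, ← h.sum l hl hl0]
    refine rowSum_congr fun j hj h2 => hup j ?_
    rintro rfl
    have := hS.ref l hl hl0 _ hj h2
    omega
  have hflag : ∀ l < size x, s₁.arr .f l ≠ 0 →
      rowSum x (s₁.arr .row) (Function.update e (k + 1) d) l = (0 : ℤ) := by
    intro l hl h1
    rw [(f₁' l hl).1 h1, r₁, rowSum, Int.cast_zero]
    refine Finset.sum_eq_zero fun j hj => ?_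
    rw [hS.row_zero _ hkN (Nat.lt_succ_self k) j (Finset.mem_range.1 hj)]
    simp
  -- outside the new letter nothing changes
  obtain ⟨e₁, he₁⟩ : ∃ e₁ : ℕ → ℤ, ∀ l, e₁ l =
    if s₁.arr .f l ≠ 0 then 0 + μ (s.var .h) else Function.update e (k + 1) d l :=
    ⟨_, fun _ => rfl⟩
  obtain ⟨L', shape', sorted', row', sum'⟩ := shift_resort (e₀ := fun _ => 0)
    shape hd hkx
    (fun m => by rw [r₁]; exact Nat.succ_le_succ (h.row_le m))
    (fun l hl h1 => by rw [(f₁' l hl).1 h1, st₁'', h₁]) hM hkeep hflag (by simp) he₁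
  have h₂ : (resort.eval x (shift.eval x s₁)).var .h = s.var .h :=
    ((Cmd.eval_var x _ _ (by decide)).trans (Cmd.eval_var x _ _ (by decide))).trans h₁
  have st₂ : (resort.eval x (shift.eval x s₁)).arr .st = s₁.arr .st :=
    (Cmd.eval_arr x _ _ (by decide)).trans (Cmd.eval_arr x _ _ (by decide))
  have k₂ : (resort.eval x (shift.eval x s₁)).arr .stk = s.arr .stk :=
    ((Cmd.eval_arr x _ _ (by decide)).trans (Cmd.eval_arr x _ _ (by decide))).trans k₁
  have he₁' : ∀ l < size x, l ≠ k + 1 → e₁ l = e l := fun l hl h1 => by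
    rw [he₁, if_neg (fun h2 => h1 ((f₁' l hl).1 h2)), hup l h1]
  have he₁'' : e₁ (k + 1) = μ (s.var .h) := by
    rw [he₁, if_pos ((f₁' _ hkN).2 rfl), zero_add]
  have other : ∀ key ≠ 2 * s.var .h + 2, key ≠ 0 →
      statSum x (s₁.arr .st) e₁ key = statSum x (s.arr .st) e key := by
    intro key h1 h2
    refine (statSum_congr (fun j hj => ?_) fun j hj h3 => (he₁' j hj ?_).symm).symm
    · by_cases h3 : j = k + 1
      · rw [h3, hst0, st₁'']; omega
      · rw [st₁' j h3]
    · rintro rfl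
      omega
  have top : statSum x (s₁.arr .st) e₁ (2 * s.var .h + 2) =
      statSum x (s.arr .st) e (2 * s.var .h + 2) + 2 ^ μ (s.var .h) * sgn x (k + 1) := by
    have h3 : statSum x (s₁.arr .st) e₁ (2 * s.var .h + 2) = statSum x (s₁.arr .st)
        (Function.update e (k + 1) (μ (s.var .h))) (2 * s.var .h + 2) := by
      refine statSum_congr (fun _ _ => Iff.rfl) fun j hj _ => ?_
      by_cases h4 : j = k + 1
      · rw [h4, he₁'', Function.update_self]
      · rw [he₁' j hj h4, Function.update_of_ne h4]
    rw [h3, statSum_insert hkN (by omega) st₁'' st₁' (fun j hj => Function.update_of_ne hj _ _),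
      Function.update_self, mul_comm (sgn x (k + 1) : ℚ)]
  refine ⟨L', e₁, μ, shape', sorted', row', by rw [st₂]; exact sum', ?_, by
    rw [h₂, k₂]; exact h.stk, ?_⟩
  · intro j hj
    rw [h₂] at hj
    rw [st₂, other _ (by omega) (by omega), h.scale j hj]
  · rw [st₂, h₂, k₂, top]
    have h3 := h.stack.mul (rep_zpow (sgn x (k + 1)))
    rw [Dyad.mul_def] at h3
    dsimp only at h3
    rw [add_zero] at h3
    convert h3 using 1
    exact pieces_congr (fun j hj => other _ (by omega) (by omega)) (fun _ _ => rfl) fun _ _ => rfl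

end Baumslag

/-! ### Multiplication by a power of `b` -/

namespace Baumslag

open RAM

variable {x : List ℕ} {s : Store Var Arr} {L : List ℕ} {e e' : ℕ → ℤ} {k : ℕ} {X : Grp} {μ : ℕ → ℤ}

theorem popInt_spec (hh : s.var .h ≤ x.length) :
    (popInt.eval x s).var .h = s.var .h - 1 ∧
    ∀ l < size x, (popInt.eval x s).arr .st l =
      if s.arr .st l = 2 * s.var .h + 3 then 1
      else if s.arr .st l = 2 * s.var .h + 2 then 2 * s.var .h + 1 else s.arr .st l := by
  have h16 : ((1 : Fin 16) : ℕ) = 1 := rfl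
  have h16' : ((2 : Fin 16) : ℕ) = 2 := rfl
  have h16'' : ((3 : Fin 16) : ℕ) = 3 := rfl
  have key := Cmd.loop_induction (x := x) (v := Var.i) (s := s) (c := popIntBody)
    (fun i t => ∀ l, t.arr .st l = if l < i then
      if s.arr .st l = 2 * s.var .h + 3 then 1
      else if s.arr .st l = 2 * s.var .h + 2 then 2 * s.var .h + 1 else s.arr .st l
      else s.arr .st l) (by simp) ?_
  · simp only [popInt, Cmd.eval_seq]
    have h₁ : (Cmd.eval x (.loop .i popIntBody) s).var .h = s.var .h :=
      Cmd.eval_var x _ _ (by decide)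
    generalize Cmd.eval x (.loop .i popIntBody) s = s₁ at *
    refine ⟨by simp [h₁], fun l hl => ?_⟩
    rw [Cmd.eval_set, Store.setVar_arr, key l, if_pos hl]
  · intro i hi t ht ih l
    have hht : (t.setVar .i i).var .h = s.var .h := by
      simpa using ht.var .h (by decide)
    have k3 := eval_key x (t.setVar .i i) (hht ▸ hh) 3
    have k2 := eval_key x (t.setVar .i i) (hht ▸ hh) 2
    have k1 := eval_key x (t.setVar .i i) (hht ▸ hh) 1
    rw [hht, h16] at k1
    rw [hht, h16'] at k2
    rw [hht, h16''] at k3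
    have ihi := ih i
    rw [if_neg (lt_irrefl i)] at ihi
    have ihl := ih l
    simp only [popIntBody, Cmd.eval_ite, Cmd.eval_put, Cmd.eval_skip, Ex.eval_eq, k1, k2, k3,
      Ex.eval_get, Ex.eval_var, Ex.eval_lit, Store.setVar_arr, Store.setVar_var, if_true, ihi, h16]
    by_cases hli : l = i
    · subst hli
      by_cases c3 : s.arr .st l = 2 * s.var .h + 3
      · simp [c3]
      · by_cases c2 : s.arr .st l = 2 * s.var .h + 2
        · simp [c2]
        · simp [c2, c3, ihi]
    · have : l < i + 1 ↔ l < i := by omega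
      simp only [this]
      rw [← ihl]
      split_ifs <;> simp [hli]

/-- The pinch `b (r, 0) b⁻¹` with an integer `r`. -/
theorem Inv.popInt (h : Inv x k X s L e μ) (hkx : k < x.length) {K : ℤ} (hn : 0 < s.var .h)
    (hstk : s.arr .stk (s.var .h) = 3) (hμ : μ (s.var .h) = 0)
    (hK : statSum x (s.arr .st) e (2 * s.var .h + 2) = K) :
    ∃ L' e' μ', Inv x (k + 1) (X * gb⁻¹) (popInt.eval x s) L' e' μ' := by
  have hS := h.shape
  have hN : size x = x.length + 16 := rfl
  have hh : s.var .h ≤ x.length := hS.h_le.trans hkx.le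
  obtain ⟨h₁, st₁⟩ := popInt_spec hh
  have l₁ : (Baumslag.popInt.eval x s).var .len = s.var .len := Cmd.eval_var x _ _ (by decide)
  have a₁ : ∀ a ≠ Arr.st, (Baumslag.popInt.eval x s).arr a = s.arr a := fun a ha =>
    Cmd.eval_arr x _ _ (by
      have : Baumslag.popInt.arrs = [.st, .st] := by decide
      simp [this, ha])
  obtain ⟨j, hj⟩ : ∃ j, s.var .h = j + 1 := ⟨s.var .h - 1, by omega⟩
  rw [hj] at h₁
  simp only [hj] at st₁
  generalize Baumslag.popInt.eval x s = s₁ at *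
  have hlt : ∀ l < size x, s.arr .st l ≤ 2 * (j + 1) + 3 := hj ▸ hS.st_le
  have cases₁ : ∀ l < size x, (s.arr .st l = 2 * j + 5 ∧ s₁.arr .st l = 1) ∨
      (s.arr .st l = 2 * j + 4 ∧ s₁.arr .st l = 2 * j + 3) ∨
      (s.arr .st l < 2 * j + 4 ∧ s₁.arr .st l = s.arr .st l) := fun l hl => by
    have h1 := st₁ l hl
    have h2 := hlt l hl
    split_ifs at h1 <;> omega
  have other : ∀ key, key ≠ 1 → key < 2 * j + 3 →
      statSum x (s₁.arr .st) e key = statSum x (s.arr .st) e key := fun key h1 h2 =>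
    statSum_congr (fun l hl => by have := cases₁ l hl; omega) fun _ _ _ => rfl
  have top : statSum x (s₁.arr .st) e (2 * j + 3) = μ j + K := by
    rw [statSum_union (st := s.arr .st) (key₁ := 2 * j + 3) (key₂ := 2 * j + 4) (M := 0)
      (fun l hl => by have := cases₁ l hl; omega) (by omega) (fun _ _ _ => rfl)
      (fun _ _ _ => (add_zero _).symm), h.scale j (by omega), zpow_zero, one_mul, ← hK, hj]
    rfl
  have r₁ := a₁ .row (by decide)
  refine ⟨L, e, Function.update μ j (μ j + K), ⟨by have := hS.h_le; omega,
    fun l hl => (hS.le l hl).trans (Nat.le_succ k), fun l hl h0 => hS.mem l hl ?_, ?_, ?_, ?_, ?_⟩,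
    h.sorted.congr l₁ (a₁ _ (by decide)) (a₁ _ (by decide)),
    fun m => by rw [r₁]; exact (h.row_le m).trans (Nat.le_succ k), ?_, ?_, ?_, ?_⟩
  · have := cases₁ l hl
    omega
  · intro l hl
    have := cases₁ l hl
    omega
  · have := cases₁ 0 (by omega)
    have := hS.st_zero
    omega
  · intro l hl h0 i hi hr
    rw [r₁] at hr
    have h1 := cases₁ l hl
    have h2 := cases₁ i hi
    rcases hS.ref l hl (by omega) i hi hr with h3 | ⟨p, h3, h4⟩
    · left
      omega
    · by_cases h5 : p = j + 1
      · left
        omega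
      · right
        exact ⟨p, by omega, by omega⟩
  · intro l hl hkl
    rw [r₁]
    exact hS.row_zero l hl (by omega)
  · intro l hl h0
    rw [r₁]
    refine h.sum l hl ?_
    have := cases₁ l hl
    omega
  · intro i hi
    rw [h₁] at hi
    rcases (show i ≤ j by omega).eq_or_lt with rfl | h2
    · rw [top, Function.update_self]
      push_cast
      rfl
    · rw [Function.update_of_ne h2.ne, other _ (by omega) (by omega), h.scale i (by omega)]
  · intro i hi
    rw [a₁ _ (by decide)]
    exact h.stk i (by omega)
  · have h3 := h.stack
    rw [hj, pieces, ← hj, hstk, if_pos rfl] at h3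
    have h4 := h3.pop_one hμ hK
    rw [Dyad.mul_def] at h4
    dsimp only at h4
    rw [mul_zero, add_zero] at h4
    rw [h₁, Nat.add_sub_cancel, Function.update_self, other _ (by omega) (by omega)]
    convert h4 using 1
    exact pieces_congr (fun i hi => other _ (by omega) (by omega))
      (fun i hi => Function.update_of_ne hi.ne _ _) fun i hi => by rw [a₁ _ (by decide)]

theorem popScale_spec (hh : s.var .h ≤ x.length) :
    ∀ l < size x, ((Cmd.loop Var.i popScaleBody).eval x s).arr .st l =
      (if s.arr .st l = 2 * s.var .h + 2 then 0
        else if s.arr .st l = 2 * s.var .h + 3 then 2 * s.var .h else s.arr .st l) ∧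
      (((Cmd.loop Var.i popScaleBody).eval x s).arr .f l ≠ 0 ↔ s.arr .st l = 2 * s.var .h + 3) := by
  have h16' : ((2 : Fin 16) : ℕ) = 2 := rfl
  have h16'' : ((3 : Fin 16) : ℕ) = 3 := rfl
  have h16 : ((1 : Fin 16) : ℕ) = 1 := rfl
  have key := Cmd.loop_induction (x := x) (v := Var.i) (s := s) (c := popScaleBody)
    (fun i t => ∀ l, t.arr .st l = (if l < i then
      if s.arr .st l = 2 * s.var .h + 2 then 0
      else if s.arr .st l = 2 * s.var .h + 3 then 2 * s.var .h else s.arr .st l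
      else s.arr .st l) ∧ (l < i → (t.arr .f l ≠ 0 ↔ s.arr .st l = 2 * s.var .h + 3)))
    (by simp) ?_
  · intro l hl
    have := key l
    rw [if_pos hl] at this
    exact ⟨this.1, this.2 hl⟩
  · intro i hi t ht ih l
    have hht : t.var .h = s.var .h := ht.var .h (by decide)
    obtain ⟨u, hu⟩ : ∃ u, u = Cmd.eval x (.put .f (.var .i) (.lit 0)) (t.setVar .i i) := ⟨_, rfl⟩
    have hhu : u.var .h = s.var .h := by rw [hu]; simp [hht]
    have k3 := eval_key x u (hhu ▸ hh) 3
    have k2 := eval_key x u (hhu ▸ hh) 2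
    have hcap : 2 * s.var .h ≤ cap x := by have := two_mul_length_add_le_cap x; omega
    have k0 : ((.var .h + .var .h : E)).eval x u = 2 * s.var .h := by
      rw [Ex.eval_add, Ex.eval_var, hhu, ← two_mul, min_eq_left hcap]
    rw [hhu, h16'] at k2
    rw [hhu, h16''] at k3
    have su : ∀ l, u.arr .st l = t.arr .st l := fun l => by rw [hu]; simp
    have fu : ∀ l, u.arr .f l = if l = i then 0 else t.arr .f l := fun l => by rw [hu]; simp
    have iu : u.var .i = i := by rw [hu]; simp
    have ihi := (ih i).1
    rw [if_neg (lt_irrefl i)] at ihi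
    have ihl := ih l
    rw [popScaleBody, Cmd.eval_seq, ← hu]
    simp only [Cmd.eval_ite, Cmd.eval_put, Cmd.eval_skip, Cmd.eval_seq, Ex.eval_eq, k0, k2, k3,
      Ex.eval_get, Ex.eval_var, Ex.eval_lit, iu, su, ihi, h16]
    clear hu
    by_cases hli : l = i
    · subst hli
      by_cases c2 : s.arr .st l = 2 * s.var .h + 2
      · simp [c2, fu]
      · by_cases c3 : s.arr .st l = 2 * s.var .h + 3
        · simp [c3, iu]
        · simp [c2, c3, su, fu, ihi]
    · have : l < i + 1 ↔ l < i := by omega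
      simp only [this]
      rw [← ihl.1]
      split_ifs <;> simp [hli, su, fu, iu] <;> exact fun h => (by simpa using ihl.2 h)

/-- The pinch `b⁻¹ (0, m) b`. -/
theorem Inv.popScale (h : Inv x k X s L e μ) (hkx : k < x.length) (hn : 0 < s.var .h)
    (hstk : s.arr .stk (s.var .h) = 2)
    (hr : statSum x (s.arr .st) e (2 * s.var .h + 2) = 0) :
    ∃ L' e' μ', Inv x (k + 1) (X * gb) (popScale.eval x s) L' e' μ' := by
  have hS := h.shape
  have hN : size x = x.length + 16 := rfl
  have hh : s.var .h ≤ x.length := hS.h_le.trans hkx.le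
  have spec := popScale_spec hh
  simp only [Baumslag.popScale, Cmd.eval_seq]
  generalize hs₁ : Cmd.eval x (.set Var.h _) (Cmd.eval x (.loop .i popScaleBody) s) = s₁
  have h₁ : s₁.var .h = s.var .h - 1 := by
    rw [← hs₁, Cmd.eval_set, Ex.eval_sub, Ex.eval_var, Cmd.eval_var x _ _ (by decide)]
    simp
  have l₁ : s₁.var .len = s.var .len := by
    rw [← hs₁, Cmd.eval_set]
    simpa using Cmd.eval_var x _ _ (by decide)
  have a₁ : ∀ a ≠ Arr.st, a ≠ .f → s₁.arr a = s.arr a := fun a ha ha' => by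
    rw [← hs₁, Cmd.eval_set, Store.setVar_arr]
    refine Cmd.eval_arr x _ _ ?_
    have : popScaleBody.arrs = [.f, .st, .st, .f] := by decide
    simp [Cmd.arrs, this, ha, ha']
  have st₁ : ∀ l < size x, s₁.arr .st l = if s.arr .st l = 2 * s.var .h + 2 then 0
      else if s.arr .st l = 2 * s.var .h + 3 then 2 * s.var .h else s.arr .st l := fun l hl => by
    rw [← hs₁, Cmd.eval_set, Store.setVar_arr]
    exact (spec l hl).1
  have f₁ : ∀ l < size x, s₁.arr .f l ≠ 0 ↔ s.arr .st l = 2 * s.var .h + 3 := fun l hl => by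
    rw [← hs₁, Cmd.eval_set, Store.setVar_arr]
    exact (spec l hl).2
  clear hs₁ spec
  obtain ⟨j, hj⟩ : ∃ j, s.var .h = j + 1 := ⟨s.var .h - 1, by omega⟩
  rw [hj, Nat.add_sub_cancel] at h₁
  simp only [hj] at st₁ f₁
  have hlt : ∀ l < size x, s.arr .st l ≤ 2 * (j + 1) + 3 := hj ▸ hS.st_le
  have cases₁ : ∀ l < size x, (s.arr .st l = 2 * j + 4 ∧ s₁.arr .st l = 0) ∨
      (s.arr .st l = 2 * j + 5 ∧ s₁.arr .st l = 2 * j + 2) ∨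
      (s.arr .st l < 2 * j + 4 ∧ s₁.arr .st l = s.arr .st l) := fun l hl => by
    have h1 := st₁ l hl
    have h2 := hlt l hl
    split_ifs at h1 <;> omega
  have f₁' : ∀ l < size x, s₁.arr .f l ≠ 0 ↔ s.arr .st l = 2 * j + 5 := f₁
  have r₁ := a₁ .row (by decide) (by decide)
  have shape : Shape x (k + 1) s₁ L := by
    refine ⟨by have := hS.h_le; omega, fun l hl => (hS.le l hl).trans (Nat.le_succ k),
      fun l hl h0 => hS.mem l hl ?_, ?_, ?_, ?_, ?_⟩
    · have := cases₁ l hl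
      omega
    · intro l hl
      have := cases₁ l hl
      omega
    · have := cases₁ 0 (by omega)
      have := hS.st_zero
      omega
    · intro l hl h0 i hi hr
      rw [r₁] at hr
      have h1 := cases₁ l hl
      have h2 := cases₁ i hi
      rcases hS.ref l hl (by omega) i hi hr with h3 | ⟨p, h3, h4⟩
      · left
        omega
      · right
        exact ⟨p, by omega, by omega⟩
    · intro l hl hkl
      rw [r₁]
      exact hS.row_zero l hl (by omega)
  have other₀ : ∀ key, key ≠ 0 → key < 2 * j + 4 → key ≠ 2 * j + 2 →
      statSum x (s₁.arr .st) e key = statSum x (s.arr .st) e key := fun key h1 h2 h3 =>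
    statSum_congr (fun l hl => by have := cases₁ l hl; omega) fun _ _ _ => rfl
  obtain ⟨e₁, he₁⟩ : ∃ e₁ : ℕ → ℤ, ∀ l, e₁ l = if s₁.arr .f l ≠ 0 then e l + μ j else e l :=
    ⟨_, fun _ => rfl⟩
  have he₁' : ∀ l < size x, s.arr .st l ≠ 2 * j + 5 → e₁ l = e l := fun l hl h1 => by
    rw [he₁, if_neg (fun h2 => h1 ((f₁' l hl).1 h2))]
  obtain ⟨L', shape', sorted', row', sum'⟩ := shift_resort (e₀ := e) shape
    (h.sorted.congr l₁ (a₁ _ (by decide) (by decide)) (a₁ _ (by decide) (by decide))) hkx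
    (fun m => by rw [r₁]; exact Nat.succ_le_succ (h.row_le m))
    (fun l hl h1 => by have := cases₁ l hl; have := (f₁' l hl).1 h1; omega)
    (by rw [h₁, other₀ _ (by omega) (by omega) (by omega)]; exact h.scale j (by omega))
    (fun l hl h0 _ => by
      rw [r₁]; exact h.sum l hl (by have := cases₁ l hl; omega))
    (fun l hl h0 => by
      rw [r₁]; exact h.sum l hl (by have := (f₁' l hl).1 h0; omega))
    (fun _ _ _ _ _ _ h1 => h1) he₁
  have other : ∀ key, key ≠ 0 → key < 2 * j + 4 → key ≠ 2 * j + 2 →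
      statSum x (s₁.arr .st) e₁ key = statSum x (s.arr .st) e key := fun key h1 h2 h3 =>
    (statSum_congr (fun l hl => by have := cases₁ l hl; omega) fun l hl h4 =>
      (he₁' l hl (by omega)).symm).symm
  have top : statSum x (s₁.arr .st) e₁ (2 * j + 2) =
      statSum x (s.arr .st) e (2 * j + 2) + 2 ^ μ j * μ (j + 1) := by
    rw [statSum_union (st := s.arr .st) (key₁ := 2 * j + 2) (key₂ := 2 * j + 5) (e := e) (M := μ j)
      (fun l hl => by have := cases₁ l hl; omega) (by omega)
      (fun l hl h1 => he₁' l hl (by omega))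
      (fun l hl h1 => by rw [he₁, if_pos ((f₁' l hl).2 h1)]), ← h.scale (j + 1) (by omega)]
    rfl
  have h₂ : (resort.eval x (shift.eval x s₁)).var .h = j :=
    ((Cmd.eval_var x _ _ (by decide)).trans (Cmd.eval_var x _ _ (by decide))).trans h₁
  have st₂ : (resort.eval x (shift.eval x s₁)).arr .st = s₁.arr .st :=
    (Cmd.eval_arr x _ _ (by decide)).trans (Cmd.eval_arr x _ _ (by decide))
  have k₂ : (resort.eval x (shift.eval x s₁)).arr .stk = s.arr .stk :=
    ((Cmd.eval_arr x _ _ (by decide)).trans (Cmd.eval_arr x _ _ (by decide))).trans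
      (a₁ _ (by decide) (by decide))
  refine ⟨L', e₁, μ, shape', sorted', row', by rw [st₂]; exact sum', ?_, ?_, ?_⟩
  · intro i hi
    rw [h₂] at hi
    rw [st₂, other _ (by omega) (by omega) (by omega), h.scale i (by omega)]
  · intro i hi
    rw [k₂]
    exact h.stk i (by omega)
  · have h3 := h.stack
    rw [hr, hj, pieces, ← hj, hstk, if_neg (by decide), hj] at h3
    have h4 := h3.pop_neg_one rfl
    rw [Dyad.mul_def] at h4
    dsimp only at h4
    rw [add_zero] at h4
    rw [st₂, h₂, k₂, top]
    convert h4 using 1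
    exact pieces_congr (fun i hi => other _ (by omega) (by omega) (by omega)) (fun _ _ => rfl)
      fun _ _ => rfl

end Baumslag

/-! ### Detection of pinches and of the identity -/

namespace Baumslag

open RAM

variable {x : List ℕ} {s : Store Var Arr} {L : List ℕ} {e e' : ℕ → ℤ} {k : ℕ} {X : Grp} {μ : ℕ → ℤ}

open Classical in
/-- The outcome of a test, in the form in which the program uses it. -/
theorem Inv.test (h : Inv x k X s L e μ) (ex : E) {key : ℕ} (hk : ex.eval x s = key)
    (hkey : key ≠ 0) :
    (((test ex).eval x s).var .flag =
      if ∃ M : ℤ, statSum x (s.arr .st) e key = M then 1 else 0) ∧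
    ((∃ M : ℤ, statSum x (s.arr .st) e key = M) →
      1 - min (((test ex).eval x s).var .p + ((test ex).eval x s).var .q) (cap x) =
        if statSum x (s.arr .st) e key = 0 then 1 else 0) := by
  have hcap := le_cap_of_le x (c := 1) (by norm_num)
  have spec := test_spec h.sorted ex fun j hj h1 => h.shape.mem j hj (by rwa [h1, hk])
  rw [hk] at spec
  rcases spec with ⟨h1, M, hM, h2⟩ | ⟨h1, h2⟩
  · have hM' : ∃ M : ℤ, statSum x (s.arr .st) e key = M := ⟨M, hM⟩
    rw [if_pos hM']
    refine ⟨h1, fun _ => ?_⟩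
    have : statSum x (s.arr .st) e key = 0 ↔ M = 0 := by rw [hM, Int.cast_eq_zero]
    split_ifs with h3
    · have := h2.2 (this.1 h3)
      omega
    · have := mt h2.1 (mt this.2 h3)
      omega
  · rw [if_neg h2]
    exact ⟨h1, fun h3 => absurd h3 h2⟩

theorem eval_test_var (ex : E) {w : Var} (hw : w ∉ (Baumslag.test (.lit 0)).vars) :
    ((Baumslag.test ex).eval x s).var w = s.var w := Cmd.eval_var x (Baumslag.test ex) s hw

theorem eval_test_arr (ex : E) {a : Arr} (ha : a ≠ .p) (ha' : a ≠ .q) :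
    ((Baumslag.test ex).eval x s).arr a = s.arr a := by
  refine Cmd.eval_arr x (Baumslag.test ex) s ?_
  have : (Baumslag.test ex).arrs = [.p, .q, .p, .q] := rfl
  simp [this, ha, ha']

theorem Inv.eval_test (h : Inv x k X s L e μ) (ex : E) :
    Inv x k X ((Baumslag.test ex).eval x s) L e μ :=
  h.congr (eval_test_var ex (by decide)) (eval_test_var ex (by decide))
    fun _ ha ha' => eval_test_arr ex ha ha'

theorem Inv.setVar (h : Inv x k X s L e μ) {w : Var} (n : ℕ) (hw : w ≠ .h)
    (hw' : w ≠ .len) : Inv x k X (s.setVar w n) L e μ :=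
  h.congr (by simp [hw.symm]) (by simp [hw'.symm]) (by simp)

theorem min_mul_eq_one {p q : Prop} [Decidable p] [Decidable q] {C : ℕ} (hC : 1 ≤ C) :
    min ((if p then 1 else 0) * (if q then 1 else 0)) C = if p ∧ q then 1 else 0 := by
  by_cases hp : p <;> by_cases hq : q <;> simp [hp, hq, hC]

/-- The condition for a pinch at the top of the stack, if `c` is the code of the next letter. -/
def Pinch (x : List ℕ) (s : Store Var Arr) (e μ : ℕ → ℤ) (c : ℕ) : Prop :=
  0 < s.var .h ∧ s.arr .stk (s.var .h) ≠ c ∧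
    (c = 2 → μ (s.var .h) = 0 ∧ ∃ M : ℤ, statSum x (s.arr .st) e (2 * s.var .h + 2) = M) ∧
    (c ≠ 2 → statSum x (s.arr .st) e (2 * s.var .h + 2) = 0)

theorem Inv.testPinch (h : Inv x k X s L e μ) (hkx : k ≤ x.length) :
    Inv x k X (testPinch.eval x s) L e μ ∧
      ((testPinch.eval x s).var .ok ≠ 0 ↔ Pinch x s e μ (s.var .c)) := by
  classical
  have hcap := le_cap_of_le x (c := 1) (by norm_num)
  have hh := h.shape.h_le.trans hkx
  have h16 : ((1 : Fin 16) : ℕ) = 1 := rfl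
  have h16' : ((2 : Fin 16) : ℕ) = 2 := rfl
  have h16'' : ((3 : Fin 16) : ℕ) = 3 := rfl
  simp only [Baumslag.testPinch, Cmd.eval_seq]
  generalize hs₁ : Cmd.eval x (.set Var.ok (.lit 0 : E)) s = s₁
  have ok₁ : s₁.var .ok = 0 := by rw [← hs₁]; simp
  have h₁ : s₁.var .h = s.var .h := by rw [← hs₁]; simp
  have c₁ : s₁.var .c = s.var .c := by rw [← hs₁]; simp
  have a₁ : s₁.arr = s.arr := by rw [← hs₁]; simp
  have i₁ : Inv x k X s₁ L e μ := by
    rw [← hs₁]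
    exact h.setVar _ (by decide) (by decide)
  clear hs₁
  have P : Pinch x s e μ (s.var .c) ↔ Pinch x s₁ e μ (s₁.var .c) := by
    unfold Pinch
    rw [a₁, h₁, c₁]
  rw [P]
  rw [← h₁] at hh
  clear P h₁ c₁ a₁ h
  have k2 := eval_key x s₁ hh 2
  have k3 := eval_key x s₁ hh 3
  rw [h16'] at k2
  rw [h16''] at k3
  simp only [Cmd.eval_ite, Cmd.eval_skip, Ex.eval_eq, Ex.eval_var, Ex.eval_get, Ex.eval_lit, h16']
  by_cases hz : s₁.var .h = 0
  · simp only [hz, if_true]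
    exact ⟨i₁, by simp [ok₁, Pinch, hz]⟩
  simp only [hz, if_false]
  by_cases hc : s₁.arr .stk (s₁.var .h) = s₁.var .c
  · simp only [hc, if_true, one_ne_zero, if_false]
    exact ⟨i₁, by simp [ok₁, Pinch, hc]⟩
  simp only [hc, if_false, if_true]
  by_cases hc2 : s₁.var .c = 2
  · simp only [hc2, if_true, one_ne_zero, if_false, Cmd.eval_seq]
    obtain ⟨_, t2⟩ := i₁.test _ k3 (by omega)
    have i₂ := i₁.eval_test (.var .h + .var .h + .lit 3)
    have h₂ := eval_test_var (x := x) (s := s₁) (.var .h + .var .h + .lit 3) (w := .h) (by decide)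
    have st₂ := eval_test_arr (x := x) (s := s₁) (.var .h + .var .h + .lit 3) (a := .st) (by decide)
      (by decide)
    generalize Cmd.eval x (Baumslag.test (.var .h + .var .h + .lit 3)) s₁ = s₂ at *
    have i₃ := i₂.setVar (w := .ok) (1 - min (s₂.var .p + s₂.var .q) (cap x)) (by decide)
      (by decide)
    simp only [Cmd.eval_set, Ex.eval_sub, Ex.eval_lit, Ex.eval_add, Ex.eval_var, h16]
    have ok₃ : (s₂.setVar .ok (1 - min (s₂.var .p + s₂.var .q) (cap x))).var .ok =
        if μ (s₁.var .h) = 0 then 1 else 0 := by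
      rw [Store.setVar_var, if_pos rfl, t2 ⟨_, i₁.scale _ le_rfl⟩, i₁.scale _ le_rfl]
      simp
    have h₃ : (s₂.setVar .ok (1 - min (s₂.var .p + s₂.var .q) (cap x))).var .h = s₁.var .h := by
      simp [h₂]
    have st₃ : (s₂.setVar .ok (1 - min (s₂.var .p + s₂.var .q) (cap x))).arr .st = s₁.arr .st := by
      simp [st₂]
    generalize s₂.setVar .ok (1 - min (s₂.var .p + s₂.var .q) (cap x)) = s₃ at *
    have k2' := eval_key x s₃ (h₃ ▸ hh) 2
    rw [h16', h₃] at k2'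
    obtain ⟨t1, _⟩ := i₃.test _ k2' (by omega)
    have ok₄ := eval_test_var (x := x) (s := s₃) (.var .h + .var .h + .lit 2) (w := .ok) (by decide)
    refine ⟨(i₃.eval_test _).setVar _ (by decide) (by decide), ?_⟩
    rw [Store.setVar_var, if_pos rfl, Ex.eval_mul, Ex.eval_var, Ex.eval_var, ok₄, t1, ok₃, st₃,
      min_mul_eq_one hcap]
    simp [Pinch, hz, hc2 ▸ hc, Nat.pos_iff_ne_zero]
  · simp only [hc2, if_true, if_false, Cmd.eval_seq]
    obtain ⟨t1, t2⟩ := i₁.test _ k2 (by omega)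
    refine ⟨(i₁.eval_test _).setVar _ (by decide) (by decide), ?_⟩
    rw [Cmd.eval_set, Store.setVar_var, if_pos rfl, Ex.eval_mul, Ex.eval_var, Ex.eval_sub,
      Ex.eval_add, Ex.eval_var, Ex.eval_var, Ex.eval_lit, h16, t1]
    by_cases h0 : statSum x (s₁.arr .st) e (2 * s₁.var .h + 2) = 0
    · have hM : ∃ M : ℤ, statSum x (s₁.arr .st) e (2 * s₁.var .h + 2) = M := ⟨0, by simpa using h0⟩
      rw [t2 hM, min_mul_eq_one hcap]
      simp [Pinch, h0, hz, hc, hc2, Nat.pos_iff_ne_zero]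
      exact ⟨0, by simp⟩
    · by_cases hM : ∃ M : ℤ, statSum x (s₁.arr .st) e (2 * s₁.var .h + 2) = M
      · rw [t2 hM, min_mul_eq_one hcap]
        simp [Pinch, h0, hc2]
      · rw [if_neg hM]
        simp [Pinch, h0, hc2]

/-- A letter that makes no pinch is pushed. -/
theorem Inv.push (h : Inv x k X s L e μ) {c : ℕ} (hc : c = 2 ∨ c = 3)
    (hp : ¬ Pinch x s e μ c) {t : Store Var Arr} (hh : t.var .h = s.var .h + 1)
    (hl : t.var .len = s.var .len) (ha : ∀ a ≠ .stk, t.arr a = s.arr a)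
    (hstk : ∀ i, t.arr .stk i = if i = s.var .h + 1 then c else s.arr .stk i) :
    ∃ L' e' μ', Inv x (k + 1) (X * gb ^ (if c = 3 then 1 else -1 : ℤ)) t L' e' μ' := by
  have hS := h.shape
  have hN : size x = x.length + 16 := rfl
  have st₁ := ha .st (by decide)
  have r₁ := ha .row (by decide)
  have empty : ∀ key, 2 * s.var .h + 3 < key → statSum x (s.arr .st) e key = 0 := fun key hk =>
    statSum_eq_zero fun j hj => by have := hS.st_le j hj; omega
  obtain ⟨u, hu⟩ : ∃ u : ℤˣ, u = if c = 3 then 1 else -1 := ⟨_, rfl⟩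
  have hu' : (if c = 3 then 1 else -1 : ℤ) = (u : ℤ) := by rw [hu]; split_ifs <;> rfl
  refine ⟨L, e, Function.update μ (s.var .h + 1) 0, ⟨by have := hS.h_le; omega,
    fun l hl => (hS.le l hl).trans (Nat.le_succ k), st₁ ▸ hS.mem, fun l hl => ?_, st₁ ▸ hS.st_zero,
    by rw [st₁, r₁]; exact hS.ref, fun l hl hkl => by rw [r₁]; exact hS.row_zero l hl (by omega)⟩,
    h.sorted.congr hl (ha _ (by decide)) (ha _ (by decide)),
    fun m => by rw [r₁]; exact (h.row_le m).trans (Nat.le_succ k), by rw [st₁, r₁]; exact h.sum,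
    ?_, ?_, ?_⟩
  · rw [st₁, hh]
    have := hS.st_le l hl
    omega
  · intro j hj
    rw [hh] at hj
    rw [st₁]
    rcases hj.eq_or_lt with rfl | h1
    · rw [Function.update_self, empty _ (by omega), Int.cast_zero]
    · rw [Function.update_of_ne h1.ne, h.scale j (by omega)]
  · intro j hj
    rw [hh] at hj
    rw [hstk]
    split_ifs with h1
    · exact hc
    · exact h.stk j (by omega)
  · rw [hu', st₁, hh, Function.update_self, empty _ (by omega), pieces, hstk, if_pos rfl, ← hu,
      Function.update_of_ne (Nat.lt_succ_self _).ne]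
    rw [show pieces x (s.arr .st) (t.arr .stk) e (Function.update μ (s.var .h + 1) 0) (s.var .h) =
      pieces x (s.arr .st) (s.arr .stk) e μ (s.var .h) from
      pieces_congr (fun _ _ => rfl) (fun j hj => Function.update_of_ne (by omega) _ _)
        fun j hj => by rw [hstk, if_neg (by omega)]]
    refine h.stack.push ?_
    intro p hp₁ hmem
    -- the top of the stack
    rcases Nat.eq_zero_or_pos (s.var .h) with h0 | h0
    · rw [h0, pieces] at hp₁
      simp at hp₁
    obtain ⟨j, hj⟩ : ∃ j, s.var .h = j + 1 := ⟨s.var .h - 1, by omega⟩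
    have hstkj := h.stk j (by omega)
    rw [hj, pieces] at hp₁
    simp only [List.head?_cons, Option.mem_def, Option.some.injEq] at hp₁
    rw [← hp₁] at hmem ⊢
    dsimp only at hmem ⊢
    by_contra hne
    refine hp ⟨h0, ?_, ?_, ?_⟩
    · rw [hj]
      rintro rfl
      exact hne hu.symm
    · rintro rfl
      rcases hstkj with h1 | h1
      · exact absurd (by rw [hu, h1]) hne
      · rw [h1, if_pos rfl, HNNExtension.toSubgroup_one, Dyad.mem_range_ofInt] at hmem
        exact hmem
    · intro hc2
      have hc3 : c = 3 := by omega
      rcases hstkj with h1 | h1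
      · rw [h1, if_neg (by decide), HNNExtension.toSubgroup_neg_one, Dyad.mem_range_ofScale] at hmem
        exact hmem
      · exact absurd (by rw [hu, h1, hc3]) hne

/-- Multiplication by `b ^ (±1)`. -/
theorem Inv.stepB (h : Inv x k X s L e μ) (hkx : k < x.length)
    (hc : s.var .c = 2 ∨ s.var .c = 3) :
    ∃ L' e' μ', Inv x (k + 1) (X * gb ^ (if s.var .c = 3 then 1 else -1 : ℤ))
      (stepB.eval x s) L' e' μ' := by
  have hcap := size_le_cap x
  have hN : size x = x.length + 16 := rfl
  have h16 : ((1 : Fin 16) : ℕ) = 1 := rfl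
  have h16' : ((2 : Fin 16) : ℕ) = 2 := rfl
  obtain ⟨h₁, hok⟩ := h.testPinch hkx.le
  have c₁ : (Baumslag.testPinch.eval x s).var .c = s.var .c := Cmd.eval_var x _ _ (by decide)
  have v₁ : (Baumslag.testPinch.eval x s).var .h = s.var .h := Cmd.eval_var x _ _ (by decide)
  have st₁ : (Baumslag.testPinch.eval x s).arr .st = s.arr .st := Cmd.eval_arr x _ _ (by decide)
  have k₁ : (Baumslag.testPinch.eval x s).arr .stk = s.arr .stk := Cmd.eval_arr x _ _ (by decide)
  have hP : Pinch x s e μ (s.var .c) ↔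
      Pinch x (Baumslag.testPinch.eval x s) e μ (s.var .c) := by
    unfold Pinch
    rw [v₁, st₁, k₁]
  rw [hP] at hok
  rw [← c₁] at hc hok ⊢
  simp only [Baumslag.stepB, Cmd.eval_seq, Cmd.eval_ite, Ex.eval_var, Ex.eval_eq, Ex.eval_lit, h16']
  generalize Baumslag.testPinch.eval x s = s₁ at *
  clear hP c₁ v₁ st₁ k₁ h
  by_cases ho : s₁.var .ok = 0
  · simp only [ho, if_true]
    have hh : min (s₁.var .h + 1) (cap x) = s₁.var .h + 1 := by
      have := h₁.shape.h_le
      omega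
    refine h₁.push hc (fun h => hok.2 h ho) ?_ ?_ ?_ ?_
    · simp [hh]
    · simp
    · intro a ha
      funext i
      simp [ha]
    · intro i
      simp [hh]
  · simp only [ho, if_false]
    obtain ⟨p1, p2, p3, p4⟩ := hok.1 ho
    obtain ⟨j, hj⟩ : ∃ j, s₁.var .h = j + 1 := ⟨s₁.var .h - 1, by omega⟩
    have hstk := h₁.stk j (by omega)
    rw [← hj] at hstk
    by_cases hc2 : s₁.var .c = 2
    · simp only [hc2, if_true, one_ne_zero, if_false]
      obtain ⟨p5, M, p6⟩ := p3 hc2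
      simpa using h₁.popInt hkx p1 (by omega) p5 p6
    · have hc3 : s₁.var .c = 3 := by omega
      simp only [hc2, if_true, if_false]
      simpa [hc3] using h₁.popScale hkx p1 (by omega) (p4 hc2)

/-- The final test. -/
theorem Inv.finish (h : Inv x k X s L e μ) :
    (X = 1 → (finish.eval x s).var .out = 1) ∧ (X ≠ 1 → (finish.eval x s).var .out = 0) := by
  classical
  have hcap := le_cap_of_le x (c := 1) (by norm_num)
  have h16 : ((1 : Fin 16) : ℕ) = 1 := rfl
  suffices H : (Baumslag.finish.eval x s).var .out = if X = 1 then 1 else 0 by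
    rw [H]
    exact ⟨fun h => if_pos h, fun h => if_neg h⟩
  have hX := h.stack.eq_one_iff
  simp only [Baumslag.finish, Cmd.eval_seq, Cmd.eval_ite, Cmd.eval_skip, Ex.eval_var]
  generalize hs₁ : Cmd.eval x (.set Var.out (.lit 0 : E)) s = s₁
  have o₁ : s₁.var .out = 0 := by rw [← hs₁]; simp
  have h₁ : s₁.var .h = s.var .h := by rw [← hs₁]; simp
  have st₁ : s₁.arr .st = s.arr .st := by rw [← hs₁]; simp
  have i₁ : Inv x k X s₁ L e μ := by
    rw [← hs₁]
    exact h.setVar _ (by decide) (by decide)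
  clear hs₁
  by_cases h0 : s₁.var .h = 0
  · simp only [h0, if_true]
    rw [← h₁, h0, pieces, Dyad.one_def, Dyad.mk.injEq, ← st₁] at hX
    simp only [true_and, mul_zero, zero_add] at hX
    obtain ⟨t1, t2⟩ := i₁.test (.lit 2) (key := 2) rfl (by omega)
    have i₂ := i₁.eval_test (.lit 2)
    have st₂ := eval_test_arr (x := x) (s := s₁) (.lit 2) (a := .st) (by decide) (by decide)
    generalize Cmd.eval x (Baumslag.test (.lit 2)) s₁ = s₂ at *
    generalize hs₃ : Cmd.eval x (.set Var.ok (_ : E)) s₂ = s₃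
    have i₃ : Inv x k X s₃ L e μ := by
      rw [← hs₃]
      exact i₂.setVar _ (by decide) (by decide)
    have ok₃ : s₃.var .ok = if statSum x (s₁.arr .st) e 2 = 0 then 1 else 0 := by
      rw [← hs₃, Cmd.eval_set, Store.setVar_var, if_pos rfl, Ex.eval_mul, Ex.eval_var, Ex.eval_sub,
        Ex.eval_add, Ex.eval_var, Ex.eval_var, Ex.eval_lit, h16, t1]
      by_cases hM : ∃ M : ℤ, statSum x (s₁.arr .st) e 2 = M
      · rw [t2 hM, min_mul_eq_one hcap]
        simp [hM]
      · rw [if_neg hM, if_neg (fun h => hM ⟨0, by simpa using h⟩)]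
        simp
    clear hs₃
    obtain ⟨_, t3⟩ := i₃.test (.lit 3) (key := 3) rfl (by omega)
    have ok₄ := eval_test_var (x := x) (s := s₃) (.lit 3) (w := .ok) (by decide)
    have h3 : statSum x (s₃.arr .st) e 3 = μ 0 := i₃.scale 0 (Nat.zero_le _)
    rw [Cmd.eval_set, Store.setVar_var, if_pos rfl, Ex.eval_mul, Ex.eval_var, Ex.eval_sub,
      Ex.eval_add, Ex.eval_var, Ex.eval_var, Ex.eval_lit, h16, ok₄, ok₃, t3 ⟨_, h3⟩,
      min_mul_eq_one hcap, h3]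
    simp only [hX, Int.cast_eq_zero]
  · simp only [h0, if_false]
    rw [o₁, if_neg]
    rw [hX]
    rintro ⟨h2, _⟩
    obtain ⟨j, hj⟩ : ∃ j, s.var .h = j + 1 := ⟨s.var .h - 1, by omega⟩
    rw [hj, pieces] at h2
    simp at h2

end Baumslag

/-! ### Correctness of the program -/

namespace Baumslag

open RAM

/-- The element of the Baumslag group that is represented by a letter. -/
def letter (y : Fin 2 × Bool) : Grp := PresentedGroup.mk rels (FreeGroup.mk [y])

theorem mk_mk_eq_prod (w : List (Fin 2 × Bool)) :
    PresentedGroup.mk rels (FreeGroup.mk w) = (w.map letter).prod := by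
  induction w with
  | nil => exact map_one _
  | cons y w ih =>
    rw [List.map_cons, List.prod_cons, ← ih, letter, ← map_mul, FreeGroup.mul_mk]
    rfl

theorem letter_zero (u : Bool) : letter (0, u) = ga ^ (if u then 1 else -1 : ℤ) := by
  cases u
  · simp only [Bool.false_eq_true, if_false, zpow_neg, zpow_one]
    rw [letter, ga, PresentedGroup.of, FreeGroup.of, ← map_inv, FreeGroup.inv_mk]
    rfl
  · simp only [if_true, zpow_one]
    rfl

theorem letter_one (u : Bool) : letter (1, u) = gb ^ (if u then 1 else -1 : ℤ) := by
  cases u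
  · simp only [Bool.false_eq_true, if_false, zpow_neg, zpow_one]
    rw [letter, gb, PresentedGroup.of, FreeGroup.of, ← map_inv, FreeGroup.inv_mk]
    rfl
  · simp only [if_true, zpow_one]
    rfl

/-- The invariant holds at the start. -/
theorem inv_start (x : List ℕ) :
    Inv x 0 1 (Cmd.eval x (.set Var.len (.lit 1 : E))
      (Cmd.eval x (.put Arr.st (.lit 0 : E) (.lit 1)) Store.zero)) [0] (fun _ => 0) (fun _ => 0) := by
  have hN : size x = x.length + 16 := rfl
  generalize hs : Cmd.eval x (.set Var.len (.lit 1 : E)) (Cmd.eval x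
    (.put Arr.st (.lit 0 : E) (.lit 1)) Store.zero) = s
  have hl : s.var .len = 1 := by rw [← hs]; simp
  have hh : s.var .h = 0 := by rw [← hs]; simp [Store.zero]
  have hst : ∀ l, s.arr .st l = if l = 0 then 1 else 0 := fun l => by
    rw [← hs]; simp [Store.zero]
  have ha : ∀ a ≠ .st, ∀ l, s.arr a l = 0 := fun a h l => by
    rw [← hs]; simp [Store.zero, h]
  have hr : ∀ m, s.arr .row m = 0 := ha _ (by decide)
  have hsum : ∀ key, 2 ≤ key → statSum x (s.arr .st) (fun _ => 0) key = 0 := fun key hk =>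
    statSum_eq_zero fun j _ => by rw [hst]; split_ifs <;> omega
  refine ⟨⟨by simp [hh], by simp, fun l _ h => ?_, fun l _ => ?_, by simp [hst],
    fun l _ _ j _ h => absurd (hr _) h, fun l _ _ j _ => hr _⟩,
    ⟨by simp [hl], ?_, by simp, by simp [hN], by simp, rfl, by simp, by simp⟩,
    fun m => by simp [hr], fun l _ _ => by simp [rowSum, hr], fun j _ => ?_, by simp [hh], ?_⟩
  · rw [hst] at h
    simpa using h
  · rw [hst]
    split_ifs <;> omega
  · intro i hi
    simp at hi
    simp [ha .t (by decide), hi]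
  · rw [hsum _ (by omega), Int.cast_zero]
  · rw [hh, pieces, hsum _ (by omega)]
    exact .nil rep_one

/-- The invariant is preserved by every letter of the input. -/
theorem Inv.programBody {w : List (Fin 2 × Bool)} {k : ℕ} (hk : k < w.length)
    {s : Store Var Arr} {L : List ℕ} {e μ : ℕ → ℤ} {X : Grp}
    (h : Inv (w.map letterCode) k X s L e μ) :
    ∃ L' e' μ', Inv (w.map letterCode) (k + 1) (X * letter w[k])
      (programBody.eval (w.map letterCode) (s.setVar .k k)) L' e' μ' := by
  have hN : size (w.map letterCode) = (w.map letterCode).length + 16 := rfl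
  have hlen : (w.map letterCode).length = w.length := List.length_map _
  have hget : (w.map letterCode).getD k 0 = letterCode w[k] := by
    simp [List.getD_eq_getElem?_getD, hk]
  generalize w.map letterCode = x at *
  have h15 : ((15 : Fin 16) : ℕ) = 15 := rfl
  have h16 : ((1 : Fin 16) : ℕ) = 1 := rfl
  have h16' : ((2 : Fin 16) : ℕ) = 2 := rfl
  have hne : ¬ size x - 15 - 1 - k = 0 := by omega
  have hsgn : sgn x (k + 1) = if x.getD k 0 = 0 then -1 else 1 := rfl
  rw [hget] at hsgn
  have h₁ : Inv x k X ((s.setVar .k k).setVar .c (letterCode w[k])) L e μ :=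
    (h.setVar _ (by decide) (by decide)).setVar _ (by decide) (by decide)
  have hk₁ : ((s.setVar .k k).setVar .c (letterCode w[k])).var .k = k := by simp
  have hc₁ : ((s.setVar .k k).setVar .c (letterCode w[k])).var .c = letterCode w[k] := by simp
  simp only [Baumslag.programBody, Cmd.eval_ite, Cmd.eval_seq, Cmd.eval_set, Cmd.eval_skip,
    Ex.eval_sub, Ex.eval_size, Ex.eval_lit, Ex.eval_var, Ex.eval_inp, Store.setVar_var, h15, h16,
    h16', if_true, hget]
  simp only [hne, if_false]
  generalize (s.setVar .k k).setVar .c (letterCode w[k]) = s₁ at *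
  generalize w[k] = y at *
  obtain ⟨i, u⟩ := y
  obtain rfl | rfl : i = 0 ∨ i = 1 := by omega
  · have hc : ¬ 2 - letterCode (0, u) = 0 := by cases u <;> simp [letterCode]
    have hs : sgn x (k + 1) = if u then 1 else -1 := by
      rw [hsgn]
      cases u <;> simp [letterCode]
    simp only [hc, if_false]
    rw [letter_zero, ← hs]
    exact h₁.mulLetter hk₁ (by omega)
  · have hc : 2 - letterCode (1, u) = 0 := by cases u <;> simp [letterCode]
    have hs : (if s₁.var .c = 3 then 1 else -1 : ℤ) = if u then 1 else -1 := by
      rw [hc₁]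
      cases u <;> simp [letterCode]
    simp only [hc, if_true]
    rw [letter_one, ← hs]
    refine h₁.stepB (by omega) ?_
    rw [hc₁]
    cases u <;> simp [letterCode]

theorem program_spec (w : List (Fin 2 × Bool)) :
    (w ∈ wordProblem rels → (program.eval (w.map letterCode) Store.zero).var .out = 1) ∧
      (w ∉ wordProblem rels → (program.eval (w.map letterCode) Store.zero).var .out = 0) := by
  have hN : size (w.map letterCode) = w.length + 16 := by simp [size]
  have hmem : w ∈ wordProblem rels ↔ (w.map letter).prod = 1 := by
    rw [← mk_mk_eq_prod]
    rfl
  rw [hmem]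
  simp only [program, Cmd.eval_seq]
  have h0 := inv_start (w.map letterCode)
  generalize Cmd.eval (w.map letterCode) (.set Var.len (.lit 1 : E)) _ = s at *
  have key := Cmd.loop_induction (x := w.map letterCode) (v := Var.k) (s := s) (c := programBody)
    (fun k t => ∃ L e μ, Inv (w.map letterCode) (min k w.length)
      ((w.take (min k w.length)).map letter).prod t L e μ)
    ⟨_, _, _, by simpa using h0⟩ ?_
  · obtain ⟨L, e, μ, h⟩ := key
    rw [min_eq_right (by omega), List.take_length] at h
    exact h.finish
  · rintro k hk t ht ⟨L, e, μ, h⟩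
    rcases Nat.lt_or_ge k w.length with h1 | h1
    · rw [min_eq_left h1.le] at h
      rw [min_eq_left (by omega), List.take_succ_eq_append_getElem h1, List.map_append,
        List.prod_append, List.map_singleton, List.prod_singleton]
      exact h.programBody h1
    · rw [min_eq_right h1] at h
      rw [min_eq_right (by omega)]
      have h15 : ((15 : Fin 16) : ℕ) = 15 := rfl
      have h16 : ((1 : Fin 16) : ℕ) = 1 := rfl
      have h2 : size (w.map letterCode) - 15 - 1 - k = 0 := by omega
      refine ⟨L, e, μ, ?_⟩
      have h3 := h.setVar (w := .k) k (by decide) (by decide)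
      simpa [Baumslag.programBody, h15, h16, h2] using h3

theorem letterCode_le (y : Fin 2 × Bool) : letterCode y ≤ 2048 := by
  obtain ⟨i, u⟩ := y
  fin_cases i <;> cases u <;> simp [letterCode]

end Baumslag

theorem mainTheorem2 :
    RAM.DecidableInTime letterCode (wordProblem Baumslag.rels) (fun n : ℕ => (n : ℝ) ^ 3) :=
  RAM.decidableInTime_of_cmd Baumslag.program Baumslag.Var.out Baumslag.Var.code_injective
    Baumslag.Arr.code_injective Baumslag.Arr.code_lt Baumslag.letterCode_le (by decide)
    Baumslag.program_spec
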